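/- A quadrant is one of the four closed regions $\{x\ge a,\,y\le b\}$ (southeast), $\{x\le a,\,y\le b\}$ (southwest), $\{x\ge a,\,y\ge b\}$ (northeast), $\{x\le a,\,y\ge b\}$ (northwest) of $\mathbb{R}^2$ with vertex $(a,b)$. A quadrant set cover instance $(S,\mathcal{Q})$ consists of a finite set $S\subset\mathbb{R}^2$ and a finite collection $\mathcal{Q}$ of quadrants; its size is $n=|S|+|\mathcal{Q}|$. A set cover is a (multi)set of quadrants of $\mathcal{Q}$ that covers all points of $S$, and $\mathsf{opt}(S,\mathcal{Q})$ is the smallest size of one. The model of computation is a comparison-based, purely functional pointer machine: values are a null pointer, real numbers, and pointers to immutable nodes with two fields; a program is a fixed finite list of recursive functions without real constants; real numbers may only be copied and compared; each evaluation step costs one unit of time. Put $\lg n=\lfloor\log_2(n+2)\rfloor$. **Theorem.** Quadrant set cover admits an $O(1)$-approximate output-sensitive algorithm. That is, there are a program with functions build, update, solve, and absolute constants $c,C,k\in\mathbb{N}$, such that: 1. (Basic data structure.) From any instance of size $n_0$, given as a list of its points and a list of its quadrants, each without repetitions and in any order, build constructs a data structure in at most $C(n_0+1)(\lg n_0)^k$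 time. The data structure is maintained by update under arbitrary insertions and deletions of points and quadrants in polylogarithmic amortized time: for every sequence of $m$ updates after the construction, the total update time is at most $C\sum_{i=1}^m(\lg n_i)^k$, where $n_i$ is the size of the instance after the $i$-th update. 2. (Output-sensitive algorithm.) Let $(S,\mathcal{Q})$ be the current instance, of size $n$, at any time. If $(S,\mathcal{Q})$ has a set cover, then solve, run on the current data structure, outputs a set cover of size at most $c\cdot\mathsf{opt}(S,\mathcal{Q})$ in at most $C(\mathsf{opt}(S,\mathcal{Q})+1)(\lg n)^k$ time. If $(S,\mathcal{Q})$ has no set cover, then solve reports this in at most $C(\mathsf{opt}(S',\mathcal{Q})+1)(\lg n)^k$ time, where $S'\subseteq S$ is the set of points of $S$ that are covered by $\mathcal{Q}$. -/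

import Mathlib

/-! ## Quadrants and quadrant set cover -/

/-- A point of the plane. -/
abbrev Point := ℝ × ℝ

/-- An (axis-parallel, closed) quadrant: its vertex is `(vx, vy)`; it extends to the right of the
vertex if `east`, to the left otherwise, and above the vertex if `north`, below otherwise. -/
structure Quadrant where
  east : Bool
  north : Bool
  vx : ℝ
  vy : ℝ

/-- The region of the plane occupied by a quadrant. -/
def Quadrant.region (q : Quadrant) : Set Point :=
  {p | (if q.east then q.vx ≤ p.1 else p.1 ≤ q.vx) ∧ (if q.north then q.vy ≤ p.2 else p.2 ≤ q.vy)}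

/-- A quadrant set cover instance `(S, 𝒬)`. -/
structure QInstance where
  pts : Finset Point
  quads : Finset Quadrant

/-- The size of the instance, `|S| + |𝒬|`. -/
def QInstance.size (I : QInstance) : ℕ := I.pts.card + I.quads.card

/-- The quadrants satisfying `C` cover every point of `S`. -/
def Covers (C : Set Quadrant) (S : Set Point) : Prop := ∀ p ∈ S, ∃ q ∈ C, p ∈ q.region

/-- The instance has a set cover. -/
def QInstance.HasCover (I : QInstance) : Prop := Covers (I.quads : Set Quadrant) (I.pts : Set Point)

/-- The smallest number of quadrants of `Q` that cover all points of `S`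
(only used when `Q` covers `S`). -/
noncomputable def opt (S : Set Point) (Q : Finset Quadrant) : ℕ :=
  sInf {m | ∃ C : Finset Quadrant, C ⊆ Q ∧ Covers (C : Set Quadrant) S ∧ C.card = m}

/-- The points of `S` that are covered by some quadrant of `𝒬`. -/
def QInstance.coverable (I : QInstance) : Set Point :=
  {p | p ∈ I.pts ∧ ∃ q ∈ I.quads, p ∈ q.region}

/-- An update of a fully dynamic instance. -/
inductive Update
  | insertPoint (p : Point)
  | deletePoint (p : Point)
  | insertQuadrant (q : Quadrant)
  | deleteQuadrant (q : Quadrant)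

open Classical in
/-- The instance after an update (inserting an element that is present, or deleting one that is
absent, changes nothing). -/
noncomputable def QInstance.apply (I : QInstance) : Update → QInstance
  | .insertPoint p => ⟨insert p I.pts, I.quads⟩
  | .deletePoint p => ⟨I.pts.erase p, I.quads⟩
  | .insertQuadrant q => ⟨I.pts, insert q I.quads⟩
  | .deleteQuadrant q => ⟨I.pts, I.quads.erase q⟩

open Classical in
/-- The instance given by a list of points and a list of quadrants. -/
noncomputable def QInstance.ofLists (ps : List Point) (qs : List Quadrant) : QInstance :=
  ⟨ps.toFinset, qs.toFinset⟩

/-! ## The machine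

A comparison-based, purely functional pointer machine ("pure Lisp").  A value is a null pointer, a
real number, or a pointer to an immutable memory node with two fields.  A program is a finite list
of (mutually recursive) functions of one argument, and contains no real constants.  Real numbers
can be copied and compared with each other, nothing else.  Every evaluation step costs one unit and
takes constant time on a pointer machine, or on a real RAM: values are passed by reference, and the
local environment has a length bounded by the program. -/

/-- Values: the null pointer, a real number, or (a pointer to) a node with two fields. -/
inductive Val
  | nil
  | real (x : ℝ)
  | pair (a b : Val)

/-- The first field of a node (`nil` on other values). -/
def Val.fst : Val → Val
  | .pair a _ => a
  | _ => .nil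

/-- The second field of a node (`nil` on other values). -/
def Val.snd : Val → Val
  | .pair _ b => b
  | _ => .nil

/-- Expressions.  Local variables are de Bruijn indices; `letIn a b` binds index `0` in `b` to the
value of `a`; `ifPair a b c` continues with `b` if `a` is a node and with `c` otherwise;
`ifLe a b c d` compares the real numbers `a` and `b` and continues with `c` if `a ≤ b` and with `d`
otherwise; `call f a` calls function number `f` of the program on `a`. -/
inductive Expr
  | var (i : ℕ)
  | nil
  | pair (a b : Expr)
  | fst (a : Expr)
  | snd (a : Expr)
  | letIn (a b : Expr)
  | ifPair (a b c : Expr)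
  | ifLe (a b c d : Expr)
  | call (f : ℕ) (a : Expr)

/-- A program: the bodies of its functions; the argument of a function is variable `0`. -/
abbrev Program := List Expr

/-- `Eval P ρ e v t`: in the program `P` and the local environment `ρ`, the expression `e`
evaluates to the value `v` in exactly `t` steps. -/
inductive Eval (P : Program) : List Val → Expr → Val → ℕ → Prop
  | var (ρ : List Val) (i : ℕ) : Eval P ρ (.var i) (ρ.getD i .nil) 1
  | nil (ρ : List Val) : Eval P ρ .nil .nil 1
  | pair {ρ : List Val} {a b : Expr} {v w : Val} {s t : ℕ} :
      Eval P ρ a v s → Eval P ρ b w t → Eval P ρ (.pair a b) (.pair v w) (s + t + 1)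
  | fst {ρ : List Val} {a : Expr} {v : Val} {s : ℕ} :
      Eval P ρ a v s → Eval P ρ (.fst a) v.fst (s + 1)
  | snd {ρ : List Val} {a : Expr} {v : Val} {s : ℕ} :
      Eval P ρ a v s → Eval P ρ (.snd a) v.snd (s + 1)
  | letIn {ρ : List Val} {a b : Expr} {v w : Val} {s t : ℕ} :
      Eval P ρ a v s → Eval P (v :: ρ) b w t → Eval P ρ (.letIn a b) w (s + t + 1)
  | ifPair_pos {ρ : List Val} {a b c : Expr} {x y w : Val} {s t : ℕ} :
      Eval P ρ a (.pair x y) s → Eval P ρ b w t → Eval P ρ (.ifPair a b c) w (s + t + 1)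
  | ifPair_neg {ρ : List Val} {a b c : Expr} {v w : Val} {s t : ℕ} :
      Eval P ρ a v s → (∀ x y, v ≠ .pair x y) → Eval P ρ c w t →
      Eval P ρ (.ifPair a b c) w (s + t + 1)
  | ifLe_pos {ρ : List Val} {a b c d : Expr} {x y : ℝ} {w : Val} {r s t : ℕ} :
      Eval P ρ a (.real x) r → Eval P ρ b (.real y) s → x ≤ y → Eval P ρ c w t →
      Eval P ρ (.ifLe a b c d) w (r + s + t + 1)
  | ifLe_neg {ρ : List Val} {a b c d : Expr} {x y : ℝ} {w : Val} {r s t : ℕ} :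
      Eval P ρ a (.real x) r → Eval P ρ b (.real y) s → y < x → Eval P ρ d w t →
      Eval P ρ (.ifLe a b c d) w (r + s + t + 1)
  | call {ρ : List Val} {f : ℕ} {a b : Expr} {v w : Val} {s t : ℕ} :
      Eval P ρ a v s → P[f]? = some b → Eval P [v] b w t → Eval P ρ (.call f a) w (s + t + 1)

/-- Function number `f` of `P`, run on the argument `v`, halts with result `w` after `t` steps. -/
def Runs (P : Program) (f : ℕ) (v w : Val) (t : ℕ) : Prop := Eval P [v] (.call f (.var 0)) w t

/-! ## Encoding of inputs and outputs -/

/-- Booleans: `false` is the null pointer, `true` is a node. -/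
def encBool : Bool → Val
  | false => .nil
  | true => .pair .nil .nil

/-- Linked lists. -/
def encList {α : Type} (enc : α → Val) : List α → Val
  | [] => .nil
  | a :: l => .pair (enc a) (encList enc l)

/-- A point is the pair of its coordinates. -/
def encPoint (p : Point) : Val := .pair (.real p.1) (.real p.2)

/-- A quadrant is its type and its vertex. -/
def encQuadrant (q : Quadrant) : Val :=
  .pair (.pair (encBool q.east) (encBool q.north)) (.pair (.real q.vx) (.real q.vy))

/-- An update: insertion or deletion, quadrant or point, and the element. -/
def encUpdate : Update → Val
  | .insertPoint p => .pair (encBool true) (.pair (encBool false) (encPoint p))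
  | .deletePoint p => .pair (encBool false) (.pair (encBool false) (encPoint p))
  | .insertQuadrant q => .pair (encBool true) (.pair (encBool true) (encQuadrant q))
  | .deleteQuadrant q => .pair (encBool false) (.pair (encBool true) (encQuadrant q))

/-- The answer of a set cover algorithm: either "there is no set cover" or a list of quadrants. -/
def encAnswer : Option (List Quadrant) → Val
  | none => .nil
  | some l => .pair .nil (encList encQuadrant l)

/-! ## Basic data structures and output-sensitive algorithms -/

/-- The logarithmic factor `⌊log₂ (n + 2)⌋ ≥ 1` for instances of size `n`. -/
def lg (n : ℕ) : ℕ := Nat.log 2 (n + 2)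

/-- The function `upd` of `P` processes the updates `us` one after the other, turning the data
structure `D` into `D'`, in `t` steps in total. -/
inductive UpdateRun (P : Program) (upd : ℕ) : Val → List Update → Val → ℕ → Prop
  | nil (D : Val) : UpdateRun P upd D [] D 0
  | cons {D D' D'' : Val} {u : Update} {us : List Update} {s t : ℕ} :
      Runs P upd (.pair D (encUpdate u)) D' s → UpdateRun P upd D' us D'' t →
      UpdateRun P upd D (u :: us) D'' (s + t)

/-- The sum of `(lg n) ^ k` over the updates, `n` being the size of the instance after the update. -/
noncomputable def sumLg (k : ℕ) : QInstance → List Update → ℕ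
  | _, [] => 0
  | I, u :: us => lg (I.apply u).size ^ k + sumLg k (I.apply u) us

/-- The functions `build` and `upd` of `P` form a basic data structure on quadrant set cover
instances: it is constructed in `Õ(n₀)` time from the initial instance, given by its elements
in any order, and it is updated in `Õ(1)` amortized time. -/
def IsBasicDataStructure (P : Program) (build upd : ℕ) : Prop :=
  ∃ C k : ℕ, ∀ (ps : List Point) (qs : List Quadrant), ps.Nodup → qs.Nodup →
    ∃ (D₀ : Val) (t₀ : ℕ),
      Runs P build (.pair (encList encPoint ps) (encList encQuadrant qs)) D₀ t₀ ∧
      t₀ ≤ C * ((ps.length + qs.length + 1) * lg (ps.length + qs.length) ^ k) ∧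
      ∀ us : List Update, ∃ (D : Val) (t : ℕ),
        UpdateRun P upd D₀ us D t ∧ t ≤ C * sumLg k (QInstance.ofLists ps qs) us

/-- `D` is a state of the data structure given by `build` and `upd` when the current instance is
`I`: it is obtained by construction from some initial instance, followed by updates that lead
to `I`. -/
def Stores (P : Program) (build upd : ℕ) (I : QInstance) (D : Val) : Prop :=
  ∃ (ps : List Point) (qs : List Quadrant) (us : List Update) (D₀ : Val) (t₀ t : ℕ),
    ps.Nodup ∧ qs.Nodup ∧
    Runs P build (.pair (encList encPoint ps) (encList encQuadrant qs)) D₀ t₀ ∧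
    UpdateRun P upd D₀ us D t ∧ us.foldl QInstance.apply (QInstance.ofLists ps qs) = I

/-- From any state of the data structure, the function `solve` computes a `c`-approximate
solution of the current instance in `Õ(opt)` time.  If the instance has no set cover, it
reports so, in time `Õ(m)` where `m` is the optimum for the points that can be covered. -/
def IsOutputSensitive (P : Program) (build upd solve c : ℕ) : Prop :=
  ∃ C k : ℕ, ∀ (I : QInstance) (D : Val), Stores P build upd I D →
    (I.HasCover → ∃ (l : List Quadrant) (t : ℕ),
      Runs P solve D (encAnswer (some l)) t ∧
      (∀ q ∈ l, q ∈ I.quads) ∧ Covers {q | q ∈ l} I.pts ∧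
      l.length ≤ c * opt I.pts I.quads ∧
      t ≤ C * ((opt I.pts I.quads + 1) * lg I.size ^ k)) ∧
    (¬ I.HasCover → ∃ t : ℕ,
      Runs P solve D (encAnswer none) t ∧
      t ≤ C * ((opt I.coverable I.quads + 1) * lg I.size ^ k))

set_option linter.unusedSimpArgs false

/-! ## Determinism and symbolic execution of the machine -/

/-! A covered point lies in a quadrant of one of the four types. So it suffices, in each of the four
orientations of the plane, to cover the points that lie in southeast quadrants with at most five
times as many quadrants as any given cover uses; the union of the four outputs is then a
20-approximation.

Fix an orientation and sort points and quadrants by height, ties being broken by class: northern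
quadrants, then points, then southern quadrants. A point is then vertically inside a southern
quadrant iff it precedes it, and inside a northern one iff it follows it. If a southeast and a
southwest quadrant meet horizontally, let `i` be the highest position from which on such a pair
still exists (`IsCross`). The pair covers everything up to `i`, and above `i` no point of a
southeast quadrant lies in a southwest one (`NoSouthwest`). The rest is swept upwards. Let `p` be
the leftmost remaining point and `b` the highest southeast quadrant reaching it; `b` covers all
remaining points below it. If a northeast quadrant starting below `b` reaches `p`, it covers all
remaining points above `b`, and the sweep ends. Otherwise let `e` be the northwest quadrant starting
below `b` that extends farthest right. If `e` reaches `p`, let `b'` be the highest southeast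
quadrant that reaches the side of `e`; then `b`, `e`, `b'` cover all remaining points up to `b'`. If
it does not, `b` alone is taken. The charging argument is `IsStep.notMem_active`: a member of the
given cover that contains `p` covers no remaining point after the step. So the number of steps is at
most the size of the cover, with three outputs per step and two for the crossing (`loop_spec`,
`greedy_spec`).

A step needs only a few searches in a tree with items at the leaves, whose nodes store extremal
quadrants, the leftmost point in a southeast quadrant, and an inner tree of the points sorted by
abscissa. When two consecutive sets are joined, the only new covered points are points of the lower
set inside quadrants of the upper one; the leftmost of them is a successor in the inner tree
(`leastCovered_union`). Range queries combine logarithmically many subtrees (`query_spec`). Trees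
are kept balanced by rebuilding a node of initial size `m` after about `m / 4` updates; the
potential `phi` pays for this (`link_spec`, `update_spec`).

The output covers every coverable point in any case, so a set cover exists iff the output covers all
points. This is tested in time near-linear in the output: between two consecutive heights of output
quadrants, the uncovered abscissas form an open interval (`not_covering_iff`), and one range query
per gap looks for a point in it (`gaps_spec`). -/

theorem Eval.det {P : Program} {ρ : List Val} {e : Expr} {v : Val} {t : ℕ} (h : Eval P ρ e v t) :
    ∀ {v' : Val} {t' : ℕ}, Eval P ρ e v' t' → v = v' ∧ t = t' := by
  induction h with
  | var ρ i => intro v' t' h'; cases h'; exact ⟨rfl, rfl⟩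
  | nil ρ => intro v' t' h'; cases h'; exact ⟨rfl, rfl⟩
  | pair _ _ iha ihb =>
    intro v' t' h'
    cases h' with
    | pair ha hb =>
      obtain ⟨rfl, rfl⟩ := iha ha
      obtain ⟨rfl, rfl⟩ := ihb hb
      exact ⟨rfl, rfl⟩
  | fst _ iha =>
    intro v' t' h'
    cases h' with
    | fst ha => obtain ⟨rfl, rfl⟩ := iha ha; exact ⟨rfl, rfl⟩
  | snd _ iha =>
    intro v' t' h'
    cases h' with
    | snd ha => obtain ⟨rfl, rfl⟩ := iha ha; exact ⟨rfl, rfl⟩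
  | letIn _ _ iha ihb =>
    intro v' t' h'
    cases h' with
    | letIn ha hb =>
      obtain ⟨rfl, rfl⟩ := iha ha
      obtain ⟨rfl, rfl⟩ := ihb hb
      exact ⟨rfl, rfl⟩
  | ifPair_pos _ _ iha ihb =>
    intro v' t' h'
    cases h' with
    | ifPair_pos ha hb =>
      obtain ⟨h, rfl⟩ := iha ha
      obtain ⟨rfl, rfl⟩ := ihb hb
      exact ⟨rfl, rfl⟩
    | ifPair_neg ha hn hb => exact absurd (iha ha).1.symm (hn _ _)
  | ifPair_neg _ hn _ iha ihb =>
    intro v' t' h'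
    cases h' with
    | ifPair_pos ha hb => exact absurd (iha ha).1 (hn _ _)
    | ifPair_neg ha _ hb =>
      obtain ⟨_, rfl⟩ := iha ha
      obtain ⟨rfl, rfl⟩ := ihb hb
      exact ⟨rfl, rfl⟩
  | ifLe_pos _ _ hle _ iha ihb ihc =>
    intro v' t' h'
    cases h' with
    | ifLe_pos ha hb _ hc =>
      obtain ⟨_, rfl⟩ := iha ha
      obtain ⟨_, rfl⟩ := ihb hb
      obtain ⟨rfl, rfl⟩ := ihc hc
      exact ⟨rfl, rfl⟩
    | ifLe_neg ha hb hlt _ =>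
      have h1 := (iha ha).1
      have h2 := (ihb hb).1
      injection h1 with h1
      injection h2 with h2
      subst h1 h2
      exact absurd hle (not_le.2 hlt)
  | ifLe_neg _ _ hlt _ iha ihb ihc =>
    intro v' t' h'
    cases h' with
    | ifLe_pos ha hb hle _ =>
      have h1 := (iha ha).1
      have h2 := (ihb hb).1
      injection h1 with h1
      injection h2 with h2
      subst h1 h2
      exact absurd hle (not_le.2 hlt)
    | ifLe_neg ha hb _ hc =>
      obtain ⟨_, rfl⟩ := iha ha
      obtain ⟨_, rfl⟩ := ihb hb
      obtain ⟨rfl, rfl⟩ := ihc hc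
      exact ⟨rfl, rfl⟩
  | call _ hf _ iha ihb =>
    intro v' t' h'
    cases h' with
    | call ha hf' hb =>
      obtain ⟨rfl, rfl⟩ := iha ha
      rw [hf] at hf'
      injection hf' with hf'
      subst hf'
      obtain ⟨rfl, rfl⟩ := ihb hb
      exact ⟨rfl, rfl⟩

/-- `Stores` speaks of arbitrary evaluations. Determinism identifies them with the evaluations that
the specifications below construct. -/
theorem UpdateRun.det {P : Program} {upd : ℕ} {D : Val} {us : List Update} {D' : Val} {t : ℕ}
    (h : UpdateRun P upd D us D' t) :
    ∀ {D'' : Val} {t' : ℕ}, UpdateRun P upd D us D'' t' → D' = D'' ∧ t = t' := by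
  induction h with
  | nil D => intro _ _ h'; cases h'; exact ⟨rfl, rfl⟩
  | cons h1 _ ih =>
    intro _ _ h'
    cases h' with
    | cons h1' h2' =>
      obtain ⟨rfl, rfl⟩ := Eval.det h1 h1'
      obtain ⟨rfl, rfl⟩ := ih h2'
      exact ⟨rfl, rfl⟩

/-! ## The program

Items are triples `(key, (class, other key))`, keys are pairs of a direction bit and a real number,
classes are unary numbers.  A tree is empty (null), a leaf `(null, item)`, or a node
`((countdown, router), ((inner tree, summary), (left, right)))`. -/

abbrev fLeKey : ℕ := 0
abbrev fLeClass : ℕ := 1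
abbrev fLtItem : ℕ := 2
abbrev fMinItem : ℕ := 3
abbrev fMaxItem : ℕ := 4
abbrev fInfo : ℕ := 5
abbrev fInner : ℕ := 6
abbrev fLeastAbove : ℕ := 7
abbrev fCombine : ℕ := 8
abbrev fCanon : ℕ := 9
abbrev fFold : ℕ := 10
abbrev fQuery : ℕ := 11
abbrev fHalve : ℕ := 12
abbrev fQuarter : ℕ := 13
abbrev fFlatten : ℕ := 14
abbrev fInsertInner : ℕ := 15
abbrev fBuild : ℕ := 16
abbrev fLink : ℕ := 17
abbrev fUpdate : ℕ := 18
abbrev fOverlap : ℕ := 19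
abbrev fReach : ℕ := 20
abbrev fHighest : ℕ := 21
abbrev fCross : ℕ := 22
abbrev fOutput : ℕ := 23
abbrev fLoop : ℕ := 24
abbrev fGreedy : ℕ := 25
abbrev fQuadItem : ℕ := 26
abbrev fUpdateOne : ℕ := 27
abbrev fUpdateAll : ℕ := 28
abbrev fInsertList : ℕ := 29
abbrev fUncovered : ℕ := 30
abbrev fGaps : ℕ := 31
abbrev fInsertOutputs : ℕ := 32
abbrev fSolve : ℕ := 33
abbrev fBuildAll : ℕ := 34

/-! ### Function bodies: comparisons, summaries and queries. -/

def leKeyBody : Expr :=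
  .ifPair (.fst (.fst (.var 0))) (.ifPair (.fst (.snd (.var 0))) (.ifLe (.snd (.fst (.var 0)))
    (.snd (.snd (.var 0))) (.pair .nil .nil) .nil) .nil) (.ifPair (.fst (.snd (.var 0))) (.pair
    .nil .nil) (.ifLe (.snd (.snd (.var 0))) (.snd (.fst (.var 0))) (.pair .nil .nil) .nil))

def leClassBody : Expr :=
  .ifPair (.fst (.var 0)) (.ifPair (.snd (.var 0)) (.call fLeClass (.pair (.snd (.fst (.var 0)))
    (.snd (.snd (.var 0))))) .nil) (.pair .nil .nil)

def ltItemBody : Expr :=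
  .ifPair (.call fLeKey (.pair (.fst (.snd (.var 0))) (.fst (.fst (.var 0))))) (.ifPair (.call
    fLeKey (.pair (.fst (.fst (.var 0))) (.fst (.snd (.var 0))))) (.ifPair (.call fLeClass (.pair
    (.fst (.snd (.snd (.var 0)))) (.fst (.snd (.fst (.var 0)))))) (.ifPair (.call fLeClass (.pair
    (.fst (.snd (.fst (.var 0)))) (.fst (.snd (.snd (.var 0)))))) (.ifPair (.call fLeKey (.pair
    (.snd (.snd (.snd (.var 0)))) (.snd (.snd (.fst (.var 0)))))) .nil (.pair .nil .nil)) .nil)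
    (.pair .nil .nil)) .nil) (.pair .nil .nil)

def minItemBody : Expr :=
  .ifPair (.fst (.var 0)) (.ifPair (.snd (.var 0)) (.ifPair (.call fLtItem (.pair (.snd (.var 0))
    (.fst (.var 0)))) (.snd (.var 0)) (.fst (.var 0))) (.fst (.var 0))) (.snd (.var 0))

def maxItemBody : Expr :=
  .ifPair (.fst (.var 0)) (.ifPair (.snd (.var 0)) (.ifPair (.call fLtItem (.pair (.fst (.var 0))
    (.snd (.var 0)))) (.snd (.var 0)) (.fst (.var 0))) (.fst (.var 0))) (.snd (.var 0))

/-- Only nodes store their summary. That of a leaf is made by counting down its unary class; items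
of class 2, and of class 5 or more, contribute to the first field only. -/
def infoBody : Expr :=
  .ifPair (.var 0) (.ifPair (.fst (.var 0)) (.snd (.fst (.snd (.var 0)))) (.letIn (.snd (.var 0))
    (.letIn (.fst (.snd (.var 0))) (.letIn (.pair (.snd (.snd (.var 1))) (.pair (.var 0) (.fst
    (.var 1)))) (.pair (.var 2) (.ifPair (.var 1) (.ifPair (.snd (.var 1)) (.ifPair (.snd (.snd
    (.var 1))) (.ifPair (.snd (.snd (.snd (.var 1)))) (.ifPair (.snd (.snd (.snd (.snd (.var
    1))))) (.pair .nil (.pair .nil (.pair .nil (.pair .nil .nil)))) (.pair .nil (.pair .nil (.pair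
    .nil (.pair (.var 0) .nil))))) (.pair .nil (.pair (.var 0) (.pair .nil (.pair .nil .nil)))))
    (.pair .nil (.pair .nil (.pair .nil (.pair .nil .nil))))) (.pair .nil (.pair .nil (.pair .nil
    (.pair .nil (.var 0)))))) (.pair .nil (.pair .nil (.pair (.var 0) (.pair .nil .nil))))))))))
    (.pair .nil (.pair .nil (.pair .nil (.pair .nil (.pair .nil .nil)))))

def innerBody : Expr :=
  .ifPair (.var 0) (.ifPair (.fst (.var 0)) (.fst (.fst (.snd (.var 0)))) (.ifPair (.fst (.snd
    (.snd (.var 0)))) (.ifPair (.snd (.fst (.snd (.snd (.var 0))))) (.ifPair (.snd (.snd (.fst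
    (.snd (.snd (.var 0)))))) .nil (.pair .nil (.pair (.snd (.snd (.snd (.var 0)))) (.pair (.pair
    .nil (.pair .nil (.pair .nil (.pair .nil (.pair .nil .nil))))) (.fst (.snd (.var 0)))))))
    .nil) .nil)) .nil

def leastAboveBody : Expr :=
  .ifPair (.snd (.var 0)) (.fst (.call fQuery (.pair (.call fInner (.fst (.var 0))) (.pair (.snd
    (.var 0)) .nil)))) .nil

/-- The argument is a tree and the summary of the items that follow it. Five fields are plain minima
or maxima; only the leftmost covered point needs a search in the inner tree. -/
def combineBody : Expr :=
  .letIn (.call fInfo (.fst (.var 0))) (.pair (.call fMinItem (.pair (.fst (.var 0)) (.fst (.snd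
    (.var 1))))) (.pair (.call fMinItem (.pair (.call fMinItem (.pair (.fst (.snd (.var 0))) (.fst
    (.snd (.snd (.var 1)))))) (.call fLeastAbove (.pair (.fst (.var 1)) (.fst (.snd (.snd (.snd
    (.var 1))))))))) (.pair (.call fMinItem (.pair (.fst (.snd (.snd (.var 0)))) (.fst (.snd (.snd
    (.snd (.var 1))))))) (.pair (.call fMinItem (.pair (.fst (.snd (.snd (.snd (.var 0))))) (.fst
    (.snd (.snd (.snd (.snd (.var 1)))))))) (.pair (.call fMaxItem (.pair (.fst (.snd (.snd (.snd
    (.snd (.var 0)))))) (.fst (.snd (.snd (.snd (.snd (.snd (.var 1))))))))) (.call fMaxItem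
    (.pair (.snd (.snd (.snd (.snd (.snd (.var 0)))))) (.snd (.snd (.snd (.snd (.snd (.snd (.var
    1))))))))))))))

/-- The argument is `((tree, accumulator), (lo, hi))`, a null bound standing for no bound. The
result prepends to the accumulator the maximal subtrees that make up the range. -/
def canonBody : Expr :=
  .ifPair (.fst (.fst (.var 0))) (.ifPair (.fst (.fst (.fst (.var 0)))) (.letIn (.snd (.fst (.fst
    (.fst (.var 0))))) (.letIn (.snd (.snd (.fst (.fst (.var 1))))) (.ifPair (.fst (.snd (.var
    2))) (.ifPair (.snd (.snd (.var 2))) (.ifPair (.call fLtItem (.pair (.var 1) (.snd (.snd (.var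
    2))))) (.ifPair (.call fLtItem (.pair (.fst (.snd (.var 2))) (.var 1))) (.call fCanon (.pair
    (.pair (.fst (.var 0)) (.call fCanon (.pair (.pair (.snd (.var 0)) (.snd (.fst (.var 2))))
    (.pair .nil (.snd (.snd (.var 2))))))) (.pair (.fst (.snd (.var 2))) .nil))) (.call fCanon
    (.pair (.pair (.snd (.var 0)) (.snd (.fst (.var 2)))) (.pair (.fst (.snd (.var 2))) (.snd
    (.snd (.var 2))))))) (.call fCanon (.pair (.pair (.fst (.var 0)) (.snd (.fst (.var 2))))
    (.pair (.fst (.snd (.var 2))) (.snd (.snd (.var 2))))))) (.ifPair (.call fLtItem (.pair (.fst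
    (.snd (.var 2))) (.var 1))) (.call fCanon (.pair (.pair (.fst (.var 0)) (.pair (.snd (.var 0))
    (.snd (.fst (.var 2))))) (.pair (.fst (.snd (.var 2))) .nil))) (.call fCanon (.pair (.pair
    (.snd (.var 0)) (.snd (.fst (.var 2)))) (.pair (.fst (.snd (.var 2))) .nil))))) (.ifPair (.snd
    (.snd (.var 2))) (.ifPair (.call fLtItem (.pair (.var 1) (.snd (.snd (.var 2))))) (.pair (.fst
    (.var 0)) (.call fCanon (.pair (.pair (.snd (.var 0)) (.snd (.fst (.var 2)))) (.pair .nil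
    (.snd (.snd (.var 2))))))) (.call fCanon (.pair (.pair (.fst (.var 0)) (.snd (.fst (.var 2))))
    (.pair .nil (.snd (.snd (.var 2))))))) (.pair (.fst (.fst (.var 2))) (.snd (.fst (.var
    2)))))))) (.ifPair (.fst (.snd (.var 0))) (.ifPair (.call fLtItem (.pair (.fst (.snd (.var
    0))) (.snd (.fst (.fst (.var 0)))))) (.ifPair (.snd (.snd (.var 0))) (.ifPair (.call fLtItem
    (.pair (.snd (.fst (.fst (.var 0)))) (.snd (.snd (.var 0))))) (.pair (.fst (.fst (.var 0)))
    (.snd (.fst (.var 0)))) (.snd (.fst (.var 0)))) (.pair (.fst (.fst (.var 0))) (.snd (.fst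
    (.var 0))))) (.snd (.fst (.var 0)))) (.ifPair (.snd (.snd (.var 0))) (.ifPair (.call fLtItem
    (.pair (.snd (.fst (.fst (.var 0)))) (.snd (.snd (.var 0))))) (.pair (.fst (.fst (.var 0)))
    (.snd (.fst (.var 0)))) (.snd (.fst (.var 0)))) (.pair (.fst (.fst (.var 0))) (.snd (.fst
    (.var 0))))))) (.snd (.fst (.var 0)))

def foldBody : Expr :=
  .ifPair (.var 0) (.call fCombine (.pair (.fst (.var 0)) (.call fFold (.snd (.var 0))))) (.pair
    .nil (.pair .nil (.pair .nil (.pair .nil (.pair .nil .nil)))))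

def queryBody : Expr :=
  .call fFold (.call fCanon (.pair (.pair (.fst (.var 0)) .nil) (.snd (.var 0))))

/-! ### Function bodies: construction and updates of trees. -/

def halveBody : Expr :=
  .ifPair (.snd (.var 0)) (.ifPair (.snd (.snd (.var 0))) (.letIn (.call fHalve (.pair (.snd (.fst
    (.var 0))) (.snd (.snd (.snd (.var 0)))))) (.pair (.pair (.fst (.fst (.var 1))) (.fst (.var
    0))) (.snd (.var 0)))) (.pair .nil (.fst (.var 0)))) (.pair .nil (.fst (.var 0)))

def quarterBody : Expr :=
  .ifPair (.var 0) (.ifPair (.snd (.var 0)) (.ifPair (.snd (.snd (.var 0))) (.ifPair (.snd (.snd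
    (.snd (.var 0)))) (.pair .nil (.call fQuarter (.snd (.snd (.snd (.snd (.var 0))))))) .nil)
    .nil) .nil) .nil

def flattenBody : Expr :=
  .ifPair (.fst (.var 0)) (.ifPair (.fst (.fst (.var 0))) (.call fFlatten (.pair (.fst (.snd (.snd
    (.fst (.var 0))))) (.call fFlatten (.pair (.snd (.snd (.snd (.fst (.var 0))))) (.snd (.var
    0)))))) (.pair (.snd (.fst (.var 0))) (.snd (.var 0)))) (.snd (.var 0))

def insertInnerBody : Expr :=
  .ifPair (.fst (.var 0)) (.ifPair (.fst (.snd (.fst (.fst (.var 0))))) (.ifPair (.snd (.fst (.snd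
    (.fst (.fst (.var 0)))))) (.ifPair (.snd (.snd (.fst (.snd (.fst (.fst (.var 0))))))) (.call
    fInsertInner (.pair (.snd (.fst (.var 0))) (.snd (.var 0)))) (.call fInsertInner (.pair (.snd
    (.fst (.var 0))) (.call fUpdate (.pair (.pair (.pair .nil .nil) (.pair (.snd (.snd (.fst (.fst
    (.var 0))))) (.pair (.pair .nil (.pair .nil (.pair .nil (.pair .nil (.pair .nil .nil)))))
    (.fst (.fst (.fst (.var 0))))))) (.snd (.var 0))))))) (.call fInsertInner (.pair (.snd (.fst
    (.var 0))) (.snd (.var 0))))) (.call fInsertInner (.pair (.snd (.fst (.var 0))) (.snd (.var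
    0))))) (.snd (.var 0))

/-- The inner tree is made by single insertions, which sort the points by their other key, and is
then flattened and rebuilt, so that it starts with potential zero. -/
def buildBody : Expr :=
  .ifPair (.var 0) (.ifPair (.snd (.var 0)) (.letIn (.call fHalve (.pair (.var 0) (.var 0)))
    (.letIn (.call fBuild (.fst (.var 0))) (.letIn (.call fBuild (.snd (.var 1))) (.pair (.pair
    (.call fQuarter (.var 3)) (.fst (.snd (.var 2)))) (.pair (.pair (.call fBuild (.call fFlatten
    (.pair (.call fInsertInner (.pair (.var 3) .nil)) .nil))) (.call fCombine (.pair (.var 1)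
    (.call fInfo (.var 0))))) (.pair (.var 1) (.var 0))))))) (.pair .nil (.fst (.var 0)))) .nil

/-- The argument is `((left, right), ((op, item), node))`, the children being already updated and
the node old. A null countdown triggers the rebuilding; otherwise the inner tree is updated if the
item is a point. -/
def linkBody : Expr :=
  .ifPair (.fst (.fst (.snd (.snd (.var 0))))) (.pair (.pair (.snd (.fst (.fst (.snd (.snd (.var
    0)))))) (.snd (.fst (.snd (.snd (.var 0)))))) (.pair (.pair (.ifPair (.fst (.snd (.snd (.fst
    (.snd (.var 0)))))) (.ifPair (.snd (.fst (.snd (.snd (.fst (.snd (.var 0))))))) (.ifPair (.snd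
    (.snd (.fst (.snd (.snd (.fst (.snd (.var 0)))))))) (.fst (.fst (.snd (.snd (.snd (.var
    0)))))) (.call fUpdate (.pair (.pair (.fst (.fst (.snd (.var 0)))) (.pair (.snd (.snd (.snd
    (.fst (.snd (.var 0)))))) (.pair (.pair .nil (.pair .nil (.pair .nil (.pair .nil (.pair .nil
    .nil))))) (.fst (.snd (.fst (.snd (.var 0)))))))) (.fst (.fst (.snd (.snd (.snd (.var
    0))))))))) (.fst (.fst (.snd (.snd (.snd (.var 0))))))) (.fst (.fst (.snd (.snd (.snd (.var
    0))))))) (.call fCombine (.pair (.fst (.fst (.var 0))) (.call fInfo (.snd (.fst (.var 0)))))))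
    (.fst (.var 0)))) (.call fBuild (.call fFlatten (.pair (.fst (.fst (.var 0))) (.call fFlatten
    (.pair (.snd (.fst (.var 0))) .nil)))))

def updateBody : Expr :=
  .ifPair (.snd (.var 0)) (.ifPair (.fst (.snd (.var 0))) (.ifPair (.call fLtItem (.pair (.snd
    (.fst (.var 0))) (.snd (.fst (.snd (.var 0)))))) (.call fLink (.pair (.pair (.call fUpdate
    (.pair (.pair (.fst (.fst (.var 0))) (.snd (.fst (.var 0)))) (.fst (.snd (.snd (.snd (.var
    0))))))) (.snd (.snd (.snd (.snd (.var 0)))))) (.pair (.pair (.fst (.fst (.var 0))) (.snd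
    (.fst (.var 0)))) (.snd (.var 0))))) (.call fLink (.pair (.pair (.fst (.snd (.snd (.snd (.var
    0))))) (.call fUpdate (.pair (.pair (.fst (.fst (.var 0))) (.snd (.fst (.var 0)))) (.snd (.snd
    (.snd (.snd (.var 0)))))))) (.pair (.pair (.fst (.fst (.var 0))) (.snd (.fst (.var 0)))) (.snd
    (.var 0)))))) (.ifPair (.call fLtItem (.pair (.snd (.fst (.var 0))) (.snd (.snd (.var 0)))))
    (.ifPair (.fst (.fst (.var 0))) (.call fBuild (.pair (.snd (.fst (.var 0))) (.pair (.snd (.snd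
    (.var 0))) .nil))) (.snd (.var 0))) (.ifPair (.call fLtItem (.pair (.snd (.snd (.var 0)))
    (.snd (.fst (.var 0))))) (.ifPair (.fst (.fst (.var 0))) (.call fBuild (.pair (.snd (.snd
    (.var 0))) (.pair (.snd (.fst (.var 0))) .nil))) (.snd (.var 0))) (.ifPair (.fst (.fst (.var
    0))) (.snd (.var 0)) .nil)))) (.ifPair (.fst (.fst (.var 0))) (.pair .nil (.snd (.fst (.var
    0)))) .nil)

/-! ### Function bodies: the greedy cover of one orientation. -/

def overlapBody : Expr :=
  .ifPair (.fst (.var 0)) (.ifPair (.snd (.var 0)) (.call fLeKey (.pair (.fst (.fst (.var 0)))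
    (.fst (.snd (.var 0))))) .nil) .nil

def reachBody : Expr :=
  .ifPair (.snd (.var 0)) (.call fLeKey (.pair (.fst (.snd (.var 0))) (.fst (.var 0)))) .nil

def highestBody : Expr :=
  .ifPair (.fst (.snd (.var 0))) (.ifPair (.call fReach (.pair (.fst (.var 0)) (.fst (.snd (.snd
    (.call fInfo (.snd (.snd (.snd (.snd (.var 0))))))))))) (.call fHighest (.pair (.fst (.var 0))
    (.snd (.snd (.snd (.snd (.var 0))))))) (.call fHighest (.pair (.fst (.var 0)) (.fst (.snd
    (.snd (.snd (.var 0)))))))) (.snd (.snd (.var 0)))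

def crossBody : Expr :=
  .ifPair (.fst (.fst (.var 0))) (.letIn (.call fInfo (.snd (.snd (.snd (.fst (.var 0))))))
    (.letIn (.pair (.call fMinItem (.pair (.fst (.snd (.var 1))) (.fst (.snd (.snd (.var 0))))))
    (.call fMaxItem (.pair (.snd (.snd (.var 1))) (.fst (.snd (.snd (.snd (.snd (.var 0)))))))))
    (.ifPair (.call fOverlap (.var 0)) (.call fCross (.pair (.snd (.snd (.snd (.fst (.var 2)))))
    (.pair (.fst (.snd (.var 2))) (.snd (.snd (.var 2)))))) (.call fCross (.pair (.fst (.snd (.snd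
    (.fst (.var 2))))) (.var 0)))))) (.letIn (.call fInfo (.fst (.var 0))) (.pair (.snd (.fst
    (.var 1))) (.pair (.call fMinItem (.pair (.fst (.snd (.var 1))) (.fst (.snd (.snd (.var
    0)))))) (.call fMaxItem (.pair (.snd (.snd (.var 1))) (.fst (.snd (.snd (.snd (.snd (.var
    0)))))))))))

/-- The argument is an item with exchanged keys. Its class gives the type relative to the
orientation; a direction bit that is false flips the corresponding bit of the type. -/
def outputBody : Expr :=
  .letIn (.ifPair (.fst (.snd (.var 0))) (.ifPair (.snd (.fst (.snd (.var 0)))) (.ifPair (.snd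
    (.snd (.fst (.snd (.var 0))))) (.ifPair (.snd (.snd (.snd (.fst (.snd (.var 0)))))) (.pair
    .nil .nil) (.pair (.pair .nil .nil) .nil)) .nil) (.pair .nil (.pair .nil .nil))) (.pair (.pair
    .nil .nil) (.pair .nil .nil))) (.pair (.pair (.ifPair (.fst (.fst (.var 1))) (.fst (.var 0))
    (.ifPair (.fst (.var 0)) .nil (.pair .nil .nil))) (.ifPair (.fst (.snd (.snd (.var 1)))) (.snd
    (.var 0)) (.ifPair (.snd (.var 0)) .nil (.pair .nil .nil)))) (.pair (.snd (.fst (.var 1)))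
    (.snd (.snd (.snd (.var 1))))))

/-- The argument is `(tree, (lo, outputs so far))`; everything up to `lo` is already covered. -/
def loopBody : Expr :=
  .letIn (.fst (.snd (.call fQuery (.pair (.fst (.var 0)) (.pair (.fst (.snd (.var 0))) .nil)))))
    (.ifPair (.var 0) (.letIn (.call fHighest (.pair (.fst (.var 0)) (.fst (.var 1)))) (.letIn
    (.call fQuery (.pair (.fst (.var 2)) (.pair .nil (.var 0)))) (.letIn (.pair (.call fOutput
    (.pair (.snd (.snd (.var 1))) (.pair (.fst (.snd (.var 1))) (.fst (.var 1))))) (.snd (.snd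
    (.var 3)))) (.letIn (.fst (.snd (.snd (.snd (.var 1))))) (.letIn (.snd (.snd (.snd (.snd (.snd
    (.var 2)))))) (.ifPair (.call fReach (.pair (.fst (.var 5)) (.var 1))) (.pair (.call fOutput
    (.var 1)) (.var 2)) (.ifPair (.var 0) (.ifPair (.call fLeKey (.pair (.fst (.var 5)) (.fst
    (.var 0)))) (.letIn (.call fHighest (.pair (.fst (.var 0)) (.fst (.var 6)))) (.call fLoop
    (.pair (.fst (.var 7)) (.pair (.var 0) (.pair (.call fOutput (.pair (.snd (.snd (.var 0)))
    (.pair (.fst (.snd (.var 0))) (.fst (.var 0))))) (.pair (.call fOutput (.var 1)) (.var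
    3))))))) (.call fLoop (.pair (.fst (.var 6)) (.pair (.var 4) (.var 2))))) (.call fLoop (.pair
    (.fst (.var 6)) (.pair (.var 4) (.var 2))))))))))) (.snd (.snd (.var 1))))

def greedyBody : Expr :=
  .letIn (.call fInfo (.fst (.var 0))) (.ifPair (.fst (.snd (.var 0))) (.ifPair (.call fOverlap
    (.pair (.fst (.snd (.snd (.var 0)))) (.fst (.snd (.snd (.snd (.snd (.var 0)))))))) (.letIn
    (.call fCross (.pair (.fst (.var 1)) (.pair .nil .nil))) (.call fLoop (.pair (.fst (.var 2))
    (.pair (.fst (.var 0)) (.pair (.call fOutput (.fst (.snd (.var 0)))) (.pair (.call fOutput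
    (.snd (.snd (.var 0)))) (.snd (.var 2)))))))) (.call fLoop (.pair (.fst (.var 1)) (.pair .nil
    (.snd (.var 1)))))) (.snd (.var 1)))

/-! ### Function bodies: conversion of updates, verification and entry points. -/

def quadItemBody : Expr :=
  .letIn (.ifPair (.fst (.fst (.var 0))) (.fst (.fst (.snd (.var 0)))) (.ifPair (.fst (.fst (.snd
    (.var 0)))) .nil (.pair .nil .nil))) (.letIn (.ifPair (.snd (.fst (.var 1))) (.snd (.fst (.snd
    (.var 1)))) (.ifPair (.snd (.fst (.snd (.var 1)))) .nil (.pair .nil .nil))) (.pair (.pair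
    (.snd (.fst (.var 2))) (.snd (.snd (.snd (.var 2))))) (.pair (.ifPair (.var 0) (.ifPair (.var
    1) .nil (.pair .nil .nil)) (.ifPair (.var 1) (.pair .nil (.pair .nil (.pair .nil .nil)))
    (.pair .nil (.pair .nil (.pair .nil (.pair .nil .nil)))))) (.pair (.fst (.fst (.var 2))) (.fst
    (.snd (.snd (.var 2))))))))

def updateOneBody : Expr :=
  .call fUpdate (.pair (.pair (.fst (.fst (.snd (.var 0)))) (.ifPair (.fst (.snd (.fst (.snd (.var
    0))))) (.call fQuadItem (.pair (.fst (.var 0)) (.snd (.snd (.fst (.snd (.var 0))))))) (.pair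
    (.pair (.snd (.fst (.var 0))) (.snd (.snd (.snd (.fst (.snd (.var 0))))))) (.pair (.pair .nil
    (.pair .nil .nil)) (.pair (.fst (.fst (.var 0))) (.fst (.snd (.snd (.fst (.snd (.var
    0))))))))))) (.snd (.snd (.var 0))))

def updateAllBody : Expr :=
  .pair (.call fUpdateOne (.pair (.pair (.pair .nil .nil) (.pair .nil .nil)) (.pair (.snd (.var
    0)) (.fst (.fst (.var 0)))))) (.pair (.call fUpdateOne (.pair (.pair (.pair .nil .nil) .nil)
    (.pair (.snd (.var 0)) (.fst (.snd (.fst (.var 0))))))) (.pair (.call fUpdateOne (.pair (.pair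
    .nil (.pair .nil .nil)) (.pair (.snd (.var 0)) (.fst (.snd (.snd (.fst (.var 0)))))))) (.call
    fUpdateOne (.pair (.pair .nil .nil) (.pair (.snd (.var 0)) (.snd (.snd (.snd (.fst (.var
    0))))))))))

def insertListBody : Expr :=
  .ifPair (.snd (.fst (.var 0))) (.call fInsertList (.pair (.pair (.fst (.fst (.var 0))) (.snd
    (.snd (.fst (.var 0))))) (.call fUpdateAll (.pair (.snd (.var 0)) (.pair (.pair .nil .nil)
    (.pair (.fst (.fst (.var 0))) (.fst (.snd (.fst (.var 0)))))))))) (.snd (.var 0))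

/-- The argument is `(list of trees, (lo, hi))`. The lower bound enters the inner tree with class 6,
above the class 5 of its items, which makes the bound strict. -/
def uncoveredBody : Expr :=
  .ifPair (.fst (.var 0)) (.letIn (.fst (.call fQuery (.pair (.call fInner (.fst (.fst (.var 0))))
    (.pair (.ifPair (.fst (.snd (.var 0))) (.pair (.fst (.fst (.snd (.var 0)))) (.pair (.pair .nil
    (.pair .nil (.pair .nil (.pair .nil (.pair .nil (.pair .nil .nil)))))) (.snd (.snd (.fst (.snd
    (.var 0))))))) .nil) .nil)))) (.ifPair (.var 0) (.ifPair (.snd (.snd (.var 1))) (.ifPair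
    (.call fLeKey (.pair (.fst (.snd (.snd (.var 1)))) (.fst (.var 0)))) (.call fUncovered (.pair
    (.snd (.fst (.var 1))) (.pair (.fst (.snd (.var 1))) (.snd (.snd (.var 1)))))) (.pair .nil
    .nil)) (.pair .nil .nil)) (.call fUncovered (.pair (.snd (.fst (.var 1))) (.pair (.fst (.snd
    (.var 1))) (.snd (.snd (.var 1)))))))) .nil

def gapsBody : Expr :=
  .letIn (.call fQuery (.pair (.fst (.snd (.var 0))) (.pair (.snd (.snd (.var 0))) .nil))) (.letIn
    (.fst (.var 0)) (.letIn (.call fQuery (.pair (.fst (.snd (.var 2))) (.pair .nil (.var 0))))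
    (.letIn (.call fMaxItem (.pair (.fst (.snd (.snd (.snd (.snd (.var 2)))))) (.snd (.snd (.snd
    (.snd (.snd (.var 0)))))))) (.letIn (.call fMinItem (.pair (.fst (.snd (.snd (.var 3)))) (.fst
    (.snd (.snd (.snd (.var 1))))))) (.ifPair (.call fUncovered (.pair (.call fCanon (.pair (.pair
    (.fst (.var 5)) .nil) (.pair (.snd (.snd (.var 5))) (.var 3)))) (.pair (.var 1) (.var 0))))
    .nil (.ifPair (.var 3) (.call fGaps (.pair (.fst (.var 5)) (.pair (.fst (.snd (.var 5))) (.var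
    3)))) (.pair .nil .nil)))))))

def insertOutputsBody : Expr :=
  .ifPair (.fst (.var 0)) (.call fInsertOutputs (.pair (.snd (.fst (.var 0))) (.call fUpdateOne
    (.pair (.pair (.pair .nil .nil) (.pair .nil .nil)) (.pair (.pair (.pair .nil .nil) (.pair
    (.pair .nil .nil) (.fst (.fst (.var 0))))) (.snd (.var 0))))))) (.snd (.var 0))

/-- The four greedy covers share one output list. Its quadrants then form a tree of their own,
against which the points are tested. -/
def solveBody : Expr :=
  .letIn (.call fGreedy (.pair (.snd (.snd (.snd (.var 0)))) (.call fGreedy (.pair (.fst (.snd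
    (.snd (.var 0)))) (.call fGreedy (.pair (.fst (.snd (.var 0))) (.call fGreedy (.pair (.fst
    (.var 0)) .nil)))))))) (.ifPair (.call fGaps (.pair (.fst (.var 1)) (.pair (.call
    fInsertOutputs (.pair (.var 0) .nil)) .nil))) (.pair .nil (.var 0)) .nil)

/-- The input is unsorted, so it is inserted element by element; the final rebuilding resets all
potentials to zero. -/
def buildAllBody : Expr :=
  .letIn (.call fInsertList (.pair (.pair (.pair .nil .nil) (.snd (.var 0))) (.call fInsertList
    (.pair (.pair .nil (.fst (.var 0))) (.pair .nil (.pair .nil (.pair .nil .nil))))))) (.pair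
    (.call fBuild (.call fFlatten (.pair (.fst (.var 0)) .nil))) (.pair (.call fBuild (.call
    fFlatten (.pair (.fst (.snd (.var 0))) .nil))) (.pair (.call fBuild (.call fFlatten (.pair
    (.fst (.snd (.snd (.var 0)))) .nil))) (.call fBuild (.call fFlatten (.pair (.snd (.snd (.snd
    (.var 0)))) .nil))))))

/-- The program. -/
def prog : Program :=
  [leKeyBody, leClassBody, ltItemBody, minItemBody, maxItemBody, infoBody, innerBody,
   leastAboveBody, combineBody, canonBody, foldBody, queryBody, halveBody, quarterBody,
   flattenBody, insertInnerBody, buildBody, linkBody, updateBody, overlapBody, reachBody,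
   highestBody, crossBody, outputBody, loopBody, greedyBody, quadItemBody, updateOneBody,
   updateAllBody, insertListBody, uncoveredBody, gapsBody, insertOutputsBody, solveBody,
   buildAllBody]

/-- `Ev ρ e Q`: in the environment `ρ`, the expression `e` evaluates to some value in some number
of steps that satisfy `Q`. -/
def Ev (ρ : List Val) (e : Expr) (Q : Val → ℕ → Prop) : Prop :=
  ∃ v t, Eval prog ρ e v t ∧ Q v t

@[congr] theorem Ev.congr {ρ ρ' : List Val} (h : ρ = ρ') (e : Expr) (Q : Val → ℕ → Prop) :
    Ev ρ e Q = Ev ρ' e Q := by rw [h]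

/-- Function number `f` of the program halts on `v`, with a value and a number of steps for its
body that satisfy `Q`. -/
def Fn (f : ℕ) (v : Val) (Q : Val → ℕ → Prop) : Prop :=
  match prog[f]? with
  | some b => Ev [v] b Q
  | none => False

/-- Case distinction on whether a value is a node. -/
def Val.cases (v : Val) (p q : Prop) : Prop :=
  match v with
  | .pair _ _ => p
  | _ => q

@[congr] theorem Val.cases_congr {v v' : Val} (h : v = v') (p q : Prop) :
    v.cases p q = v'.cases p q := by rw [h]

@[simp] theorem Val.cases_pair (a b : Val) (p q : Prop) : (Val.pair a b).cases p q = p := rfl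
@[simp] theorem Val.cases_nil (p q : Prop) : Val.nil.cases p q = q := rfl
@[simp] theorem Val.fst_pair (a b : Val) : (Val.pair a b).fst = a := rfl
@[simp] theorem Val.snd_pair (a b : Val) : (Val.pair a b).snd = b := rfl

theorem Val.cases_of_ne {v : Val} (h : ∀ x y, v ≠ .pair x y) (p q : Prop) : v.cases p q = q := by
  cases v with
  | pair x y => exact absurd rfl (h x y)
  | _ => rfl

theorem Ev.mono {ρ : List Val} {e : Expr} {Q Q' : Val → ℕ → Prop} (h : Ev ρ e Q)
    (hQ : ∀ v t, Q v t → Q' v t) : Ev ρ e Q' := by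
  obtain ⟨v, t, h1, h2⟩ := h
  exact ⟨v, t, h1, hQ v t h2⟩

theorem Fn.mono {f : ℕ} {v : Val} {Q Q' : Val → ℕ → Prop} (h : Fn f v Q)
    (hQ : ∀ v t, Q v t → Q' v t) : Fn f v Q' := by
  unfold Fn at *
  split at h
  · exact h.mono hQ
  · exact h

section
variable {ρ : List Val} {Q : Val → ℕ → Prop}

theorem ev_var {i : ℕ} : Ev ρ (.var i) Q ↔ Q (ρ.getD i .nil) 1 :=
  ⟨fun ⟨_, _, h, hQ⟩ => by cases h; exact hQ, fun h => ⟨_, _, .var ρ i, h⟩⟩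

theorem ev_nil : Ev ρ .nil Q ↔ Q .nil 1 :=
  ⟨fun ⟨_, _, h, hQ⟩ => by cases h; exact hQ, fun h => ⟨_, _, .nil ρ, h⟩⟩

theorem ev_pair {a b : Expr} :
    Ev ρ (.pair a b) Q ↔ Ev ρ a fun v s => Ev ρ b fun w t => Q (.pair v w) (s + t + 1) :=
  ⟨fun ⟨_, _, h, hQ⟩ => by cases h with | pair ha hb => exact ⟨_, _, ha, _, _, hb, hQ⟩,
    fun ⟨_, _, ha, _, _, hb, hQ⟩ => ⟨_, _, .pair ha hb, hQ⟩⟩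

theorem ev_fst {a : Expr} : Ev ρ (.fst a) Q ↔ Ev ρ a fun v s => Q v.fst (s + 1) :=
  ⟨fun ⟨_, _, h, hQ⟩ => by cases h with | fst ha => exact ⟨_, _, ha, hQ⟩,
    fun ⟨_, _, ha, hQ⟩ => ⟨_, _, .fst ha, hQ⟩⟩

theorem ev_snd {a : Expr} : Ev ρ (.snd a) Q ↔ Ev ρ a fun v s => Q v.snd (s + 1) :=
  ⟨fun ⟨_, _, h, hQ⟩ => by cases h with | snd ha => exact ⟨_, _, ha, hQ⟩,
    fun ⟨_, _, ha, hQ⟩ => ⟨_, _, .snd ha, hQ⟩⟩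

theorem ev_letIn {a b : Expr} :
    Ev ρ (.letIn a b) Q ↔ Ev ρ a fun v s => Ev (v :: ρ) b fun w t => Q w (s + t + 1) :=
  ⟨fun ⟨_, _, h, hQ⟩ => by cases h with | letIn ha hb => exact ⟨_, _, ha, _, _, hb, hQ⟩,
    fun ⟨_, _, ha, _, _, hb, hQ⟩ => ⟨_, _, .letIn ha hb, hQ⟩⟩

theorem ev_ifPair {a b c : Expr} :
    Ev ρ (.ifPair a b c) Q ↔ Ev ρ a fun v s =>
      v.cases (Ev ρ b fun w t => Q w (s + t + 1)) (Ev ρ c fun w t => Q w (s + t + 1)) := by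
  constructor
  · rintro ⟨_, _, h, hQ⟩
    cases h with
    | ifPair_pos ha hb => exact ⟨_, _, ha, _, _, hb, hQ⟩
    | ifPair_neg ha hn hb =>
      refine ⟨_, _, ha, ?_⟩
      beta_reduce
      rw [Val.cases_of_ne hn]
      exact ⟨_, _, hb, hQ⟩
  · rintro ⟨v, s, ha, h⟩
    cases v with
    | nil =>
      obtain ⟨_, _, hb, hQ⟩ := h
      exact ⟨_, _, .ifPair_neg ha (fun _ _ h => by cases h) hb, hQ⟩
    | real x =>
      obtain ⟨_, _, hb, hQ⟩ := h
      exact ⟨_, _, .ifPair_neg ha (fun _ _ h => by cases h) hb, hQ⟩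
    | pair x y =>
      obtain ⟨_, _, hb, hQ⟩ := h
      exact ⟨_, _, .ifPair_pos ha hb, hQ⟩

theorem ev_ifLe {a b c d : Expr} :
    Ev ρ (.ifLe a b c d) Q ↔ Ev ρ a fun v r => Ev ρ b fun w s => ∃ x y, v = .real x ∧ w = .real y ∧
      (x ≤ y → Ev ρ c fun w t => Q w (r + s + t + 1)) ∧
      (y < x → Ev ρ d fun w t => Q w (r + s + t + 1)) := by
  constructor
  · rintro ⟨_, _, h, hQ⟩
    cases h with
    | ifLe_pos ha hb hl hc =>
      exact ⟨_, _, ha, _, _, hb, _, _, rfl, rfl, fun _ => ⟨_, _, hc, hQ⟩,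
        fun h => absurd hl (not_le.2 h)⟩
    | ifLe_neg ha hb hl hc =>
      exact ⟨_, _, ha, _, _, hb, _, _, rfl, rfl, fun h => absurd h (not_le.2 hl),
        fun _ => ⟨_, _, hc, hQ⟩⟩
  · rintro ⟨v, r, ha, w, s, hb, x, y, rfl, rfl, h1, h2⟩
    rcases le_or_gt x y with h | h
    · obtain ⟨_, _, hc, hQ⟩ := h1 h
      exact ⟨_, _, .ifLe_pos ha hb h hc, hQ⟩
    · obtain ⟨_, _, hc, hQ⟩ := h2 h
      exact ⟨_, _, .ifLe_neg ha hb h hc, hQ⟩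

theorem ev_call {f : ℕ} {a : Expr} :
    Ev ρ (.call f a) Q ↔ Ev ρ a fun v s => Fn f v fun w t => Q w (s + t + 1) := by
  constructor
  · rintro ⟨_, _, h, hQ⟩
    cases h with
    | call ha hf hb =>
      refine ⟨_, _, ha, ?_⟩
      simp only [Fn, hf]
      exact ⟨_, _, hb, hQ⟩
  · rintro ⟨v, s, ha, h⟩
    unfold Fn at h
    split at h
    · obtain ⟨_, _, hb, hQ⟩ := h
      exact ⟨_, _, .call ha (by assumption) hb, hQ⟩
    · exact h.elim

end

/-- The rules of symbolic execution, as one set of rewrite rules. -/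
theorem run : (∀ ρ i Q, Ev ρ (.var i) Q ↔ Q (ρ.getD i .nil) 1) ∧
    (∀ ρ Q, Ev ρ .nil Q ↔ Q .nil 1) ∧
    (∀ ρ a b Q, Ev ρ (.pair a b) Q ↔
      Ev ρ a fun v s => Ev ρ b fun w t => Q (.pair v w) (s + t + 1)) ∧
    (∀ ρ a Q, Ev ρ (.fst a) Q ↔ Ev ρ a fun v s => Q v.fst (s + 1)) ∧
    (∀ ρ a Q, Ev ρ (.snd a) Q ↔ Ev ρ a fun v s => Q v.snd (s + 1)) ∧
    (∀ ρ a b Q, Ev ρ (.letIn a b) Q ↔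
      Ev ρ a fun v s => Ev (v :: ρ) b fun w t => Q w (s + t + 1)) ∧
    (∀ ρ a b c Q, Ev ρ (.ifPair a b c) Q ↔ Ev ρ a fun v s =>
      v.cases (Ev ρ b fun w t => Q w (s + t + 1)) (Ev ρ c fun w t => Q w (s + t + 1))) ∧
    (∀ ρ f a Q, Ev ρ (.call f a) Q ↔ Ev ρ a fun v s => Fn f v fun w t => Q w (s + t + 1)) ∧
    (∀ (v : Val) ρ, (v :: ρ).getD 0 .nil = v) ∧
    (∀ (v : Val) ρ i, (v :: ρ).getD (i + 1) .nil = ρ.getD i .nil) ∧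
    (∀ a b, (Val.pair a b).fst = a) ∧ (∀ a b, (Val.pair a b).snd = b) ∧
    (∀ a b p q, (Val.pair a b).cases p q = p) ∧ (∀ p q, Val.nil.cases p q = q) :=
  ⟨fun _ _ _ => ev_var, fun _ _ => ev_nil, fun _ _ _ _ => ev_pair, fun _ _ _ => ev_fst,
    fun _ _ _ => ev_snd, fun _ _ _ _ => ev_letIn, fun _ _ _ _ _ => ev_ifPair,
    fun _ _ _ _ => ev_call, fun _ _ => rfl, fun _ _ _ => rfl, fun _ _ => rfl, fun _ _ => rfl,
    fun _ _ _ _ => rfl, fun _ _ => rfl⟩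

/-- `Fn` counts the steps of the body only; the two extra steps are the call and the evaluation of
its argument. -/
theorem Fn.runs {f : ℕ} {v : Val} {Q : Val → ℕ → Prop} (h : Fn f v Q) :
    ∃ w t, Runs prog f v w (t + 2) ∧ Q w t := by
  have : Ev [v] (.call f (.var 0)) fun w t => ∃ s, t = s + 2 ∧ Q w s := by
    rw [ev_call, ev_var]
    exact h.mono fun w t hQ => ⟨t, by omega, hQ⟩
  obtain ⟨w, _, h1, s, rfl, h2⟩ := this
  exact ⟨w, s, h1, h2⟩

theorem fn_leKey {v : Val} {Q : Val → ℕ → Prop} :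
    Fn fLeKey v Q ↔ Ev [v] leKeyBody Q := Iff.rfl
theorem fn_leClass {v : Val} {Q : Val → ℕ → Prop} :
    Fn fLeClass v Q ↔ Ev [v] leClassBody Q := Iff.rfl
theorem fn_ltItem {v : Val} {Q : Val → ℕ → Prop} :
    Fn fLtItem v Q ↔ Ev [v] ltItemBody Q := Iff.rfl
theorem fn_minItem {v : Val} {Q : Val → ℕ → Prop} :
    Fn fMinItem v Q ↔ Ev [v] minItemBody Q := Iff.rfl
theorem fn_maxItem {v : Val} {Q : Val → ℕ → Prop} :
    Fn fMaxItem v Q ↔ Ev [v] maxItemBody Q := Iff.rfl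
theorem fn_info {v : Val} {Q : Val → ℕ → Prop} :
    Fn fInfo v Q ↔ Ev [v] infoBody Q := Iff.rfl
theorem fn_inner {v : Val} {Q : Val → ℕ → Prop} :
    Fn fInner v Q ↔ Ev [v] innerBody Q := Iff.rfl
theorem fn_leastAbove {v : Val} {Q : Val → ℕ → Prop} :
    Fn fLeastAbove v Q ↔ Ev [v] leastAboveBody Q := Iff.rfl
theorem fn_combine {v : Val} {Q : Val → ℕ → Prop} :
    Fn fCombine v Q ↔ Ev [v] combineBody Q := Iff.rfl
theorem fn_canon {v : Val} {Q : Val → ℕ → Prop} :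
    Fn fCanon v Q ↔ Ev [v] canonBody Q := Iff.rfl
theorem fn_fold {v : Val} {Q : Val → ℕ → Prop} :
    Fn fFold v Q ↔ Ev [v] foldBody Q := Iff.rfl
theorem fn_query {v : Val} {Q : Val → ℕ → Prop} :
    Fn fQuery v Q ↔ Ev [v] queryBody Q := Iff.rfl
theorem fn_halve {v : Val} {Q : Val → ℕ → Prop} :
    Fn fHalve v Q ↔ Ev [v] halveBody Q := Iff.rfl
theorem fn_quarter {v : Val} {Q : Val → ℕ → Prop} :
    Fn fQuarter v Q ↔ Ev [v] quarterBody Q := Iff.rfl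
theorem fn_flatten {v : Val} {Q : Val → ℕ → Prop} :
    Fn fFlatten v Q ↔ Ev [v] flattenBody Q := Iff.rfl
theorem fn_insertInner {v : Val} {Q : Val → ℕ → Prop} :
    Fn fInsertInner v Q ↔ Ev [v] insertInnerBody Q := Iff.rfl
theorem fn_build {v : Val} {Q : Val → ℕ → Prop} :
    Fn fBuild v Q ↔ Ev [v] buildBody Q := Iff.rfl
theorem fn_link {v : Val} {Q : Val → ℕ → Prop} :
    Fn fLink v Q ↔ Ev [v] linkBody Q := Iff.rfl
theorem fn_update {v : Val} {Q : Val → ℕ → Prop} :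
    Fn fUpdate v Q ↔ Ev [v] updateBody Q := Iff.rfl
theorem fn_overlap {v : Val} {Q : Val → ℕ → Prop} :
    Fn fOverlap v Q ↔ Ev [v] overlapBody Q := Iff.rfl
theorem fn_reach {v : Val} {Q : Val → ℕ → Prop} :
    Fn fReach v Q ↔ Ev [v] reachBody Q := Iff.rfl
theorem fn_highest {v : Val} {Q : Val → ℕ → Prop} :
    Fn fHighest v Q ↔ Ev [v] highestBody Q := Iff.rfl
theorem fn_cross {v : Val} {Q : Val → ℕ → Prop} :
    Fn fCross v Q ↔ Ev [v] crossBody Q := Iff.rfl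
theorem fn_output {v : Val} {Q : Val → ℕ → Prop} :
    Fn fOutput v Q ↔ Ev [v] outputBody Q := Iff.rfl
theorem fn_loop {v : Val} {Q : Val → ℕ → Prop} :
    Fn fLoop v Q ↔ Ev [v] loopBody Q := Iff.rfl
theorem fn_greedy {v : Val} {Q : Val → ℕ → Prop} :
    Fn fGreedy v Q ↔ Ev [v] greedyBody Q := Iff.rfl
theorem fn_quadItem {v : Val} {Q : Val → ℕ → Prop} :
    Fn fQuadItem v Q ↔ Ev [v] quadItemBody Q := Iff.rfl
theorem fn_updateOne {v : Val} {Q : Val → ℕ → Prop} :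
    Fn fUpdateOne v Q ↔ Ev [v] updateOneBody Q := Iff.rfl
theorem fn_updateAll {v : Val} {Q : Val → ℕ → Prop} :
    Fn fUpdateAll v Q ↔ Ev [v] updateAllBody Q := Iff.rfl
theorem fn_insertList {v : Val} {Q : Val → ℕ → Prop} :
    Fn fInsertList v Q ↔ Ev [v] insertListBody Q := Iff.rfl
theorem fn_uncovered {v : Val} {Q : Val → ℕ → Prop} :
    Fn fUncovered v Q ↔ Ev [v] uncoveredBody Q := Iff.rfl
theorem fn_gaps {v : Val} {Q : Val → ℕ → Prop} :
    Fn fGaps v Q ↔ Ev [v] gapsBody Q := Iff.rfl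
theorem fn_insertOutputs {v : Val} {Q : Val → ℕ → Prop} :
    Fn fInsertOutputs v Q ↔ Ev [v] insertOutputsBody Q := Iff.rfl
theorem fn_solve {v : Val} {Q : Val → ℕ → Prop} :
    Fn fSolve v Q ↔ Ev [v] solveBody Q := Iff.rfl
theorem fn_buildAll {v : Val} {Q : Val → ℕ → Prop} :
    Fn fBuildAll v Q ↔ Ev [v] buildAllBody Q := Iff.rfl

/-! ## Keys, classes and items -/

/-- A coordinate together with the direction in which it is ordered. -/
abbrev Key : Type := Lex (ℝᵒᵈ ⊕ ℝ)

/-- The real number `r` as a key that is ordered upwards if `s`, downwards otherwise. -/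
def keyOf (s : Bool) (r : ℝ) : Key :=
  if s then toLex (.inr r) else toLex (.inl (OrderDual.toDual r))

theorem keyOf_cases (k : Key) : ∃ s r, k = keyOf s r := by
  obtain ⟨a, rfl⟩ := toLex.surjective k
  rcases a with a | b
  · exact ⟨false, OrderDual.ofDual a, rfl⟩
  · exact ⟨true, b, rfl⟩

@[simp] theorem keyOf_true_le {r r' : ℝ} : keyOf true r ≤ keyOf true r' ↔ r ≤ r' :=
  Sum.Lex.inr_le_inr_iff

@[simp] theorem keyOf_false_le {r r' : ℝ} : keyOf false r ≤ keyOf false r' ↔ r' ≤ r :=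
  Sum.Lex.inl_le_inl_iff

@[simp] theorem keyOf_false_le_true {r r' : ℝ} : keyOf false r ≤ keyOf true r' ↔ True :=
  iff_true_intro (Sum.Lex.inl_le_inr _ _)

@[simp] theorem keyOf_true_le_false {r r' : ℝ} : keyOf true r ≤ keyOf false r' ↔ False :=
  iff_false_intro Sum.Lex.not_inr_le_inl

theorem keyOf_injective (s : Bool) : Function.Injective (keyOf s) := by
  intro r r' h
  cases s <;> simpa [keyOf] using h

/-- Keys are represented by their direction and their number. -/
def encKey (k : Key) : Val :=
  match ofLex k with
  | .inl a => .pair (encBool false) (.real (OrderDual.ofDual a))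
  | .inr b => .pair (encBool true) (.real b)

theorem encKey_keyOf (s : Bool) (r : ℝ) : encKey (keyOf s r) = .pair (encBool s) (.real r) := by
  cases s <;> rfl

/-- Unary numbers. -/
def encNat : ℕ → Val
  | 0 => .nil
  | n + 1 => .pair .nil (encNat n)

/-- An item of a search tree, ordered by its key, its class and its second key. -/
@[ext] structure Item where
  key : Key
  cls : Fin 7
  snd : Key

def Item.toTriple (i : Item) : Lex (Key × Lex (Fin 7 × Key)) :=
  toLex (i.key, toLex (i.cls, i.snd))

theorem Item.toTriple_injective : Function.Injective Item.toTriple := by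
  rintro ⟨a, b, c⟩ ⟨a', b', c'⟩ h
  simpa [Item.toTriple] using h

noncomputable instance : LinearOrder Item := LinearOrder.lift' Item.toTriple Item.toTriple_injective

theorem Item.lt_iff {i j : Item} : i < j ↔ i.key < j.key ∨
    i.key = j.key ∧ (i.cls < j.cls ∨ i.cls = j.cls ∧ i.snd < j.snd) := by
  change i.toTriple < j.toTriple ↔ _
  simp [Item.toTriple, Prod.Lex.lt_iff]

theorem Item.key_le_of_le {i j : Item} (h : i ≤ j) : i.key ≤ j.key := by
  rcases h.lt_or_eq with h | rfl
  · rcases Item.lt_iff.1 h with h | h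
    · exact h.le
    · exact h.1.le
  · exact le_rfl

def encItem (i : Item) : Val := .pair (encKey i.key) (.pair (encNat i.cls) (encKey i.snd))

/-- The item with the two keys exchanged. -/
def Item.swap (i : Item) : Item := ⟨i.snd, i.cls, i.key⟩

/-- The item for a point in an inner tree. -/
def Item.inn (i : Item) : Item := ⟨i.snd, 5, i.key⟩

@[simp] theorem Item.swap_key (i : Item) : i.swap.key = i.snd := rfl
@[simp] theorem Item.swap_cls (i : Item) : i.swap.cls = i.cls := rfl
@[simp] theorem Item.inn_key (i : Item) : i.inn.key = i.snd := rfl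
@[simp] theorem Item.inn_cls (i : Item) : i.inn.cls = 5 := rfl

/-- Optional items, as minima of sets. -/
def encMin : WithTop Item → Val
  | ⊤ => .nil
  | (i : Item) => encItem i

/-- Optional items, as maxima of sets. -/
def encMax : WithBot Item → Val
  | ⊥ => .nil
  | (i : Item) => encItem i

@[simp] theorem encMin_top : encMin ⊤ = .nil := rfl
@[simp] theorem encMin_coe (i : Item) : encMin i = encItem i := rfl
@[simp] theorem encMax_bot : encMax ⊥ = .nil := rfl
@[simp] theorem encMax_coe (i : Item) : encMax i = encItem i := rfl

/-! ## Comparisons -/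

@[simp] theorem encBool_true : encBool true = .pair .nil .nil := rfl
@[simp] theorem encBool_false : encBool false = .nil := rfl
@[simp] theorem encItem_cases (i : Item) (p q : Prop) : (encItem i).cases p q = p := rfl
@[simp] theorem encItem_fst (i : Item) : (encItem i).fst = encKey i.key := rfl
@[simp] theorem encItem_snd (i : Item) :
    (encItem i).snd = .pair (encNat i.cls) (encKey i.snd) := rfl

@[simp] theorem encBool_cases (b : Bool) (p q : Prop) :
    (encBool b).cases p q ↔ (b = true → p) ∧ (b = false → q) := by
  cases b <;> simp [encBool]

theorem decide_cases (p q r : Prop) [Decidable p] :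
    (encBool (decide p)).cases q r ↔ (p → q) ∧ (¬ p → r) := by
  simp

theorem leKey_spec (k k' : Key) : Fn fLeKey (.pair (encKey k) (encKey k')) fun w t =>
    w = encBool (decide (k ≤ k')) ∧ t ≤ 20 := by
  obtain ⟨s, r, rfl⟩ := keyOf_cases k
  obtain ⟨s', r', rfl⟩ := keyOf_cases k'
  rw [fn_leKey]
  cases s <;> cases s' <;> simp [leKeyBody, encKey_keyOf, run, ev_ifLe]
  all_goals
    constructor <;> intro h
    · simp [h]
    · simp [h.not_ge]

theorem leClass_spec (m n : ℕ) : Fn fLeClass (.pair (encNat m) (encNat n)) fun w t =>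
    w = encBool (decide (m ≤ n)) ∧ t ≤ 30 * m + 30 := by
  induction m generalizing n with
  | zero => rw [fn_leClass]; simp [leClassBody, encNat, run]
  | succ m ih =>
    cases n with
    | zero => rw [fn_leClass]; simp [leClassBody, encNat, run]
    | succ n =>
      rw [fn_leClass]
      simp [leClassBody, encNat, run]
      refine (ih n).mono ?_
      rintro w t ⟨rfl, h⟩
      refine ⟨by simp, by omega⟩

theorem ltItem_spec (i j : Item) : Fn fLtItem (.pair (encItem i) (encItem j)) fun w t =>
    w = encBool (decide (i < j)) ∧ t ≤ 1000 := by
  have hi := i.cls.isLt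
  have hj := j.cls.isLt
  rw [fn_ltItem]
  simp only [ltItemBody, encItem, run]
  refine (leKey_spec _ _).mono ?_
  rintro _ t1 ⟨rfl, h1⟩
  simp only [decide_cases]
  constructor <;> intro hk
  · refine (leKey_spec _ _).mono ?_
    rintro _ t2 ⟨rfl, h2⟩
    simp only [decide_cases]
    constructor <;> intro hk2
    · have hk3 := le_antisymm hk2 hk
      refine (leClass_spec _ _).mono ?_
      rintro _ t3 ⟨rfl, h3⟩
      simp only [decide_cases]
      constructor <;> intro hc
      · refine (leClass_spec _ _).mono ?_
        rintro _ t4 ⟨rfl, h4⟩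
        simp only [decide_cases]
        constructor <;> intro hc2
        · have hc3 : i.cls = j.cls := Fin.ext (le_antisymm hc2 hc)
          refine (leKey_spec _ _).mono ?_
          rintro _ t5 ⟨rfl, h5⟩
          simp only [decide_cases]
          constructor <;> intro hz
          · refine ⟨?_, by omega⟩
            simp [Item.lt_iff, hk3, hc3, hz.not_gt]
          · refine ⟨?_, by omega⟩
            simp [Item.lt_iff, hk3, hc3, not_le.1 hz]
        · refine ⟨?_, by omega⟩
          have : j.cls < i.cls := not_le.1 hc2
          simp [Item.lt_iff, hk3, this.ne', this.not_gt]
      · refine ⟨?_, by omega⟩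
        have : i.cls < j.cls := not_le.1 hc
        simp [Item.lt_iff, hk3, this]
    · refine ⟨?_, by omega⟩
      simp [Item.lt_iff, (not_le.1 hk2).ne', (not_le.1 hk2).not_gt]
  · refine ⟨?_, by omega⟩
    simp [Item.lt_iff, not_le.1 hk]

theorem minItem_spec (a b : WithTop Item) : Fn fMinItem (.pair (encMin a) (encMin b)) fun w t =>
    w = encMin (a ⊓ b) ∧ t ≤ 1030 := by
  rw [fn_minItem]
  induction a using WithTop.recTopCoe with
  | top => simp [minItemBody, run]
  | coe i =>
    induction b using WithTop.recTopCoe with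
    | top => simp [minItemBody, encItem, run]
    | coe j =>
      simp only [minItemBody, encMin_coe, run, encItem_cases]
      refine (ltItem_spec _ _).mono ?_
      rintro _ t1 ⟨rfl, h1⟩
      simp only [decide_cases]
      constructor <;> intro hk
      · refine ⟨?_, by omega⟩
        rw [inf_eq_right.2 (WithTop.coe_le_coe.2 hk.le), encMin_coe]
      · refine ⟨?_, by omega⟩
        rw [inf_eq_left.2 (WithTop.coe_le_coe.2 (not_lt.1 hk)), encMin_coe]

theorem maxItem_spec (a b : WithBot Item) : Fn fMaxItem (.pair (encMax a) (encMax b)) fun w t =>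
    w = encMax (a ⊔ b) ∧ t ≤ 1030 := by
  rw [fn_maxItem]
  induction a using WithBot.recBotCoe with
  | bot => simp [maxItemBody, run]
  | coe i =>
    induction b using WithBot.recBotCoe with
    | bot => simp [maxItemBody, encItem, run]
    | coe j =>
      simp only [maxItemBody, encMax_coe, run, encItem_cases]
      refine (ltItem_spec _ _).mono ?_
      rintro _ t1 ⟨rfl, h1⟩
      simp only [decide_cases]
      constructor <;> intro hk
      · refine ⟨?_, by omega⟩
        rw [sup_eq_right.2 (WithBot.coe_le_coe.2 hk.le), encMax_coe]
      · refine ⟨?_, by omega⟩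
        rw [sup_eq_left.2 (WithBot.coe_le_coe.2 (not_lt.1 hk)), encMax_coe]

/-! ## Summaries of sets of items -/

/-- The least item of a set. -/
noncomputable def least (s : Finset Item) : WithTop Item := s.inf fun i => (i : WithTop Item)

/-- The least item of class `c`, after an exchange of the keys. -/
noncomputable def minSwap (c : Fin 7) (s : Finset Item) : WithTop Item :=
  s.inf fun i => if i.cls = c then (i.swap : WithTop Item) else ⊤

/-- The greatest item of class `c`, after an exchange of the keys. -/
noncomputable def maxSwap (c : Fin 7) (s : Finset Item) : WithBot Item :=
  s.sup fun i => if i.cls = c then (i.swap : WithBot Item) else ⊥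

/-- The point `i` is covered by a southeast quadrant in `s`. -/
def SECovered (s : Finset Item) (i : Item) : Prop :=
  i.cls = 2 ∧ ∃ j ∈ s, j.cls = 3 ∧ i < j ∧ j.snd ≤ i.snd

open Classical in
/-- The points of `s` that are covered by southeast quadrants in `s`. -/
noncomputable def coveredSE (s : Finset Item) : Finset Item := s.filter (SECovered s)

/-- The leftmost point of `s` that is covered by a southeast quadrant in `s`. -/
noncomputable def leastCovered (s : Finset Item) : WithTop Item :=
  (coveredSE s).inf fun i => (i.inn : WithTop Item)

/-- The points of `s`, as items of an inner tree. -/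
noncomputable def innerSet (s : Finset Item) : Finset Item := (s.filter fun i => i.cls = 2).image Item.inn

/-- The items of `s` between two bounds. -/
noncomputable def between (s : Finset Item) (lo : WithBot Item) (hi : WithTop Item) : Finset Item :=
  s.filter fun i => lo < (i : WithBot Item) ∧ (i : WithTop Item) < hi

theorem mem_between {s : Finset Item} {lo : WithBot Item} {hi : WithTop Item} {i : Item} :
    i ∈ between s lo hi ↔ i ∈ s ∧ lo < (i : WithBot Item) ∧ (i : WithTop Item) < hi :=
  Finset.mem_filter

theorem between_union (s s' : Finset Item) (lo : WithBot Item) (hi : WithTop Item) :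
    between (s ∪ s') lo hi = between s lo hi ∪ between s' lo hi := Finset.filter_union _ _ _

@[simp] theorem between_bot_top (s : Finset Item) : between s ⊥ ⊤ = s := by
  ext i; simp [mem_between]

theorem mem_innerSet {s : Finset Item} {i : Item} :
    i ∈ innerSet s ↔ ∃ p ∈ s, p.cls = 2 ∧ p.inn = i := by
  simp [innerSet, and_assoc]

theorem innerSet_union (s s' : Finset Item) : innerSet (s ∪ s') = innerSet s ∪ innerSet s' := by
  simp [innerSet, Finset.filter_union, Finset.image_union]

theorem card_innerSet_le (s : Finset Item) : (innerSet s).card ≤ s.card :=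
  Finset.card_image_le.trans (Finset.card_filter_le _ _)

theorem mem_coveredSE {s : Finset Item} {i : Item} : i ∈ coveredSE s ↔ i ∈ s ∧ SECovered s i := by
  simp [coveredSE]

theorem least_union (s s' : Finset Item) : least (s ∪ s') = least s ⊓ least s' := Finset.inf_union

theorem minSwap_union (c : Fin 7) (s s' : Finset Item) :
    minSwap c (s ∪ s') = minSwap c s ⊓ minSwap c s' := Finset.inf_union

theorem maxSwap_union (c : Fin 7) (s s' : Finset Item) :
    maxSwap c (s ∪ s') = maxSwap c s ⊔ maxSwap c s' := Finset.sup_union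

theorem exists_of_inf_eq_coe {α : Type*} {s : Finset α} {f : α → WithTop Item} {x : Item}
    (h : s.inf f = x) : ∃ i ∈ s, f i = x := by
  have hs : s.Nonempty := by
    rw [Finset.nonempty_iff_ne_empty]
    rintro rfl
    simp at h
  obtain ⟨i, hi, h'⟩ := Finset.exists_mem_eq_inf s hs f
  exact ⟨i, hi, h'.symm.trans h⟩

theorem exists_of_sup_eq_coe {α : Type*} {s : Finset α} {f : α → WithBot Item} {x : Item}
    (h : s.sup f = x) : ∃ i ∈ s, f i = x := by
  have hs : s.Nonempty := by
    rw [Finset.nonempty_iff_ne_empty]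
    rintro rfl
    simp at h
  obtain ⟨i, hi, h'⟩ := Finset.exists_mem_eq_sup s hs f
  exact ⟨i, hi, h'.symm.trans h⟩

theorem least_mem {s : Finset Item} {i : Item} (h : least s = i) : i ∈ s := by
  obtain ⟨j, hj, h⟩ := exists_of_inf_eq_coe h
  rwa [← WithTop.coe_injective h]

theorem least_le {s : Finset Item} {i : Item} (h : i ∈ s) : least s ≤ i := Finset.inf_le h

theorem minSwap_le {c : Fin 7} {s : Finset Item} {i : Item} (h : i ∈ s) (hc : i.cls = c) :
    minSwap c s ≤ i.swap := (Finset.inf_le h).trans (by simp [hc])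

theorem le_maxSwap {c : Fin 7} {s : Finset Item} {i : Item} (h : i ∈ s) (hc : i.cls = c) :
    i.swap ≤ maxSwap c s :=
  le_trans (by simp [hc]) (Finset.le_sup (f := fun i : Item =>
    if i.cls = c then (i.swap : WithBot Item) else ⊥) h)

theorem exists_of_minSwap_eq {c : Fin 7} {s : Finset Item} {x : Item} (h : minSwap c s = x) :
    ∃ i ∈ s, i.cls = c ∧ i.swap = x := by
  obtain ⟨i, hi, h⟩ := exists_of_inf_eq_coe h
  split at h
  · exact ⟨i, hi, by assumption, WithTop.coe_injective h⟩
  · exact absurd h (by simp)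

theorem exists_of_maxSwap_eq {c : Fin 7} {s : Finset Item} {x : Item} (h : maxSwap c s = x) :
    ∃ i ∈ s, i.cls = c ∧ i.swap = x := by
  obtain ⟨i, hi, h⟩ := exists_of_sup_eq_coe h
  split at h
  · exact ⟨i, hi, by assumption, WithBot.coe_injective h⟩
  · exact absurd h (by simp)

theorem exists_of_leastCovered_eq {s : Finset Item} {x : Item} (h : leastCovered s = x) :
    ∃ i ∈ s, SECovered s i ∧ i.inn = x := by
  obtain ⟨i, hi, h⟩ := exists_of_inf_eq_coe h
  rw [mem_coveredSE] at hi
  exact ⟨i, hi.1, hi.2, WithTop.coe_injective h⟩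

theorem leastCovered_le {s : Finset Item} {i : Item} (h : i ∈ s) (hc : SECovered s i) :
    leastCovered s ≤ i.inn := Finset.inf_le (mem_coveredSE.2 ⟨h, hc⟩)

/-- Class 3 is below class 5, so equal abscissas count as covered. This turns the closed left side
of a southeast quadrant into a strict search bound in the inner tree. -/
theorem swap_lt_inn_iff {i p : Item} (h : i.cls = 3) : i.swap < p.inn ↔ i.snd ≤ p.snd := by
  rw [Item.lt_iff, le_iff_lt_or_eq]
  simp [h]

/-- The least item of `s` above `a`, if there is an `a`. -/
noncomputable def leastAbove (s : Finset Item) : WithTop Item → WithTop Item :=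
  WithTop.recTopCoe ⊤ fun a => least (between s a ⊤)

/-- The leftmost covered point of a union of two sets, the first of which precedes the second. -/
theorem leastCovered_union {s s' : Finset Item} (hs : ∀ i ∈ s, ∀ j ∈ s', i < j) :
    leastCovered (s ∪ s') =
      leastCovered s ⊓ leastCovered s' ⊓ leastAbove (innerSet s) (minSwap 3 s') := by
  apply le_antisymm
  · refine le_inf (le_inf ?_ ?_) ?_
    · refine Finset.le_inf fun i hi => ?_
      rw [mem_coveredSE] at hi
      obtain ⟨hi, h2, j, hj, h⟩ := hi
      exact leastCovered_le (Finset.mem_union_left _ hi) ⟨h2, j, Finset.mem_union_left _ hj, h⟩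
    · refine Finset.le_inf fun i hi => ?_
      rw [mem_coveredSE] at hi
      obtain ⟨hi, h2, j, hj, h⟩ := hi
      exact leastCovered_le (Finset.mem_union_right _ hi) ⟨h2, j, Finset.mem_union_right _ hj, h⟩
    · cases ha : minSwap 3 s' using WithTop.recTopCoe with
      | top => exact le_top
      | coe a =>
        refine Finset.le_inf fun i hi => ?_
        rw [mem_between, mem_innerSet] at hi
        obtain ⟨⟨p, hp, hp2, rfl⟩, hlt, -⟩ := hi
        obtain ⟨j, hj, hj3, rfl⟩ := exists_of_minSwap_eq ha
        exact leastCovered_le (Finset.mem_union_left _ hp) ⟨hp2, j, Finset.mem_union_right _ hj, hj3,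
          hs _ hp _ hj, (swap_lt_inn_iff hj3).1 (WithBot.coe_lt_coe.1 hlt)⟩
  -- A covered point and its quadrant lie in the same part, or the point lies in `s` and the
  -- quadrant in `s'`. In the mixed case the southeast quadrant of `s'` that extends farthest left
  -- does as well. The converse mixture contradicts the order of the parts.
  · refine Finset.le_inf fun i hi => ?_
    rw [mem_coveredSE] at hi
    obtain ⟨hi, h2, j, hj, hj3, hlt, hle⟩ := hi
    rcases Finset.mem_union.1 hi with hi | hi
    · rcases Finset.mem_union.1 hj with hj | hj
      · exact inf_le_left.trans (inf_le_left.trans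
          (leastCovered_le hi ⟨h2, j, hj, hj3, hlt, hle⟩))
      · refine inf_le_right.trans ?_
        cases ha : minSwap 3 s' using WithTop.recTopCoe with
        | top =>
          have := minSwap_le hj hj3
          rw [ha] at this
          simp at this
        | coe a =>
          refine least_le ?_
          rw [mem_between, mem_innerSet]
          refine ⟨⟨i, hi, h2, rfl⟩, ?_, WithTop.coe_lt_top _⟩
          have := minSwap_le hj hj3
          rw [ha, WithTop.coe_le_coe] at this
          exact WithBot.coe_lt_coe.2 (this.trans_lt ((swap_lt_inn_iff hj3).2 hle))
    · rcases Finset.mem_union.1 hj with hj | hj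
      · exact absurd hlt (hs _ hj _ hi).not_gt
      · exact inf_le_left.trans (inf_le_right.trans
          (leastCovered_le hi ⟨h2, j, hj, hj3, hlt, hle⟩))

/-- The summary of a set of items that is stored in a node. -/
noncomputable def encSummary (s : Finset Item) : Val :=
  .pair (encMin (least s)) (.pair (encMin (leastCovered s)) (.pair (encMin (minSwap 3 s))
    (.pair (encMin (minSwap 0 s)) (.pair (encMax (maxSwap 4 s)) (encMax (maxSwap 1 s))))))

theorem encSummary_empty : encSummary ∅ =
    .pair .nil (.pair .nil (.pair .nil (.pair .nil (.pair .nil .nil)))) := by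
  simp [encSummary, least, leastCovered, coveredSE, minSwap, maxSwap]

/-! ## Search trees -/

/-- Search trees.  A node stores the number `cd` of updates until it is rebuilt, the number `used`
of updates since it was built, the number `m` of items with which it was built, a router, an inner
tree, and its children. -/
inductive RTree
  | nil
  | leaf (i : Item)
  | node (cd used m : ℕ) (r : Item) (x a b : RTree)

namespace RTree

/-- The items in the leaves. -/
noncomputable def items : RTree → Finset Item
  | nil => ∅
  | leaf i => {i}
  | node _ _ _ _ _ a b => a.items ∪ b.items

/-- The items in the leaves, from left to right. -/
def toList : RTree → List Item
  | nil => []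
  | leaf i => [i]
  | node _ _ _ _ _ a b => a.toList ++ b.toList

/-- The number of leaves. -/
def slots : RTree → ℕ
  | nil => 1
  | leaf _ => 1
  | node _ _ _ _ _ a b => a.slots + b.slots

def depth : RTree → ℕ
  | nil => 0
  | leaf _ => 0
  | node _ _ _ _ _ a b => max a.depth b.depth + 1

/-- The inner tree. -/
def inner : RTree → RTree
  | nil => nil
  | leaf i => if i.cls = 2 then leaf i.inn else nil
  | node _ _ _ _ x _ _ => x

noncomputable def enc : RTree → Val
  | nil => .nil
  | leaf i => .pair .nil (encItem i)
  | node cd _ _ r x a b => .pair (.pair (encNat cd) (encItem r))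
      (.pair (.pair x.enc (encSummary (a.items ∪ b.items))) (.pair a.enc b.enc))

/-- The invariants of a tree of weight at most `w`. -/
def Inv : RTree → ℕ → Prop
  | nil, w => 1 ≤ w
  | leaf _, w => 1 ≤ w
  | node cd used m r x a b, w => cd + used = m / 4 ∧ m + used ≤ w ∧ 2 ≤ m ∧
      a.slots + b.slots ≤ m + used ∧ m ≤ (a.items ∪ b.items).card + used ∧
      (∀ i ∈ a.items, i < r) ∧ (∀ i ∈ b.items, r ≤ i) ∧ x.items = innerSet (a.items ∪ b.items) ∧
      x.Inv (2 * x.items.card + 1) ∧ a.Inv ((m + 1) / 2 + used) ∧ b.Inv ((m + 1) / 2 + used)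

/-- The potential: every node holds an amount `R m` for every update since it was built. -/
def phi (R : ℕ → ℕ) : RTree → ℕ
  | nil => 0
  | leaf _ => 0
  | node _ used m _ x a b => x.phi R + a.phi R + b.phi R + used * R m

theorem Inv.mono {t : RTree} {w w' : ℕ} (h : t.Inv w) (hw : w ≤ w') : t.Inv w' := by
  cases t with
  | nil => exact le_trans h hw
  | leaf i => exact le_trans h hw
  | node => exact ⟨h.1, h.2.1.trans hw, h.2.2⟩

/-- Since `used ≤ m / 4` and `m ≤ card + used`, the weight `m + used` is at most twice the number of
items. Hence deletions cannot leave an oversized tree, and weight bounds can be restated in terms of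
the current content. -/
theorem Inv.tight {t : RTree} {w : ℕ} (h : t.Inv w) : t.Inv (2 * t.items.card + 1) := by
  cases t with
  | nil => simp [Inv]
  | leaf i => simp [Inv]
  | node cd used m r x a b =>
    obtain ⟨h1, h2, h3, h4, h5, h6⟩ := h
    refine ⟨h1, ?_, h3, h4, h5, h6⟩
    simp only [items]
    omega

theorem Inv.slots_le {t : RTree} {w : ℕ} (h : t.Inv w) : t.slots ≤ w := by
  cases t with
  | nil => exact h
  | leaf i => exact h
  | node => exact h.2.2.2.1.trans h.2.1

theorem Inv.inner {t : RTree} {w : ℕ} (h : t.Inv w) : t.inner.items = innerSet t.items ∧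
    t.inner.Inv (2 * t.items.card + 1) := by
  cases t with
  | nil => simp [RTree.inner, items, innerSet, Inv]
  | leaf i =>
    by_cases hi : i.cls = 2
    · simp [RTree.inner, items, innerSet, Inv, hi, Finset.filter_singleton]
    · simp [RTree.inner, items, innerSet, Inv, hi, Finset.filter_singleton]
  | node cd used m r x a b =>
    obtain ⟨-, -, -, -, -, -, -, h1, h2, -⟩ := h
    refine ⟨h1, h2.mono ?_⟩
    have := card_innerSet_le (a.items ∪ b.items)
    rw [← h1] at this
    simp only [items]
    omega

/-- From `used ≤ m / 4` and `2 ≤ m` it follows that the weight bound `(m + 1) / 2 + used` of a child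
is at most two thirds of `m + used`. -/
theorem Inv.pow_le {t : RTree} {w : ℕ} (h : t.Inv w) : 3 ^ t.depth ≤ 2 ^ t.depth * w := by
  induction t generalizing w with
  | nil => simpa [depth, Inv] using h
  | leaf i => simpa [depth, Inv] using h
  | node cd used m r x a b _ iha ihb =>
    obtain ⟨h1, h2, h3, -, -, -, -, -, -, ha, hb⟩ := h
    have key : ∀ d, 3 ^ d ≤ 2 ^ d * ((m + 1) / 2 + used) → 3 ^ (d + 1) ≤ 2 ^ (d + 1) * w := by
      intro d hd
      have : 3 * ((m + 1) / 2 + used) ≤ 2 * w := by omega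
      calc 3 ^ (d + 1) = 3 * 3 ^ d := by ring
        _ ≤ 3 * (2 ^ d * ((m + 1) / 2 + used)) := by gcongr
        _ = 2 ^ d * (3 * ((m + 1) / 2 + used)) := by ring
        _ ≤ 2 ^ d * (2 * w) := by gcongr
        _ = 2 ^ (d + 1) * w := by ring
    simp only [depth]
    rcases max_cases a.depth b.depth with ⟨h, -⟩ | ⟨h, -⟩ <;> rw [h]
    · exact key _ (iha ha)
    · exact key _ (ihb hb)

theorem Inv.depth_le {t : RTree} {w : ℕ} (h : t.Inv w) : t.depth ≤ 3 * lg w := by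
  by_contra hd
  push Not at hd
  have h1 := h.pow_le
  have h2 : w + 2 < 2 ^ (lg w + 1) := Nat.lt_pow_succ_log_self (by norm_num) _
  have h3 : 1 ≤ lg w := Nat.log_pos (by norm_num) (by omega)
  -- This is `2 ^ d * 2 ^ (l + 1) ≤ 3 ^ d` at `d = 3 * l + 1`. It fails for `l = 0`, which is why
  -- `lg` is shifted to be positive.
  have h4 : ∀ l, 1 ≤ l → 4 * 16 ^ l ≤ 3 * 27 ^ l := by
    intro l hl
    induction l, hl using Nat.le_induction with
    | base => norm_num
    | succ l _ ih => rw [pow_succ, pow_succ]; omega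
  have h5 : ∀ d, 3 * lg w + 1 ≤ d → 2 ^ d * 2 ^ (lg w + 1) ≤ 3 ^ d := by
    intro d hd
    induction d, hd using Nat.le_induction with
    | base =>
      calc 2 ^ (3 * lg w + 1) * 2 ^ (lg w + 1) = 4 * (2 ^ (3 * lg w) * 2 ^ lg w) := by ring
        _ = 4 * 16 ^ lg w := by rw [pow_mul, ← mul_pow]; norm_num
        _ ≤ 3 * 27 ^ lg w := h4 _ h3
        _ = 3 ^ (3 * lg w + 1) := by rw [pow_succ, pow_mul]; norm_num [mul_comm]
    | succ d _ ih =>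
      calc 2 ^ (d + 1) * 2 ^ (lg w + 1) = 2 * (2 ^ d * 2 ^ (lg w + 1)) := by ring
        _ ≤ 3 * 3 ^ d := Nat.mul_le_mul (by norm_num) ih
        _ = 3 ^ (d + 1) := by ring
  have h6 := h5 _ hd
  have h7 : 2 ^ t.depth * w < 2 ^ t.depth * 2 ^ (lg w + 1) := by gcongr; omega
  omega

theorem mem_toList {t : RTree} {i : Item} : i ∈ t.toList ↔ i ∈ t.items := by
  induction t with
  | nil => simp [toList, items]
  | leaf j => simp [toList, items]
  | node cd used m r x a b _ iha ihb => simp [toList, items, iha, ihb]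

theorem toFinset_toList (t : RTree) : t.toList.toFinset = t.items := by
  ext i; simp [mem_toList]

theorem length_toList_le (t : RTree) : t.toList.length ≤ t.slots := by
  induction t with
  | nil => simp [toList, slots]
  | leaf j => simp [toList, slots]
  | node cd used m r x a b _ iha ihb => simp [toList, slots]; omega

theorem Inv.sorted {t : RTree} {w : ℕ} (h : t.Inv w) : t.toList.Pairwise (· < ·) := by
  induction t generalizing w with
  | nil => simp [toList]
  | leaf j => simp [toList]
  | node cd used m r x a b _ iha ihb =>
    obtain ⟨-, -, -, -, -, h1, h2, -, -, ha, hb⟩ := h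
    rw [toList, List.pairwise_append]
    exact ⟨iha ha, ihb hb, fun i hi j hj =>
      (h1 i (mem_toList.1 hi)).trans_le (h2 j (mem_toList.1 hj))⟩

theorem Inv.lt {cd used m : ℕ} {r : Item} {x a b : RTree} {w : ℕ}
    (h : (node cd used m r x a b).Inv w) : ∀ i ∈ a.items, ∀ j ∈ b.items, i < j :=
  fun i hi j hj => (h.2.2.2.2.2.1 i hi).trans_le (h.2.2.2.2.2.2.1 j hj)

end RTree

/-! ## Queries -/

namespace RTree

@[simp] theorem enc_nil : nil.enc = .nil := rfl
@[simp] theorem enc_leaf (i : Item) : (leaf i).enc = .pair .nil (encItem i) := rfl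
@[simp] theorem enc_node (cd used m : ℕ) (r : Item) (x a b : RTree) :
    (node cd used m r x a b).enc = .pair (.pair (encNat cd) (encItem r))
      (.pair (.pair x.enc (encSummary (a.items ∪ b.items))) (.pair a.enc b.enc)) := rfl

theorem encSummary_singleton (i : Item) : encSummary {i} = .pair (encItem i) (.pair .nil
    (.pair (if i.cls = 3 then encItem i.swap else .nil) (.pair
      (if i.cls = 0 then encItem i.swap else .nil) (.pair
        (if i.cls = 4 then encItem i.swap else .nil)
        (if i.cls = 1 then encItem i.swap else .nil))))) := by
  have h : leastCovered {i} = ⊤ := by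
    refine top_le_iff.1 (Finset.le_inf fun j hj => ?_)
    rw [mem_coveredSE] at hj
    obtain ⟨hj, -, l, hl, -, hlt, -⟩ := hj
    rw [Finset.mem_singleton] at hj hl
    subst hj hl
    exact absurd hlt (lt_irrefl _)
  simp only [encSummary, h, least, minSwap, maxSwap, Finset.inf_singleton, Finset.sup_singleton,
    apply_ite encMin, apply_ite encMax, encMin_coe, encMax_coe, encMin_top, encMax_bot]

theorem info_spec (t : RTree) : Fn fInfo t.enc fun w τ => w = encSummary t.items ∧ τ ≤ 100 := by
  rw [fn_info]
  cases t with
  | nil => simp [infoBody, run, items, encSummary_empty]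
  | leaf i =>
    obtain ⟨k, ⟨c, hc⟩, z⟩ := i
    rw [items, encSummary_singleton]
    simp only [infoBody, run, enc_leaf, encItem_fst, encItem_snd, Item.swap, encItem]
    interval_cases c <;> simp only [encNat, run] <;>
      exact ⟨rfl, by omega⟩
  | node =>
    simp only [infoBody, run, enc_node, items]
    exact ⟨trivial, by omega⟩

theorem inner_spec (t : RTree) : Fn fInner t.enc fun w τ => w = t.inner.enc ∧ τ ≤ 60 := by
  rw [fn_inner]
  cases t with
  | nil => simp [innerBody, run, RTree.inner]
  | leaf i =>
    obtain ⟨k, ⟨c, hc⟩, z⟩ := i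
    simp only [innerBody, run, enc_leaf, encItem_fst, encItem_snd, encItem]
    interval_cases c <;> simp only [encNat, run] <;> exact ⟨rfl, by omega⟩
  | node =>
    simp only [innerBody, run, enc_node, RTree.inner]
    exact ⟨trivial, by omega⟩

/-- The trees `t` and the set `s` of items after those of `t` satisfy: the inner tree of `t` can be
queried, as far as needed for a combination, in time `g`. -/
def InnerQuery (t : RTree) (s : Finset Item) (g : ℕ) : Prop :=
  ∀ a : Item, minSwap 3 s = a →
    Fn fQuery (.pair t.inner.enc (.pair (encItem a) .nil)) fun w τ =>
      w = encSummary (between (innerSet t.items) a ⊤) ∧ τ ≤ g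

theorem leastAbove_spec {t : RTree} {s : Finset Item} {g : ℕ} (hg : t.InnerQuery s g) :
    Fn fLeastAbove (.pair t.enc (encMin (minSwap 3 s))) fun w τ =>
      w = encMin (leastAbove (innerSet t.items) (minSwap 3 s)) ∧ τ ≤ g + 100 := by
  rw [fn_leastAbove]
  simp only [leastAboveBody, run]
  cases ha : minSwap 3 s using WithTop.recTopCoe with
  | top =>
    simp only [encMin_top, run]
    exact ⟨rfl, by omega⟩
  | coe a =>
    simp only [encMin_coe, run, encItem_cases]
    refine t.inner_spec.mono ?_
    rintro _ t1 ⟨rfl, h1⟩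
    refine (hg a ha).mono ?_
    rintro _ t2 ⟨rfl, h2⟩
    exact ⟨rfl, by omega⟩

theorem combine_spec {t : RTree} {s : Finset Item} {g : ℕ} (hs : ∀ i ∈ t.items, ∀ j ∈ s, i < j)
    (hg : t.InnerQuery s g) :
    Fn fCombine (.pair t.enc (encSummary s)) fun w τ =>
      w = encSummary (t.items ∪ s) ∧ τ ≤ g + 8000 := by
  rw [fn_combine]
  simp only [combineBody, run]
  refine t.info_spec.mono ?_
  rintro _ t1 ⟨rfl, h1⟩
  simp only [encSummary, run]
  refine (minItem_spec _ _).mono ?_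
  rintro _ t2 ⟨rfl, h2⟩
  refine (minItem_spec _ _).mono ?_
  rintro _ t3 ⟨rfl, h3⟩
  refine (leastAbove_spec hg).mono ?_
  rintro _ t9 ⟨rfl, h9⟩
  refine (minItem_spec _ _).mono ?_
  rintro _ t4 ⟨rfl, h4⟩
  refine (minItem_spec _ _).mono ?_
  rintro _ t5 ⟨rfl, h5⟩
  refine (minItem_spec _ _).mono ?_
  rintro _ t6 ⟨rfl, h6⟩
  refine (maxItem_spec _ _).mono ?_
  rintro _ t7 ⟨rfl, h7⟩
  refine (maxItem_spec _ _).mono ?_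
  rintro _ t8 ⟨rfl, h8⟩
  refine ⟨?_, by omega⟩
  rw [least_union, minSwap_union, minSwap_union, maxSwap_union, maxSwap_union,
    leastCovered_union hs]

/-- The items of a list of trees. -/
noncomputable def itemsOf : List RTree → Finset Item
  | [] => ∅
  | t :: l => t.items ∪ itemsOf l

theorem mem_itemsOf {l : List RTree} {i : Item} : i ∈ itemsOf l ↔ ∃ t ∈ l, i ∈ t.items := by
  induction l with
  | nil => simp [itemsOf]
  | cons t l ih => simp [itemsOf, ih]

@[simp] theorem itemsOf_append (l l' : List RTree) : itemsOf (l ++ l') = itemsOf l ∪ itemsOf l' := by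
  induction l with
  | nil => simp [itemsOf]
  | cons t l ih => simp [itemsOf, ih, Finset.union_assoc]

/-- A list of trees that follow each other. -/
def Ordered (l : List RTree) : Prop :=
  l.Pairwise fun t t' => ∀ i ∈ t.items, ∀ j ∈ t'.items, i < j

theorem Ordered.append {l l' : List RTree} (h : Ordered l) (h' : Ordered l')
    (hl : ∀ i ∈ itemsOf l, ∀ j ∈ itemsOf l', i < j) : Ordered (l ++ l') := by
  refine List.pairwise_append.2 ⟨h, h', fun t ht t' ht' i hi j hj => ?_⟩
  exact hl i (mem_itemsOf.2 ⟨t, ht, hi⟩) j (mem_itemsOf.2 ⟨t', ht', hj⟩)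

/-- The number of proper bounds. -/
noncomputable def sides (lo : WithBot Item) (hi : WithTop Item) : ℕ :=
  (if lo = ⊥ then 0 else 1) + if hi = ⊤ then 0 else 1

/-- `l` is a canonical decomposition of the items of `t` between `lo` and `hi`. -/
structure Canonical (t : RTree) (w : ℕ) (lo : WithBot Item) (hi : WithTop Item) (l : List RTree) :
    Prop where
  items_eq : itemsOf l = between t.items lo hi
  ordered : Ordered l
  inv : ∀ u ∈ l, u.Inv w
  length_le : l.length ≤ 1 + sides lo hi * t.depth

theorem between_eq_of {s : Finset Item} {lo lo' : WithBot Item} {hi hi' : WithTop Item}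
    (h : ∀ i ∈ s, (lo < (i : WithBot Item) ∧ (i : WithTop Item) < hi ↔
      lo' < (i : WithBot Item) ∧ (i : WithTop Item) < hi')) : between s lo hi = between s lo' hi' :=
  Finset.filter_congr h

theorem between_eq_empty {s : Finset Item} {lo : WithBot Item} {hi : WithTop Item}
    (h : ∀ i ∈ s, ¬ (lo < (i : WithBot Item) ∧ (i : WithTop Item) < hi)) : between s lo hi = ∅ :=
  Finset.filter_eq_empty_iff.2 h

section
variable {cd used m w : ℕ} {r : Item} {x a b : RTree} {lo : WithBot Item} {hi : WithTop Item}
  {l l' : List RTree}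

theorem Inv.left (h : (node cd used m r x a b).Inv w) : a.Inv w := by
  obtain ⟨-, h2, h3, -, -, -, -, -, -, ha, hb⟩ := h
  exact ha.mono (by omega)

theorem Inv.right (h : (node cd used m r x a b).Inv w) : b.Inv w := by
  obtain ⟨-, h2, h3, -, -, -, -, -, -, ha, hb⟩ := h
  exact hb.mono (by omega)

theorem Inv.left_lt (h : (node cd used m r x a b).Inv w) : ∀ i ∈ a.items, i < r :=
  h.2.2.2.2.2.1

theorem Inv.le_right (h : (node cd used m r x a b).Inv w) : ∀ i ∈ b.items, r ≤ i :=
  h.2.2.2.2.2.2.1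

theorem Canonical.self {t : RTree} (h : t.Inv w) : Canonical t w ⊥ ⊤ [t] :=
  ⟨by simp [itemsOf], List.pairwise_singleton _ _, by simpa using h, by simp [sides]⟩

theorem Canonical.left (h : (node cd used m r x a b).Inv w) (hr : hi ≤ (r : WithTop Item))
    (hl : Canonical a w lo hi l) : Canonical (node cd used m r x a b) w lo hi l := by
  refine ⟨?_, hl.ordered, hl.inv, hl.length_le.trans ?_⟩
  · rw [hl.items_eq, items, between_union, between_eq_empty (s := b.items), Finset.union_empty]
    rintro i hi' ⟨-, h'⟩
    exact (h'.trans_le hr).not_ge (WithTop.coe_le_coe.2 (h.le_right i hi'))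
  · simp only [depth]
    gcongr
    exact (le_max_left _ _).trans (Nat.le_succ _)

theorem Canonical.right (h : (node cd used m r x a b).Inv w) (hr : (r : WithBot Item) ≤ lo)
    (hl : Canonical b w lo hi l) : Canonical (node cd used m r x a b) w lo hi l := by
  refine ⟨?_, hl.ordered, hl.inv, hl.length_le.trans ?_⟩
  · rw [hl.items_eq, items, between_union, between_eq_empty (s := a.items), Finset.empty_union]
    rintro i hi' ⟨h', -⟩
    exact (hr.trans_lt h').not_gt (WithBot.coe_lt_coe.2 (h.left_lt i hi'))
  · simp only [depth]
    gcongr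
    exact (le_max_right _ _).trans (Nat.le_succ _)

/-- A router strictly inside the range splits it into two ranges, each without the inner bound, so
the two lengths together gain one bounded range per level at most. Without any bound the node itself
is the decomposition; `hs` excludes that case, where the length bound would fail. -/
theorem Canonical.both (h : (node cd used m r x a b).Inv w) (hlo : lo < (r : WithBot Item))
    (hhi : (r : WithTop Item) < hi) (hs : lo ≠ ⊥ ∨ hi ≠ ⊤) (hl : Canonical a w lo ⊤ l)
    (hl' : Canonical b w ⊥ hi l') :
    Canonical (node cd used m r x a b) w lo hi (l ++ l') := by
  refine ⟨?_, hl.ordered.append hl'.ordered ?_, ?_, ?_⟩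
  · rw [itemsOf_append, hl.items_eq, hl'.items_eq, items, between_union]
    congr 1
    · refine between_eq_of fun i hi' => ?_
      have := (WithTop.coe_lt_coe.2 (h.left_lt i hi')).trans hhi
      simp [this]
    · refine between_eq_of fun i hi' => ?_
      have := hlo.trans_le (WithBot.coe_le_coe.2 (h.le_right i hi'))
      simp [this]
  · rw [hl.items_eq, hl'.items_eq]
    intro i hi' j hj
    exact h.lt i (mem_between.1 hi').1 j (mem_between.1 hj).1
  · intro u hu
    rcases List.mem_append.1 hu with hu | hu
    · exact hl.inv u hu
    · exact hl'.inv u hu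
  · have h1 := hl.length_le
    have h2 := hl'.length_le
    have h3 := le_max_left a.depth b.depth
    have h4 := le_max_right a.depth b.depth
    simp only [List.length_append, depth]
    generalize max a.depth b.depth = d at *
    by_cases e1 : lo = ⊥ <;> by_cases e2 : hi = ⊤ <;> simp [sides, e1, e2] at h1 h2 hs ⊢ <;> omega

end

@[simp] theorem encList_nil {α : Type} (f : α → Val) : encList f [] = .nil := rfl
@[simp] theorem encList_cons {α : Type} (f : α → Val) (a : α) (l : List α) :
    encList f (a :: l) = .pair (f a) (encList f l) := rfl

theorem Canonical.leaf_of_mem {i : Item} {w : ℕ} {lo : WithBot Item} {hi : WithTop Item}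
    (hw : 1 ≤ w) (h1 : lo < (i : WithBot Item)) (h2 : (i : WithTop Item) < hi) :
    Canonical (leaf i) w lo hi [leaf i] := by
  refine ⟨?_, List.pairwise_singleton _ _, by simpa [Inv] using hw, by simp⟩
  simp [itemsOf, items, between, Finset.filter_singleton, h1, h2]

theorem Canonical.leaf_of_notMem {i : Item} {w : ℕ} {lo : WithBot Item} {hi : WithTop Item}
    (h : ¬ (lo < (i : WithBot Item) ∧ (i : WithTop Item) < hi)) :
    Canonical (leaf i) w lo hi [] := by
  refine ⟨?_, List.Pairwise.nil, by simp, by simp⟩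
  simp only [itemsOf, items, between, Finset.filter_singleton, if_neg h]

theorem canon_leaf_spec {i : Item} {w : ℕ} (hw : 1 ≤ w) (acc : List RTree) (lo : WithBot Item)
    (hi : WithTop Item) :
    Fn fCanon (.pair (.pair (leaf i).enc (encList enc acc)) (.pair (encMax lo) (encMin hi)))
      fun v τ => ∃ l, v = encList enc (l ++ acc) ∧ (leaf i).Canonical w lo hi l ∧ τ ≤ 4000 := by
  rw [fn_canon]
  cases lo using WithBot.recBotCoe with
  | bot =>
    cases hi using WithTop.recTopCoe with
    | top =>
      simp only [canonBody, run, enc_leaf, encMax_bot, encMin_top, encMin_coe, encItem_cases]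
      exact ⟨[leaf i], rfl, .leaf_of_mem hw (by simp) (by simp), by omega⟩
    | coe k =>
      simp only [canonBody, run, enc_leaf, encMax_bot, encMin_top, encMin_coe, encItem_cases]
      refine (ltItem_spec _ _).mono ?_
      rintro _ t1 ⟨rfl, h1⟩
      simp only [decide_cases, run, encMin_top, encMin_coe, encItem_cases]
      refine ⟨fun h => ⟨[leaf i], rfl, .leaf_of_mem hw (by simp) (by simpa using h), by omega⟩,
        fun h => ⟨[], rfl, .leaf_of_notMem (by simpa using h), by omega⟩⟩
  | coe j =>
    simp only [canonBody, run, enc_leaf, encMax_coe, encItem_cases]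
    refine (ltItem_spec _ _).mono ?_
    rintro _ t1 ⟨rfl, h1⟩
    simp only [decide_cases, run, encMin_top, encMin_coe, encItem_cases]
    refine ⟨fun h => ?_, fun h => ⟨[], rfl, .leaf_of_notMem (by simp [h]), by omega⟩⟩
    cases hi using WithTop.recTopCoe with
    | top =>
      simp only [run, encMin_top]
      exact ⟨[leaf i], rfl, .leaf_of_mem hw (by simpa using h) (by simp), by omega⟩
    | coe k =>
      simp only [run, encMin_coe, encItem_cases]
      refine (ltItem_spec _ _).mono ?_
      rintro _ t2 ⟨rfl, h2⟩
      simp only [decide_cases, run, encMin_top, encMin_coe, encItem_cases]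
      refine ⟨fun h' => ⟨[leaf i], rfl, .leaf_of_mem hw (by simpa using h) (by simpa using h'),
        by omega⟩, fun h' => ⟨[], rfl, .leaf_of_notMem (by simp [h']), by omega⟩⟩

theorem canon_spec {t : RTree} {w : ℕ} (h : t.Inv w) (acc : List RTree) (lo : WithBot Item)
    (hi : WithTop Item) :
    Fn fCanon (.pair (.pair t.enc (encList enc acc)) (.pair (encMax lo) (encMin hi))) fun v τ =>
      ∃ l, v = encList enc (l ++ acc) ∧ t.Canonical w lo hi l ∧
        τ ≤ 4000 * (1 + sides lo hi * t.depth) := by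
  induction t generalizing acc lo hi with
  | nil =>
    rw [fn_canon]
    simp only [canonBody, run, enc_nil]
    refine ⟨[], rfl, ⟨?_, List.Pairwise.nil, by simp, by simp⟩, by omega⟩
    simp [itemsOf, items, between]
  | leaf i =>
    refine (canon_leaf_spec h acc lo hi).mono ?_
    rintro _ τ ⟨l, rfl, hl, hτ⟩
    exact ⟨l, rfl, hl, by omega⟩
  | node cd used m r x a b _ iha ihb =>
    have iha := fun acc lo hi => iha h.left acc lo hi
    have ihb := fun acc lo hi => ihb h.right acc lo hi
    have da : a.depth + 1 ≤ (node cd used m r x a b).depth := by simp [depth]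
    have db : b.depth + 1 ≤ (node cd used m r x a b).depth := by simp [depth]
    generalize (node cd used m r x a b).depth = d at da db ⊢
    rw [fn_canon]
    cases lo using WithBot.recBotCoe with
    | bot =>
      cases hi using WithTop.recTopCoe with
      | top =>
        simp only [canonBody, run, enc_node, encMax_bot, encMin_top]
        exact ⟨[_], rfl, .self h, by omega⟩
      | coe k =>
        have iha := iha acc ⊥ k
        have ihb := ihb acc ⊥ k
        simp [sides] at iha ihb
        simp only [canonBody, run, enc_node, encMax_bot, encMin_top, encMax_coe, encMin_coe,
          encItem_cases]
        simp only [sides, WithTop.coe_ne_top, WithBot.coe_ne_bot, if_true, if_false]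
        refine (ltItem_spec _ _).mono ?_
        rintro _ t1 ⟨rfl, h1⟩
        simp only [decide_cases, run, encMin_top, encMin_coe, encItem_cases]
        refine ⟨fun hlt => ?_, fun hlt => ?_⟩
        · refine ihb.mono ?_
          rintro _ t2 ⟨l, rfl, hl, h2⟩
          exact ⟨a :: l, rfl, .both h (by simp) (by simpa using hlt) (by simp) (.self h.left) hl,
            by omega⟩
        · refine iha.mono ?_
          rintro _ t2 ⟨l, rfl, hl, h2⟩
          exact ⟨l, rfl, .left h (by simpa using hlt) hl, by omega⟩
    | coe j =>
      cases hi using WithTop.recTopCoe with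
      | top =>
        have iha := iha (b :: acc) j ⊤
        have ihb := ihb acc j ⊤
        simp [sides] at iha ihb
        simp only [canonBody, run, enc_node, encMax_bot, encMin_top, encMax_coe, encMin_coe,
          encItem_cases]
        simp only [sides, WithTop.coe_ne_top, WithBot.coe_ne_bot, if_true, if_false]
        refine (ltItem_spec _ _).mono ?_
        rintro _ t1 ⟨rfl, h1⟩
        simp only [decide_cases, run, encMin_top, encMin_coe, encItem_cases]
        refine ⟨fun hlt => ?_, fun hlt => ?_⟩
        · refine iha.mono ?_
          rintro _ t2 ⟨l, rfl, hl, h2⟩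
          exact ⟨l ++ [b], by simp, .both h (by simpa using hlt) (by simp) (by simp) hl
            (.self h.right), by omega⟩
        · refine ihb.mono ?_
          rintro _ t2 ⟨l, rfl, hl, h2⟩
          exact ⟨l, rfl, .right h (by simpa using hlt) hl, by omega⟩
      | coe k =>
        have iha1 := iha acc j k
        have ihb1 := ihb acc j k
        have iha2 := fun acc => iha acc j ⊤
        have ihb2 := ihb acc ⊥ k
        simp [sides] at iha1 ihb1 iha2 ihb2
        simp only [canonBody, run, enc_node, encMax_bot, encMin_top, encMax_coe, encMin_coe,
          encItem_cases]
        simp only [sides, WithTop.coe_ne_top, WithBot.coe_ne_bot, if_true, if_false]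
        refine (ltItem_spec _ _).mono ?_
        rintro _ t1 ⟨rfl, h1⟩
        simp only [decide_cases, run, encMin_top, encMin_coe, encItem_cases]
        refine ⟨fun hlt => ?_, fun hlt => ?_⟩
        · refine (ltItem_spec _ _).mono ?_
          rintro _ t2 ⟨rfl, h2⟩
          simp only [decide_cases, run, encMin_top, encMin_coe, encItem_cases]
          refine ⟨fun hlt' => ?_, fun hlt' => ?_⟩
          -- The right child is processed first, so that prepending to the accumulator leaves the
          -- trees in increasing order.
          · refine ihb2.mono ?_
            rintro _ t3 ⟨l', rfl, hl', h3⟩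
            refine (iha2 _).mono ?_
            rintro _ t4 ⟨l, rfl, hl, h4⟩
            exact ⟨l ++ l', by simp, .both h (by simpa using hlt') (by simpa using hlt) (by simp) hl
              hl', by omega⟩
          · refine ihb1.mono ?_
            rintro _ t3 ⟨l, rfl, hl, h3⟩
            exact ⟨l, rfl, .right h (by simpa using hlt') hl, by omega⟩
        · refine iha1.mono ?_
          rintro _ t2 ⟨l, rfl, hl, h2⟩
          exact ⟨l, rfl, .left h (by simpa using hlt) hl, by omega⟩

theorem sides_le (lo : WithBot Item) (hi : WithTop Item) : sides lo hi ≤ 2 := by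
  unfold sides; split <;> split <;> omega

theorem fold_spec {l : List RTree} {g : ℕ} (h : Ordered l)
    (hg : ∀ t ∈ l, ∀ s, s ⊆ itemsOf l → t.InnerQuery s g) :
    Fn fFold (encList enc l) fun v τ =>
      v = encSummary (itemsOf l) ∧ τ ≤ (g + 8020) * (l.length + 1) := by
  induction l with
  | nil =>
    rw [fn_fold]
    simp [foldBody, run, itemsOf, encSummary_empty]
  | cons t l ih =>
    have h' := List.pairwise_cons.1 h
    rw [fn_fold]
    simp [foldBody, run, itemsOf]
    refine (ih h'.2 fun u hu s hs => hg u (by simp [hu]) s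
      (hs.trans Finset.subset_union_right)).mono ?_
    rintro _ t1 ⟨rfl, h1⟩
    refine (combine_spec (fun i hi j hj => ?_) (hg t (by simp) _ Finset.subset_union_right)).mono ?_
    · obtain ⟨u, hu, hj⟩ := mem_itemsOf.1 hj
      exact h'.1 u hu i hi j hj
    · rintro _ t2 ⟨rfl, h2⟩
      refine ⟨rfl, ?_⟩
      have : (g + 8020) * (l.length + 1 + 1) = (g + 8020) * (l.length + 1) + (g + 8020) := by ring
      omega

/-- The cost `g` of a search in an inner tree is a parameter, so that the same statement serves for
inner trees, with `g = 0`, and then for outer trees, with `g` the bound just obtained. -/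
theorem query_spec {t : RTree} {w g : ℕ} (h : t.Inv w)
    (hg : ∀ u : RTree, u.Inv w → ∀ s, s ⊆ t.items → u.InnerQuery s g) (lo : WithBot Item)
    (hi : WithTop Item) :
    Fn fQuery (.pair t.enc (.pair (encMax lo) (encMin hi))) fun v τ =>
      v = encSummary (between t.items lo hi) ∧ τ ≤ (g + 20000) * (2 * t.depth + 2) := by
  rw [fn_query]
  simp only [queryBody, run]
  refine (canon_spec h [] lo hi).mono ?_
  rintro _ t1 ⟨l, rfl, hl, h1⟩
  have hlen := hl.length_le
  have hs : sides lo hi * t.depth ≤ 2 * t.depth := Nat.mul_le_mul_right _ (sides_le lo hi)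
  rw [List.append_nil]
  refine (fold_spec hl.ordered fun u hu s hs => hg u (hl.inv u hu) s (hs.trans ?_)).mono ?_
  · rw [hl.items_eq]; exact Finset.filter_subset _ _
  rintro _ t2 ⟨rfl, h2⟩
  refine ⟨by rw [hl.items_eq], ?_⟩
  have : (g + 8020) * (l.length + 1) ≤ (g + 8020) * (2 * t.depth + 2) :=
    Nat.mul_le_mul_left _ (by omega)
  nlinarith

/-- All items belong to inner trees. -/
def Inner (s : Finset Item) : Prop := ∀ i ∈ s, i.cls = 5

theorem Inner.minSwap_eq {s : Finset Item} (h : Inner s) : minSwap 3 s = ⊤ := by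
  refine top_le_iff.1 (Finset.le_inf fun i hi => ?_)
  rw [if_neg]
  rw [h i hi]
  decide

/-- Inner trees contain no quadrants, so combining their summaries never triggers a deeper search.
This ends the recursion between queries and combinations after two levels. -/
theorem Inner.innerQuery {s : Finset Item} (h : Inner s) (t : RTree) (g : ℕ) :
    t.InnerQuery s g := fun a ha => by rw [h.minSwap_eq] at ha; cases ha

theorem Inner.mono {s s' : Finset Item} (h : Inner s) (hs : s' ⊆ s) : Inner s' :=
  fun i hi => h i (hs hi)

theorem inner_innerSet (s : Finset Item) : Inner (innerSet s) := by
  intro i hi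
  obtain ⟨p, -, -, rfl⟩ := mem_innerSet.1 hi
  rfl

theorem one_le_lg (n : ℕ) : 1 ≤ lg n := Nat.log_pos (by norm_num) (by omega)

theorem lg_mono {m n : ℕ} (h : m ≤ n) : lg m ≤ lg n := Nat.log_mono_right (by omega)

theorem query_inner_spec {t : RTree} {w : ℕ} (h : t.Inv w) (ht : Inner t.items)
    (lo : WithBot Item) (hi : WithTop Item) :
    Fn fQuery (.pair t.enc (.pair (encMax lo) (encMin hi))) fun v τ =>
      v = encSummary (between t.items lo hi) ∧ τ ≤ 160000 * lg w := by
  refine (query_spec h (g := 0) (fun u _ s hs => (ht.mono hs).innerQuery u 0) lo hi).mono ?_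
  rintro _ τ ⟨rfl, hτ⟩
  refine ⟨rfl, ?_⟩
  have := h.depth_le
  have := one_le_lg w
  omega

theorem Inv.innerQuery {t : RTree} {w : ℕ} (h : t.Inv w) (s : Finset Item) :
    t.InnerQuery s (160000 * lg (2 * w + 1)) := by
  intro a _
  have hi := h.inner
  have hw : t.items.card ≤ w := by
    rw [← toFinset_toList]
    exact (List.toFinset_card_le _).trans ((length_toList_le t).trans h.slots_le)
  have := query_inner_spec (hi.2.mono (by omega : _ ≤ 2 * w + 1))
    (by rw [hi.1]; exact inner_innerSet _) a ⊤
  rwa [hi.1] at this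

theorem lg_two_mul_le (w : ℕ) : lg (2 * w + 1) ≤ 2 * lg w := by
  have h : lg (2 * w + 1) ≤ lg w + 1 := by
    unfold lg
    refine Nat.le_of_lt_succ (Nat.log_lt_of_lt_pow (by omega) ?_)
    have := Nat.lt_pow_succ_log_self (b := 2) (by norm_num) (w + 2)
    rw [Nat.succ_eq_add_one] at this ⊢
    rw [pow_succ]
    omega
  have := one_le_lg w
  omega

theorem query_outer_spec {t : RTree} {w : ℕ} (h : t.Inv w) (lo : WithBot Item)
    (hi : WithTop Item) :
    Fn fQuery (.pair t.enc (.pair (encMax lo) (encMin hi))) fun v τ =>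
      v = encSummary (between t.items lo hi) ∧ τ ≤ 3000000 * lg w ^ 2 := by
  refine (query_spec h (fun u hu s _ => hu.innerQuery s) lo hi).mono ?_
  rintro _ τ ⟨rfl, hτ⟩
  refine ⟨rfl, hτ.trans ?_⟩
  have h1 := h.depth_le
  have h2 := one_le_lg w
  have h3 := lg_two_mul_le w
  calc (160000 * lg (2 * w + 1) + 20000) * (2 * t.depth + 2)
      ≤ (340000 * lg w) * (8 * lg w) := by gcongr <;> omega
    _ ≤ 3000000 * lg w ^ 2 := by nlinarith

end RTree

/-! ## Building and updating trees -/

namespace RTree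

/-- The second list is a clock that advances by two items while the first advances by one. -/
theorem halve_spec {l f : List Item} (h : f.length ≤ l.length) :
    Fn fHalve (.pair (encList encItem l) (encList encItem f)) fun v τ =>
      v = .pair (encList encItem (l.take (f.length / 2))) (encList encItem (l.drop (f.length / 2))) ∧
      τ ≤ 60 * (f.length + 1) := by
  induction hn : f.length using Nat.strong_induction_on generalizing l f with
  | _ n ih =>
    rw [fn_halve]
    match f, l with
    | [], l =>
      subst hn
      simp only [halveBody, run, encList_nil]
      exact ⟨by simp, by simp⟩
    | [x], l =>
      subst hn
      simp only [halveBody, run, encList_cons, encList_nil, encItem_cases]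
      exact ⟨by simp, by simp⟩
    | x :: y :: f, [] => simp at h
    | x :: y :: f, a :: l =>
      subst hn
      simp only [halveBody, run, encList_cons, encItem_cases]
      refine (ih f.length (by simp) (l := l) (f := f) (by simpa using by simp at h; omega) rfl).mono ?_
      rintro _ t1 ⟨rfl, h1⟩
      have e : (x :: y :: f).length / 2 = f.length / 2 + 1 := by simp; omega
      simp only [run, e, List.take_succ_cons, List.drop_succ_cons, encList_cons]
      exact ⟨trivial, by simp; omega⟩

theorem quarter_spec (l : List Item) : Fn fQuarter (encList encItem l) fun v τ =>
    v = encNat (l.length / 4) ∧ τ ≤ 60 * (l.length + 1) := by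
  induction hn : l.length using Nat.strong_induction_on generalizing l with
  | _ n ih =>
    rw [fn_quarter]
    match l with
    | [] => subst hn; simp only [quarterBody, run, encList_nil]; exact ⟨by simp [encNat], by simp⟩
    | [_] => subst hn; simp only [quarterBody, run, encList_nil, encList_cons]; exact ⟨by simp [encNat], by simp⟩
    | [_, _] =>
      subst hn; simp only [quarterBody, run, encList_nil, encList_cons]; exact ⟨by simp [encNat], by simp⟩
    | [_, _, _] =>
      subst hn; simp only [quarterBody, run, encList_nil, encList_cons]; exact ⟨by simp [encNat], by simp⟩
    | a :: b :: c :: d :: l =>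
      subst hn
      simp only [quarterBody, run, encList_cons]
      refine (ih l.length (by simp; omega) l rfl).mono ?_
      rintro _ t1 ⟨rfl, h1⟩
      have e : (a :: b :: c :: d :: l).length / 4 = l.length / 4 + 1 := by simp; omega
      rw [e]
      exact ⟨rfl, by simp; omega⟩

theorem flatten_spec (t : RTree) (acc : List Item) :
    Fn fFlatten (.pair t.enc (encList encItem acc)) fun v τ =>
      v = encList encItem (t.toList ++ acc) ∧ τ + 60 ≤ 120 * t.slots := by
  induction t generalizing acc with
  | nil =>
    rw [fn_flatten]
    simp only [flattenBody, run, enc_nil, toList, slots, List.nil_append]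
    exact ⟨trivial, by omega⟩
  | leaf i =>
    rw [fn_flatten]
    simp only [flattenBody, run, enc_leaf, toList, slots]
    exact ⟨rfl, by omega⟩
  | node cd used m r x a b _ iha ihb =>
    rw [fn_flatten]
    simp only [flattenBody, run, enc_node, toList, slots]
    refine (ihb acc).mono ?_
    rintro _ t1 ⟨rfl, h1⟩
    refine (iha _).mono ?_
    rintro _ t2 ⟨rfl, h2⟩
    exact ⟨by rw [List.append_assoc], by omega⟩

/-- `t` is a freshly built tree for the list `l`. -/
structure Fresh (l : List Item) (t : RTree) : Prop where
  items_eq : t.items = l.toFinset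
  inv : t.Inv (max 1 l.length)
  slots_eq : t.slots = max 1 l.length
  phi_eq : ∀ R, t.phi R = 0

/-- The inner tree for the list `l` can be constructed in time `E` per item. -/
def InnerBuild (l : List Item) (E : ℕ) : Prop :=
  Fn fInsertInner (.pair (encList encItem l) .nil) fun y t1 => Fn fFlatten (.pair y .nil) fun z t2 =>
    Fn fBuild z fun v t3 => ∃ x : RTree, v = x.enc ∧ x.items = innerSet l.toFinset ∧
      x.Inv (2 * x.items.card + 1) ∧ (∀ R, x.phi R = 0) ∧ t1 + t2 + t3 ≤ E * (l.length + 1)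

theorem card_toFinset_of_sorted {l : List Item} (h : l.Pairwise (· < ·)) :
    l.toFinset.card = l.length :=
  List.toFinset_card_of_nodup (h.imp fun h => h.ne)

/-- Halving gives `k` levels. A node spends on each of its items a constant amount plus `E` for the
inner tree, and one combination with an inner search. -/
theorem build_step {l : List Item} (hl : l.Pairwise (· < ·)) {n E k : ℕ} (hn : l.length ≤ n)
    (hE : ∀ l', l' ⊆ l → l'.Pairwise (· < ·) → l'.length ≤ n → InnerBuild l' E)
    (hk : l.length ≤ 2 ^ k) :
    Fn fBuild (encList encItem l) fun v τ => ∃ t : RTree, v = t.enc ∧ Fresh l t ∧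
      τ ≤ (2 * E + 160000 * lg (2 * n + 3) + 10000) * (l.length * (k + 1) + 1) := by
  set K := 2 * E + 160000 * lg (2 * n + 3) + 10000 with hK
  -- With `max 1` instead of `+ 1`, the bounds of two nonempty halves add up without surplus.
  suffices h : Fn fBuild (encList encItem l) fun v τ => ∃ t : RTree, v = t.enc ∧ Fresh l t ∧
      τ ≤ K * max 1 (l.length * (k + 1)) by
    refine h.mono ?_
    rintro v τ ⟨t, h1, h2, h3⟩
    exact ⟨t, h1, h2, h3.trans (Nat.mul_le_mul_left _ (by omega))⟩
  have hK1 : ∀ c τ, 1 ≤ c → τ ≤ 10000 → τ ≤ K * c := fun c τ hc hτ =>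
    (show τ ≤ K by omega).trans (Nat.le_mul_of_pos_right _ hc)
  induction k generalizing l with
  | zero =>
    rw [fn_build]
    match l with
    | [] =>
      simp only [buildBody, run, encList_nil]
      refine ⟨nil, rfl, ⟨rfl, by simp [Inv], by simp [slots], fun R => rfl⟩, hK1 _ _ (le_max_left _ _) (by omega)⟩
    | [i] =>
      simp only [buildBody, run, encList_nil, encList_cons]
      refine ⟨leaf i, rfl, ⟨by simp [items], by simp [Inv], by simp [slots], fun R => rfl⟩, hK1 _ _ (le_max_left _ _) (by omega)⟩
    | i :: j :: l => simp at hk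
  | succ k ih =>
    match l with
    | [] =>
      rw [fn_build]
      simp only [buildBody, run, encList_nil]
      refine ⟨nil, rfl, ⟨rfl, by simp [Inv], by simp [slots], fun R => rfl⟩, hK1 _ _ (le_max_left _ _) (by omega)⟩
    | [i] =>
      rw [fn_build]
      simp only [buildBody, run, encList_nil, encList_cons]
      refine ⟨leaf i, rfl, ⟨by simp [items], by simp [Inv], by simp [slots], fun R => rfl⟩, hK1 _ _ (le_max_left _ _) (by omega)⟩
    | i :: j :: l₀ =>
      obtain ⟨l, hlist⟩ : ∃ l, l = i :: j :: l₀ := ⟨_, rfl⟩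
      have hlen : 2 ≤ l.length := by rw [hlist]; simp
      have henc : encList encItem l = .pair (encItem i) (.pair (encItem j) (encList encItem l₀)) := by
        rw [hlist]; rfl
      rw [← hlist] at hl hn hE hk ⊢
      rw [fn_build, henc]
      simp only [buildBody, run]
      rw [← henc]
      refine (halve_spec le_rfl).mono ?_
      rintro _ t1 ⟨rfl, h1⟩
      simp only [run]
      set l1 := l.take (l.length / 2) with hl1
      set l2 := l.drop (l.length / 2) with hl2
      have hlen1 : l1.length = l.length / 2 := by simp [hl1]; omega
      have hlen2 : l2.length = l.length - l.length / 2 := by simp [hl2]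
      have happ : l1 ++ l2 = l := List.take_append_drop _ _
      have hpow : l.length ≤ 2 * 2 ^ k := by rw [pow_succ] at hk; omega
      have hsub1 : l1 ⊆ l := List.take_subset _ _
      have hsub2 : l2 ⊆ l := List.drop_subset _ _
      rw [← happ, List.pairwise_append] at hl
      refine (ih hl.1 (by omega) (fun l' hl' => hE l' (List.Subset.trans hl' hsub1)) (by omega)).mono ?_
      rintro _ t2 ⟨a, rfl, ha, h2⟩
      refine (ih hl.2.1 (by omega) (fun l' hl' => hE l' (List.Subset.trans hl' hsub2)) (by omega)).mono ?_
      rintro _ t3 ⟨b, rfl, hb, h3⟩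
      refine (quarter_spec l).mono ?_
      rintro _ t4 ⟨rfl, h4⟩
      refine (hE l (List.Subset.refl _) (by rw [← happ]; exact List.pairwise_append.2 hl) hn).mono ?_
      intro y t5 h5
      refine h5.mono ?_
      intro z t6 h6
      refine h6.mono ?_
      rintro _ t7 ⟨x, rfl, hx1, hx2, hx3, h7⟩
      refine b.info_spec.mono ?_
      rintro _ t8 ⟨rfl, h8⟩
      have hab : ∀ i ∈ a.items, ∀ j ∈ b.items, i < j := by
        intro i hi j hj
        rw [ha.items_eq, List.mem_toFinset] at hi
        rw [hb.items_eq, List.mem_toFinset] at hj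
        exact hl.2.2 i hi j hj
      refine (combine_spec hab ((ha.inv.mono (by omega : _ ≤ n + 1)).innerQuery _)).mono ?_
      rintro _ t9 ⟨rfl, h9⟩
      obtain ⟨r, l3, hr⟩ : ∃ r l3, l2 = r :: l3 := by
        cases h : l2 with
        | nil => rw [h] at hlen2; simp at hlen2; omega
        | cons r l3 => exact ⟨r, l3, rfl⟩
      have hitems : a.items ∪ b.items = l.toFinset := by
        rw [ha.items_eq, hb.items_eq, ← List.toFinset_append, happ]
      have hcard : (a.items ∪ b.items).card = l.length := by
        rw [hitems, card_toFinset_of_sorted]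
        rw [← happ]; exact List.pairwise_append.2 hl
      have hr2 : r ∈ l2 := by rw [hr]; simp
      refine ⟨node (l.length / 4) 0 l.length r x a b, ?_, ⟨hitems, ?_, ?_, ?_⟩, ?_⟩
      · rw [enc_node, hr]; rfl
      · refine ⟨by omega, by omega, hlen, ?_, by omega, ?_, ?_, ?_, hx2, ?_, ?_⟩
        · rw [ha.slots_eq, hb.slots_eq]; omega
        · intro i hi
          rw [ha.items_eq, List.mem_toFinset] at hi
          exact hl.2.2 i hi r hr2
        · intro i hi
          rw [hb.items_eq, List.mem_toFinset, hr] at hi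
          rcases List.mem_cons.1 hi with rfl | hi
          · exact le_rfl
          · have := hl.2.1
            rw [hr, List.pairwise_cons] at this
            exact (this.1 i hi).le
        · rw [hx1, hitems]
        · exact ha.inv.mono (by omega)
        · exact hb.inv.mono (by omega)
      · simp only [slots]; rw [ha.slots_eq, hb.slots_eq]; omega
      · intro R; simp [phi, hx3, ha.phi_eq, hb.phi_eq]
      · have e1 : max 1 (l1.length * (k + 1)) = l1.length * (k + 1) :=
          max_eq_right (Nat.mul_pos (by omega) (by omega))
        have e2 : max 1 (l2.length * (k + 1)) = l2.length * (k + 1) :=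
          max_eq_right (Nat.mul_pos (by omega) (by omega))
        have e3 : max 1 (l.length * (k + 1 + 1)) = l.length * (k + 1 + 1) :=
          max_eq_right (Nat.mul_pos (by omega) (by omega))
        rw [e1] at h2
        rw [e2] at h3
        rw [e3]
        have e4 : K * (l.length * (k + 1 + 1)) =
            K * (l1.length * (k + 1)) + K * (l2.length * (k + 1)) + K * l.length := by
          have : l.length = l1.length + l2.length := by omega
          rw [this]; ring
        have e5 : E * (l.length + 1) ≤ 2 * E * l.length := by nlinarith
        have e6 : K * l.length =
            2 * E * l.length + 160000 * lg (2 * n + 3) * l.length + 10000 * l.length := by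
          rw [hK]; ring
        have e7 : 160000 * lg (2 * n + 3) ≤ 160000 * lg (2 * n + 3) * l.length :=
          Nat.le_mul_of_pos_right _ (by omega)
        have e8 : 2 * (n + 1) + 1 = 2 * n + 3 := by ring
        rw [e8] at h9
        omega

end RTree

/-! ### Amortized updates by partial rebuilding. -/

namespace RTree

/-- Insertion (`op`) or deletion of an item. -/
noncomputable def modify (op : Bool) (i : Item) (s : Finset Item) : Finset Item :=
  if op then insert i s else s.erase i

theorem mem_modify {op : Bool} {i j : Item} {s : Finset Item} :
    j ∈ modify op i s ↔ if op then j = i ∨ j ∈ s else j ≠ i ∧ j ∈ s := by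
  cases op <;> simp [modify]

theorem mem_of_mem_modify {op : Bool} {i j : Item} {s : Finset Item} (h : j ∈ modify op i s) :
    j = i ∨ j ∈ s := by
  rw [mem_modify] at h
  split at h
  · exact h
  · exact .inr h.2

theorem card_le_card_modify (op : Bool) (i : Item) (s : Finset Item) :
    s.card ≤ (modify op i s).card + 1 := by
  cases op
  · have := Finset.pred_card_le_card_erase (s := s) (a := i)
    simp only [modify]
    simp; omega
  · exact (Finset.card_le_card (Finset.subset_insert _ _)).trans (Nat.le_succ _)

theorem modify_union_left {op : Bool} {i : Item} {s s' : Finset Item} (h : i ∉ s') :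
    modify op i (s ∪ s') = modify op i s ∪ s' := by
  cases op
  · simp [modify, Finset.erase_union_distrib, Finset.erase_eq_of_notMem h]
  · simp [modify]

theorem modify_union_right {op : Bool} {i : Item} {s s' : Finset Item} (h : i ∉ s) :
    modify op i (s ∪ s') = s ∪ modify op i s' := by
  rw [Finset.union_comm, modify_union_left h, Finset.union_comm]

/-- `Item.inn` is injective on items of class 2, so deleting a point removes exactly its own item
from the inner tree. -/
theorem innerSet_modify (op : Bool) (i : Item) (s : Finset Item) : innerSet (modify op i s) =
    if i.cls = 2 then modify op i.inn (innerSet s) else innerSet s := by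
  ext j
  split_ifs with h
  · rw [mem_modify]
    cases op
    · simp only [mem_innerSet, mem_modify]
      constructor
      · rintro ⟨p, hp, hp2, rfl⟩
        refine ⟨fun he => hp.1 ?_, p, hp.2, hp2, rfl⟩
        rw [Item.ext_iff] at he ⊢
        exact ⟨he.2.2, hp2.trans h.symm, he.1⟩
      · rintro ⟨hne, p, hp, hp2, rfl⟩
        exact ⟨p, ⟨fun he => hne (by rw [he]), hp⟩, hp2, rfl⟩
    · simp only [mem_innerSet, mem_modify, if_true]
      constructor
      · rintro ⟨p, rfl | hp, hp2, rfl⟩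
        · exact .inl rfl
        · exact .inr ⟨p, hp, hp2, rfl⟩
      · rintro (rfl | ⟨p, hp, hp2, rfl⟩)
        · exact ⟨i, .inl rfl, h, rfl⟩
        · exact ⟨p, .inr hp, hp2, rfl⟩
  · simp only [mem_innerSet]
    constructor
    · rintro ⟨p, hp, hp2, rfl⟩
      rcases mem_of_mem_modify hp with rfl | hp
      · exact absurd hp2 h
      · exact ⟨p, hp, hp2, rfl⟩
    · rintro ⟨p, hp, hp2, rfl⟩
      have hne : p ≠ i := fun he => h (he ▸ hp2)
      refine ⟨p, ?_, hp2, rfl⟩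
      rw [mem_modify]
      cases op
      · exact ⟨hne, hp⟩
      · exact .inr hp

/-- Updating the item `i` in the tree `t` takes amortized time `g`. -/
def CanUpdate (R : ℕ → ℕ) (t : RTree) (i : Item) (w g : ℕ) : Prop :=
  ∀ op : Bool, Fn fUpdate (.pair (.pair (encBool op) (encItem i)) t.enc) fun v τ =>
    ∃ t' : RTree, v = t'.enc ∧ t'.Inv (w + 1) ∧ t'.items = modify op i t.items ∧
      t'.slots ≤ t.slots + 1 ∧ τ + t'.phi R ≤ t.phi R + g

/-- Lists of items from `p` can be built in time `F`. -/
def CanBuild (p : Item → Prop) (F : ℕ → ℕ) : Prop :=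
  ∀ l : List Item, l.Pairwise (· < ·) → (∀ i ∈ l, p i) →
    Fn fBuild (encList encItem l) fun v τ => ∃ t : RTree, v = t.enc ∧ Fresh l t ∧ τ ≤ F l.length

/-- The rate `R` pays for rebuilding in time `F`. -/
def Pays (R F : ℕ → ℕ) : Prop :=
  ∀ n s m, n ≤ s → s ≤ m + m / 4 + 1 → F n + 200 * (s + 1) ≤ (m / 4 + 1) * R m

section

variable {p : Item → Prop} {F R : ℕ → ℕ} {W G gX : ℕ}

/-- The inner tree of a node, after an update. -/
theorem update_inner_spec {op : Bool} {i : Item} {x : RTree} {s : Finset Item}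
    (hx : x.items = innerSet s) (hi : x.Inv (2 * x.items.card + 1)) (hW : s.card ≤ W)
    (hX : i.cls = 2 → ∀ x : RTree, x.Inv (2 * x.items.card + 1) → Inner x.items →
      x.items.card ≤ W → CanUpdate R x i.inn (2 * x.items.card + 1) gX) :
    (i.cls = 2 → Fn fUpdate (.pair (.pair (encBool op) (encItem i.inn)) x.enc) fun v τ =>
      ∃ x' : RTree, v = x'.enc ∧ x'.Inv (2 * x'.items.card + 1) ∧
        x'.items = innerSet (modify op i s) ∧ τ + x'.phi R ≤ x.phi R + gX) := by
  intro h2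
  refine (hX h2 x hi (by rw [hx]; exact inner_innerSet s)
    (by rw [hx]; exact (card_innerSet_le s).trans hW) op).mono ?_
  rintro _ τ ⟨x', rfl, h3, h4, -, h5⟩
  refine ⟨x', rfl, h3.tight, ?_, h5⟩
  rw [h4, hx, innerSet_modify, if_pos h2]

theorem build_append_spec {a b : RTree} {w w' : ℕ} (hF : CanBuild p F)
    (hab : ∀ i ∈ a.items, ∀ j ∈ b.items, i < j) (ha : a.Inv w) (hb : b.Inv w')
    (hp : ∀ i ∈ a.items ∪ b.items, p i) :
    Fn fFlatten (.pair b.enc .nil) fun u t1 => Fn fFlatten (.pair a.enc u) fun v t2 =>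
      Fn fBuild v fun z t3 => ∃ t : RTree, z = t.enc ∧ t.Inv (a.slots + b.slots) ∧
        t.items = a.items ∪ b.items ∧ t.slots ≤ a.slots + b.slots ∧ (∀ R, t.phi R = 0) ∧
        ∃ n, n ≤ a.slots + b.slots ∧ t1 + t2 + t3 + 120 ≤ F n + 120 * (a.slots + b.slots) := by
  refine (flatten_spec b []).mono ?_
  rintro _ t1 ⟨rfl, h1⟩
  refine (flatten_spec a _).mono ?_
  rintro _ t2 ⟨rfl, h2⟩
  rw [List.append_nil]
  have hmem : ∀ i, i ∈ a.toList ++ b.toList ↔ i ∈ a.items ∪ b.items := by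
    simp [mem_toList]
  refine (hF (a.toList ++ b.toList) ?_ fun i hi => hp i ((hmem i).1 hi)).mono ?_
  · exact List.pairwise_append.2 ⟨ha.sorted, hb.sorted, fun i hi j hj =>
      hab i (mem_toList.1 hi) j (mem_toList.1 hj)⟩
  rintro _ t3 ⟨t, rfl, ht, h3⟩
  have hlen : (a.toList ++ b.toList).length ≤ a.slots + b.slots := by
    have := length_toList_le a
    have := length_toList_le b
    simp; omega
  have hpos : 1 ≤ a.slots := by omega
  refine ⟨t, rfl, ht.inv.mono (by omega), ?_, by rw [ht.slots_eq]; omega, ht.phi_eq, _, hlen,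
    by omega⟩
  rw [ht.items_eq]
  ext i
  rw [List.mem_toFinset, hmem]

/-- Every update deposits `R m`, contained in `G`, at the node. If the countdown is positive, the
deposit accounts for the increment of `used`; otherwise all deposits are spent on the rebuilding. -/
theorem link_spec {cd used m w : ℕ} {r i : Item} {x a b a' b' : RTree} {op : Bool}
    (h : (node cd used m r x a b).Inv w) (hw : w ≤ W) (hF : CanBuild p F) (hR : Pays R F)
    (hp : ∀ j ∈ modify op i (a.items ∪ b.items), p j)
    (hX : i.cls = 2 → ∀ x : RTree, x.Inv (2 * x.items.card + 1) → Inner x.items →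
      x.items.card ≤ W → CanUpdate R x i.inn (2 * x.items.card + 1) gX)
    (hG : ∀ m ≤ W, R m + gX + 160000 * lg (2 * W + 3) + 10000 ≤ G)
    (ha : a'.Inv ((m + 1) / 2 + used + 1)) (hb : b'.Inv ((m + 1) / 2 + used + 1))
    (har : ∀ j ∈ a'.items, j < r) (hbr : ∀ j ∈ b'.items, r ≤ j)
    (hab : a'.items ∪ b'.items = modify op i (a.items ∪ b.items))
    (hs : a'.slots + b'.slots ≤ a.slots + b.slots + 1) :
    Fn fLink (.pair (.pair a'.enc b'.enc)
      (.pair (.pair (encBool op) (encItem i)) (node cd used m r x a b).enc)) fun v τ =>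
      ∃ t' : RTree, v = t'.enc ∧ t'.Inv (w + 1) ∧ t'.items = modify op i (a.items ∪ b.items) ∧
        t'.slots ≤ a'.slots + b'.slots ∧
        τ + t'.phi R ≤ x.phi R + a'.phi R + b'.phi R + used * R m + G := by
  have hlt : ∀ i ∈ a'.items, ∀ j ∈ b'.items, i < j := fun i hi j hj => (har i hi).trans_le (hbr j hj)
  obtain ⟨h1, h2, h3, h4, h5, -, -, h6, h7, -, -⟩ := h
  have hG := hG m (by omega)
  rw [fn_link]
  cases cd with
  | zero =>
    simp only [linkBody, run, enc_node, encNat]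
    refine (build_append_spec hF hlt ha hb (by rwa [hab])).mono fun u t1 h => h.mono fun v t2 h =>
      h.mono ?_
    rintro _ t3 ⟨t, rfl, i1, i2, i3, i4, n, h8, h9⟩
    refine ⟨t, rfl, i1.mono (by omega), by rw [i2, hab], i3, ?_⟩
    -- At countdown zero `used = m / 4`, so the stored deposits and the present one make up the `m /
    -- 4 + 1` of `Pays`. The leaves number at most `m + used + 1`.
    have h10 := hR n (a'.slots + b'.slots) m h8 (by omega)
    have h11 : used = m / 4 := by omega
    rw [add_mul, one_mul] at h10
    rw [i4, h11]
    omega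
  | succ cd =>
    have hcard := card_le_card_modify op i (a.items ∪ b.items)
    have hW : (a.items ∪ b.items).card ≤ W := by
      have e1 : a.items.card ≤ a.slots := by
        rw [← toFinset_toList]; exact (List.toFinset_card_le _).trans (length_toList_le a)
      have e2 : b.items.card ≤ b.slots := by
        rw [← toFinset_toList]; exact (List.toFinset_card_le _).trans (length_toList_le b)
      have e3 := Finset.card_union_le a.items b.items
      omega
    have key : ∀ (x' : RTree) (τ : ℕ), x'.items = innerSet (modify op i (a.items ∪ b.items)) →
        x'.Inv (2 * x'.items.card + 1) → τ + x'.phi R ≤ x.phi R + gX + 100 →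
        Fn fInfo b'.enc fun v t1 => Fn fCombine (.pair a'.enc v) fun z t2 =>
          ∃ t' : RTree, Val.pair (.pair (encNat cd) (encItem r))
            (.pair (.pair x'.enc z) (.pair a'.enc b'.enc)) = t'.enc ∧ t'.Inv (w + 1) ∧
            t'.items = modify op i (a.items ∪ b.items) ∧ t'.slots ≤ a'.slots + b'.slots ∧
            τ + t1 + t2 + 200 + t'.phi R ≤
              x.phi R + a'.phi R + b'.phi R + used * R m + G := by
      intro x' τ e1 e2 e3
      refine b'.info_spec.mono ?_
      rintro _ t1 ⟨rfl, h9⟩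
      refine (combine_spec hlt ((ha.mono (by omega : _ ≤ W + 1)).innerQuery _)).mono ?_
      rintro _ t2 ⟨rfl, h10⟩
      refine ⟨node cd (used + 1) m r x' a' b', rfl, ⟨by omega, by omega, h3, by omega, ?_, har, hbr,
        by rw [e1, hab], e2, ha.mono (by omega), hb.mono (by omega)⟩, hab, le_rfl, ?_⟩
      · rw [hab]; omega
      · simp only [phi]
        rw [add_mul, one_mul]
        have e8 : 2 * (W + 1) + 1 = 2 * W + 3 := by ring
        rw [e8] at h10
        omega
    simp only [linkBody, run, enc_node, encNat, encItem_snd]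
    have hu := update_inner_spec (op := op) h6 h7 hW hX
    have hkeep : i.cls ≠ 2 → x.items = innerSet (modify op i (a.items ∪ b.items)) := fun hne => by
      rw [innerSet_modify, if_neg hne, h6]
    obtain ⟨k, ⟨c, hc⟩, z⟩ := i
    by_cases hc2 : c = 2
    · subst hc2
      simp only [encNat, run]
      refine (hu rfl).mono ?_
      rintro _ t1 ⟨x', rfl, e1, e2, e3⟩
      refine (key x' t1 e2 e1 (by omega)).mono fun _ _ h => h.mono ?_
      rintro _ _ ⟨t', j1, j2, j3, j4, j5⟩
      exact ⟨t', j1, j2, j3, j4, by omega⟩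
    · have hkey := key x 0 (hkeep fun h => hc2 (congrArg Fin.val h)) h7 (by omega)
      -- The program recognizes class 2 by three nested tests; these are the three ways to fail
      -- them.
      have : c = 0 ∨ c = 1 ∨ ∃ c', c = c' + 3 := by
        rcases c with _ | _ | _ | c
        · simp
        · simp
        · simp at hc2
        · simp
      obtain rfl | rfl | ⟨c, rfl⟩ := this <;> simp only [encNat, run] <;>
      · refine hkey.mono fun _ _ h => h.mono ?_
        rintro _ _ ⟨t', j1, j2, j3, j4, j5⟩
        exact ⟨t', j1, j2, j3, j4, by omega⟩

/-- Each level of the search path costs `G` for `link_spec` and a comparison. The predicate `p`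
makes the argument applicable both to inner trees, where all items have class 5, and to outer trees.
-/
theorem update_spec {t : RTree} {w : ℕ} {i : Item} (h : t.Inv w) (hw : w ≤ W)
    (hF : CanBuild p F) (hR : Pays R F) (hpi : p i) (hp : ∀ j ∈ t.items, p j)
    (hX : i.cls = 2 → ∀ x : RTree, x.Inv (2 * x.items.card + 1) → Inner x.items →
      x.items.card ≤ W → CanUpdate R x i.inn (2 * x.items.card + 1) gX)
    (hG : ∀ m ≤ W, R m + gX + 160000 * lg (2 * W + 3) + 10000 ≤ G) (hF2 : F 2 + 10000 ≤ G) :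
    CanUpdate R t i w ((t.depth + 1) * (G + 5000)) := by
  intro op
  induction t generalizing w with
  | nil =>
    rw [fn_update]
    cases op <;> simp only [updateBody, run, enc_nil, encBool_true, encBool_false]
    · exact ⟨nil, rfl, Nat.le_add_left _ _, by simp [items, modify], by simp [slots],
        by simp [phi, depth]⟩
    · exact ⟨leaf i, rfl, Nat.le_add_left _ _, by simp [items, modify], by simp [slots],
        by simp [phi, depth]⟩
  | leaf j =>
    have hpj : p j := hp j (by simp [items])
    have h1 : 1 ≤ w := h
    have pair : ∀ j₁ j₂ : Item, j₁ < j₂ → p j₁ → p j₂ → ∀ s, s = ({j₁, j₂} : Finset Item) →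
        Fn fBuild (.pair (encItem j₁) (.pair (encItem j₂) .nil)) fun v τ =>
          ∃ t' : RTree, v = t'.enc ∧ t'.Inv (w + 1) ∧ t'.items = s ∧ t'.slots ≤ 2 ∧
            τ + 10000 + t'.phi R ≤ G := by
      intro j₁ j₂ hlt hp₁ hp₂ s hs
      refine (hF [j₁, j₂] (by simpa using hlt) (by simp [hp₁, hp₂])).mono ?_
      rintro _ τ ⟨t', rfl, ht, hτ⟩
      refine ⟨t', rfl, ht.inv.mono (by simp; omega), ?_, by rw [ht.slots_eq]; simp, ?_⟩
      · rw [ht.items_eq, hs]; simp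
      · rw [ht.phi_eq]
        simp only [List.length_cons, List.length_nil, zero_add] at hτ
        have : 1 + 1 = 2 := rfl
        rw [this] at hτ
        omega
    rw [fn_update]
    simp only [updateBody, run, enc_leaf]
    refine (ltItem_spec _ _).mono ?_
    rintro _ t1 ⟨rfl, h2⟩
    simp only [decide_cases, run]
    have hphi : ∀ j, (leaf j).phi R = 0 := fun j => rfl
    have hdep : ((leaf j).depth + 1) * (G + 5000) = G + 5000 := by simp [depth]
    refine ⟨fun hij => ?_, fun hij => ?_⟩
    · cases op <;> simp only [encBool_true, encBool_false, run]
      · refine ⟨leaf j, rfl, Nat.le_add_left _ _, ?_, Nat.le_succ _, by omega⟩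
        simp [items, modify, hij.ne]
      · refine (pair i j hij hpi hpj _ rfl).mono ?_
        rintro _ τ ⟨t', e1, e2, e3, e4, e5⟩
        exact ⟨t', e1, e2, by rw [e3]; rfl, e4, by rw [hphi, hdep]; omega⟩
    · refine (ltItem_spec _ _).mono ?_
      rintro _ t2 ⟨rfl, h3⟩
      simp only [decide_cases, run]
      refine ⟨fun hji => ?_, fun hji => ?_⟩
      · cases op <;> simp only [encBool_true, encBool_false, run]
        · refine ⟨leaf j, rfl, Nat.le_add_left _ _, ?_, Nat.le_succ _, by rw [hdep]; omega⟩
          simp [items, modify, hji.ne']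
        · refine (pair j i hji hpj hpi _ rfl).mono ?_
          rintro _ τ ⟨t', e1, e2, e3, e4, e5⟩
          exact ⟨t', e1, e2, by rw [e3]; exact Finset.pair_comm _ _, e4,
            by rw [hphi, hdep]; omega⟩
      · have hij' : i = j := le_antisymm (not_lt.1 hji) (not_lt.1 hij)
        subst hij'
        cases op <;> simp only [encBool_true, encBool_false, run]
        · exact ⟨nil, rfl, Nat.le_add_left _ _, by simp [items, modify], Nat.le_succ _,
            by rw [hdep]; simp [phi]; omega⟩
        · exact ⟨leaf i, rfl, Nat.le_add_left _ _, by simp [items, modify], Nat.le_succ _,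
            by rw [hdep]; omega⟩
  | node cd used m r x a b _ iha ihb =>
    have hpm : ∀ j ∈ modify op i (a.items ∪ b.items), p j := fun j hj => by
      rcases mem_of_mem_modify hj with rfl | hj
      · exact hpi
      · exact hp j hj
    have h' := h
    obtain ⟨h1, h2, h3, -, -, har, hbr, -, -, ha, hb⟩ := h'
    have hda : (a.depth + 1) * (G + 5000) + (G + 5000) ≤
        ((node cd used m r x a b).depth + 1) * (G + 5000) := by
      rw [← Nat.succ_mul]
      refine Nat.mul_le_mul_right _ ?_
      have := le_max_left a.depth b.depth
      simp only [depth]; omega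
    have hdb : (b.depth + 1) * (G + 5000) + (G + 5000) ≤
        ((node cd used m r x a b).depth + 1) * (G + 5000) := by
      rw [← Nat.succ_mul]
      refine Nat.mul_le_mul_right _ ?_
      have := le_max_right a.depth b.depth
      simp only [depth]; omega
    rw [fn_update]
    simp only [updateBody, run, enc_node]
    refine (ltItem_spec _ _).mono ?_
    rintro _ t1 ⟨rfl, h4⟩
    simp only [decide_cases, run]
    refine ⟨fun hir => ?_, fun hir => ?_⟩
    · refine (iha ha (by omega) fun j hj => hp j (Finset.mem_union_left _ hj)).mono ?_
      rintro _ t2 ⟨a', rfl, ha', hia, hsa, hta⟩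
      refine (link_spec h hw hF hR hpm hX hG ha' (hb.mono (by omega)) ?_ hbr ?_ (by omega)).mono ?_
      · intro j hj
        rw [hia] at hj
        rcases mem_of_mem_modify hj with rfl | hj
        · exact hir
        · exact har j hj
      · rw [hia, modify_union_left fun hi => (hbr i hi).not_gt hir]
      · rintro _ t3 ⟨t', e1, e2, e3, e4, e5⟩
        refine ⟨t', e1, e2, e3, e4.trans (by simp only [slots]; omega), ?_⟩
        simp only [phi]
        omega
    · refine (ihb hb (by omega) fun j hj => hp j (Finset.mem_union_right _ hj)).mono ?_
      rintro _ t2 ⟨b', rfl, hb', hib, hsb, htb⟩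
      refine (link_spec h hw hF hR hpm hX hG (ha.mono (by omega)) hb' har ?_ ?_ (by omega)).mono ?_
      · intro j hj
        rw [hib] at hj
        rcases mem_of_mem_modify hj with rfl | hj
        · exact not_lt.1 hir
        · exact hbr j hj
      · rw [hib, modify_union_right fun hi => hir (har i hi)]
      · rintro _ t3 ⟨t', e1, e2, e3, e4, e5⟩
        refine ⟨t', e1, e2, e3, e4.trans (by simp only [slots]; omega), ?_⟩
        simp only [phi]
        omega

end

end RTree

namespace RTree

/-! ### Polylogarithmic bounds -/

theorem lg_le_of_le {m n : ℕ} (h : m + 2 ≤ 4 * (n + 2)) : lg m ≤ 3 * lg n := by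
  have h1 := one_le_lg n
  have h2 : lg m ≤ lg n + 2 := by
    unfold lg
    refine Nat.le_of_lt_succ (Nat.log_lt_of_lt_pow (by omega) ?_)
    have := Nat.lt_pow_succ_log_self (b := 2) (by norm_num) (n + 2)
    rw [Nat.succ_eq_add_one] at this ⊢
    rw [pow_succ] at this
    rw [pow_succ, pow_succ, pow_succ]
    omega
  omega

theorem le_mul_lg_pow (c n e : ℕ) : c ≤ c * lg n ^ e :=
  Nat.le_mul_of_pos_right _ (Nat.pow_pos (one_le_lg n))

theorem lg_pow_le {e f : ℕ} (h : e ≤ f) (n : ℕ) : lg n ^ e ≤ lg n ^ f :=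
  Nat.pow_le_pow_right (one_le_lg n) h

theorem CanUpdate.mono {R : ℕ → ℕ} {t : RTree} {i : Item} {w g g' : ℕ} (h : CanUpdate R t i w g)
    (hg : g ≤ g') : CanUpdate R t i w g' := fun op => (h op).mono <| by
  rintro _ τ ⟨t', h1, h2, h3, h4, h5⟩
  exact ⟨t', h1, h2, h3, h4, by omega⟩

theorem CanBuild.mono {p : Item → Prop} {F F' : ℕ → ℕ} (h : CanBuild p F) (hF : ∀ n, F n ≤ F' n) :
    CanBuild p F' := fun l hl hp => (h l hl hp).mono <| by
  rintro _ τ ⟨t, h1, h2, h3⟩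
  exact ⟨t, h1, h2, h3.trans (hF _)⟩

/-- The factor 5 comes from `s + 1 ≤ 5 * (m / 4 + 1)`, the factor `3 ^ e` from `lg s ≤ 3 * lg m`,
and the summand 200 pays for flattening. -/
theorem pays (A e : ℕ) : Pays (fun m => 5 * 3 ^ e * (A + 200) * lg m ^ e)
    (fun n => A * (lg n ^ e * (n + 1))) := by
  intro n s m hn hs
  have h1 : lg n ^ e * (n + 1) ≤ lg s ^ e * (s + 1) :=
    Nat.mul_le_mul (Nat.pow_le_pow_left (lg_mono hn) e) (by omega)
  have h2 : s + 1 ≤ lg s ^ e * (s + 1) :=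
    Nat.le_mul_of_pos_left _ (Nat.pow_pos (one_le_lg s))
  have h3 : lg s ^ e ≤ (3 * lg m) ^ e := Nat.pow_le_pow_left (lg_le_of_le (by omega)) e
  calc A * (lg n ^ e * (n + 1)) + 200 * (s + 1)
      ≤ A * (lg s ^ e * (s + 1)) + 200 * (lg s ^ e * (s + 1)) := by gcongr
    _ = (A + 200) * (lg s ^ e * (s + 1)) := by ring
    _ ≤ (A + 200) * ((3 * lg m) ^ e * (5 * (m / 4 + 1))) := by gcongr; omega
    _ = (m / 4 + 1) * (5 * 3 ^ e * (A + 200) * lg m ^ e) := by rw [mul_pow]; ring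

theorem exists_canUpdate {p : Item → Prop} {F : ℕ → ℕ} {B e : ℕ} (hF : CanBuild p F)
    (hR : Pays (fun m => B * lg m ^ e) F) (D f : ℕ) (hf : e ≤ f) (hf' : 1 ≤ f) :
    ∃ C, ∀ (W : ℕ) (t : RTree) (i : Item), t.Inv (2 * t.items.card + 1) → t.items.card ≤ W → p i →
      (∀ j ∈ t.items, p j) →
      (i.cls = 2 → ∀ x : RTree, x.Inv (2 * x.items.card + 1) → Inner x.items →
        x.items.card ≤ 2 * W + 1 → CanUpdate (fun m => B * lg m ^ e) x i.inn
          (2 * x.items.card + 1) (D * lg (2 * W + 1) ^ f)) →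
      CanUpdate (fun m => B * lg m ^ e) t i (2 * t.items.card + 1) (C * lg W ^ (f + 1)) := by
  -- The weight is at most `2 * W + 1`, so the search path has at most `10 * lg W` levels, which
  -- accounts for the extra exponent. 505000 is `3 * 160000 + 20000 + 5000`.
  refine ⟨10 * ((B + D) * 3 ^ f + 505000 + F 2), fun W t i ht hW hi hp hX => ?_⟩
  have hw : 2 * t.items.card + 1 ≤ 2 * W + 1 := by omega
  have h1 : lg (2 * W + 1) ≤ 3 * lg W := lg_le_of_le (by omega)
  have h2 : lg (2 * (2 * W + 1) + 3) ≤ 3 * lg W := lg_le_of_le (by omega)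
  have h3 := one_le_lg W
  have h4 := one_le_lg (2 * W + 1)
  refine (update_spec (G := B * lg (2 * W + 1) ^ f + D * lg (2 * W + 1) ^ f +
    160000 * lg (2 * (2 * W + 1) + 3) + 20000 + F 2) ht hw hF hR hi hp hX ?_ (by omega)).mono ?_
  · intro m hm
    have : B * lg m ^ e ≤ B * lg (2 * W + 1) ^ f :=
      Nat.mul_le_mul_left _ ((Nat.pow_le_pow_left (lg_mono hm) e).trans (lg_pow_le hf _))
    omega
  · have h5 : t.depth + 1 ≤ 10 * lg W := by
      have := ht.depth_le
      have := lg_mono hw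
      omega
    have h6 : lg (2 * W + 1) ^ f ≤ 3 ^ f * lg W ^ f := by
      rw [← mul_pow]; exact Nat.pow_le_pow_left h1 f
    have h7 : lg W ≤ lg W ^ f := Nat.le_self_pow (by omega) _
    calc (t.depth + 1) * (B * lg (2 * W + 1) ^ f + D * lg (2 * W + 1) ^ f +
          160000 * lg (2 * (2 * W + 1) + 3) + 20000 + F 2 + 5000)
        ≤ (10 * lg W) * (B * (3 ^ f * lg W ^ f) + D * (3 ^ f * lg W ^ f) +
          160000 * (3 * lg W ^ f) + 20000 * lg W ^ f + F 2 * lg W ^ f + 5000 * lg W ^ f) := by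
          gcongr
          · omega
          · exact le_mul_lg_pow _ _ _
          · exact le_mul_lg_pow _ _ _
          · exact le_mul_lg_pow _ _ _
      _ = 10 * ((B + D) * 3 ^ f + 505000 + F 2) * lg W ^ (f + 1) := by ring

/-- `build_step` is applied with `lg n + 1` levels, so one logarithm is added to the cost of the
inner trees. -/
theorem exists_canBuild {p : Item → Prop} {E e : ℕ} (he : 1 ≤ e)
    (hE : ∀ l : List Item, l.Pairwise (· < ·) → (∀ i ∈ l, p i) → ∀ n, l.length ≤ n →
      InnerBuild l (E * lg n ^ e)) :
    ∃ A, CanBuild p (fun n => A * (lg n ^ (e + 1) * (n + 1))) := by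
  refine ⟨3 * (2 * E + 490000), fun l hl hp => ?_⟩
  have hk : l.length ≤ 2 ^ (lg l.length + 1) := by
    have : l.length + 2 < 2 ^ (lg l.length + 1) := Nat.lt_pow_succ_log_self (by norm_num) _
    omega
  refine (build_step hl le_rfl (fun l' hl' hs hn => hE l' hs (fun i hi => hp i (hl' hi)) _ hn)
    hk).mono ?_
  rintro _ τ ⟨t, rfl, ht, hτ⟩
  refine ⟨t, rfl, ht, hτ.trans ?_⟩
  generalize l.length = n
  have h1 : lg (2 * n + 3) ≤ 3 * lg n := lg_le_of_le (by omega)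
  have h2 := one_le_lg n
  have h7 : lg n ≤ lg n ^ e := Nat.le_self_pow (by omega) _
  calc (2 * (E * lg n ^ e) + 160000 * lg (2 * n + 3) + 10000) * (n * (lg n + 1 + 1) + 1)
      ≤ (2 * (E * lg n ^ e) + 160000 * (3 * lg n ^ e) + 10000 * lg n ^ e) * (3 * lg n * (n + 1)) := by
        gcongr
        · omega
        · exact le_mul_lg_pow _ _ _
        · nlinarith
    _ = 3 * (2 * E + 490000) * (lg n ^ (e + 1) * (n + 1)) := by ring

theorem insertInner_of_inner (l : List Item) (h : ∀ i ∈ l, i.cls = 5) (x : RTree) :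
    Fn fInsertInner (.pair (encList encItem l) x.enc) fun v τ => v = x.enc ∧
      τ ≤ 100 * (l.length + 1) := by
  induction l with
  | nil =>
    rw [fn_insertInner]
    simp only [insertInnerBody, run, encList_nil]
    exact ⟨trivial, by simp⟩
  | cons i l ih =>
    rw [fn_insertInner]
    simp only [insertInnerBody, run, encList_cons, encItem_cases, encItem_snd, h i (by simp)]
    have : encNat ((5 : Fin 7) : ℕ) =
      .pair .nil (.pair .nil (.pair .nil (.pair .nil (.pair .nil .nil)))) := rfl
    simp only [this, run]
    refine (ih fun j hj => h j (by simp [hj])).mono ?_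
    rintro _ τ ⟨rfl, hτ⟩
    exact ⟨rfl, by simp; omega⟩

theorem build_nil : Fn fBuild .nil fun v τ => v = .nil ∧ τ ≤ 10 := by
  rw [fn_build]
  simp only [buildBody, run]
  exact ⟨trivial, by omega⟩

theorem innerBuild_of_inner (l : List Item) (h : ∀ i ∈ l, i.cls = 5) : InnerBuild l 1000 := by
  refine (insertInner_of_inner l h nil).mono ?_
  rintro _ t1 ⟨rfl, h1⟩
  refine (flatten_spec nil []).mono ?_
  rintro _ t2 ⟨rfl, h2⟩
  refine build_nil.mono ?_
  rintro _ t3 ⟨rfl, h3⟩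
  refine ⟨nil, rfl, ?_, by simp [Inv], fun R => rfl, ?_⟩
  · symm
    rw [items, Finset.eq_empty_iff_forall_notMem]
    intro i hi
    obtain ⟨p, hp, hp2, -⟩ := mem_innerSet.1 hi
    rw [List.mem_toFinset] at hp
    have := (h p hp).symm.trans hp2
    exact absurd this (by decide)
  · simp only [slots] at h2
    omega

/-- Construction of trees without inner trees. -/
theorem exists_canBuild_inner :
    ∃ A, CanBuild (fun i => i.cls = 5) (fun n => A * (lg n ^ 2 * (n + 1))) :=
  exists_canBuild (E := 1000) (e := 1) le_rfl fun l _ hl n _ =>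
    (innerBuild_of_inner l hl).mono fun _ _ h => h.mono fun _ _ h => h.mono <| by
      rintro _ τ ⟨x, h1, h2, h3, h4, h5⟩
      exact ⟨x, h1, h2, h3, h4, h5.trans (Nat.mul_le_mul_right _ (le_mul_lg_pow _ _ _))⟩

/-- Updates of trees without inner trees. -/
theorem exists_canUpdate_inner {F : ℕ → ℕ} {B e : ℕ} (hF : CanBuild (fun i => i.cls = 5) F)
    (hR : Pays (fun m => B * lg m ^ e) F) (he : 1 ≤ e) :
    ∃ C, ∀ (W : ℕ) (t : RTree) (i : Item), t.Inv (2 * t.items.card + 1) → t.items.card ≤ W →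
      i.cls = 5 → Inner t.items →
      CanUpdate (fun m => B * lg m ^ e) t i (2 * t.items.card + 1) (C * lg W ^ (e + 1)) := by
  obtain ⟨C, hC⟩ := exists_canUpdate hF hR 0 e le_rfl he
  refine ⟨C, fun W t i ht hW hi hp => hC W t i ht hW hi hp fun h => ?_⟩
  rw [hi] at h
  exact absurd h (by decide)

theorem insertInner_spec {R : ℕ → ℕ} {g N : ℕ}
    (hu : ∀ (t : RTree) (i : Item), t.Inv (2 * t.items.card + 1) → t.items.card ≤ N →
      i.cls = 5 → Inner t.items → CanUpdate R t i (2 * t.items.card + 1) g)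
    (l : List Item) (x : RTree) (hx : x.Inv (2 * x.items.card + 1)) (hi : Inner x.items)
    (hN : x.items.card + l.length ≤ N) :
    Fn fInsertInner (.pair (encList encItem l) x.enc) fun v τ => ∃ x' : RTree, v = x'.enc ∧
      x'.Inv (2 * x'.items.card + 1) ∧ x'.items = x.items ∪ innerSet l.toFinset ∧
      x'.slots ≤ x.slots + l.length ∧ τ + x'.phi R ≤ x.phi R + (g + 100) * (l.length + 1) := by
  induction l generalizing x with
  | nil =>
    rw [fn_insertInner]
    simp only [insertInnerBody, run, encList_nil]
    exact ⟨x, rfl, hx, by simp [innerSet], by simp, by simp; omega⟩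
  | cons i l ih =>
    rw [fn_insertInner]
    simp only [insertInnerBody, run, encList_cons, encItem_cases, encItem_snd]
    simp only [List.length_cons] at hN ⊢
    have hmul : (g + 100) * (l.length + 1 + 1) = (g + 100) * (l.length + 1) + (g + 100) := by ring
    have hset : innerSet (i :: l).toFinset = innerSet {i} ∪ innerSet l.toFinset := by
      rw [List.toFinset_cons, ← Finset.singleton_union, innerSet_union]
    by_cases hc : i.cls = 2
    · have : encNat (i.cls : ℕ) = .pair .nil (.pair .nil .nil) := by rw [hc]; rfl
      simp only [this, run]
      refine (hu x i.inn hx (by omega) rfl hi true).mono ?_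
      rintro _ t1 ⟨x1, rfl, h1, h2, h3, h4⟩
      have hcard : x1.items.card ≤ x.items.card + 1 := by
        rw [h2]; exact Finset.card_insert_le _ _
      refine (ih x1 h1.tight ?_ (by omega)).mono ?_
      · intro j hj
        rw [h2] at hj
        rcases mem_of_mem_modify hj with rfl | hj
        · rfl
        · exact hi j hj
      · rintro _ t2 ⟨x2, rfl, e1, e2, e3, e4⟩
        refine ⟨x2, rfl, e1, ?_, by omega, by omega⟩
        rw [e2, h2, hset]
        have : innerSet {i} = {i.inn} := by simp [innerSet, Finset.filter_singleton, hc]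
        rw [this, modify, if_pos rfl, Finset.insert_eq, Finset.union_comm {i.inn},
          Finset.union_assoc]
    · have hset' : innerSet {i} = ∅ := by simp [innerSet, Finset.filter_singleton, hc]
      rw [hset, hset', Finset.empty_union]
      have hih := ih x hx hi (by omega)
      obtain ⟨k, ⟨c, hc'⟩, z⟩ := i
      have : c = 0 ∨ c = 1 ∨ ∃ c', c = c' + 3 := by
        rcases c with _ | _ | _ | c
        · simp
        · simp
        · simp at hc
        · simp
      obtain rfl | rfl | ⟨c, rfl⟩ := this <;> simp only [encNat, run] <;>
      · refine hih.mono ?_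
        rintro _ t2 ⟨x2, rfl, e1, e2, e3, e4⟩
        exact ⟨x2, rfl, e1, e2, by omega, by omega⟩

/-- Insertions start from the empty tree, of potential zero, so their actual total time is at most
the sum of the amortized times. -/
theorem exists_innerBuild : ∃ E, ∀ l : List Item, l.Pairwise (· < ·) → ∀ n, l.length ≤ n →
    InnerBuild l (E * lg n ^ 3) := by
  obtain ⟨A, hA⟩ := exists_canBuild_inner
  obtain ⟨C, hC⟩ := exists_canUpdate_inner hA (pays A 2) (by norm_num)
  refine ⟨C + A + 1000, fun l hl n hn => ?_⟩
  refine (insertInner_spec (N := n) (fun t i ht hW hi hp => hC n t i ht hW hi hp) l nil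
    (by simp [Inv]) (by simp [items, Inner]) (by simpa [items] using hn)).mono ?_
  rintro _ t1 ⟨x, rfl, h1, h2, h3, h4⟩
  refine (flatten_spec x []).mono ?_
  rintro _ t2 ⟨rfl, h5⟩
  have h2' : x.items = innerSet l.toFinset := by rw [h2]; simp [items]
  rw [List.append_nil]
  refine (hA x.toList h1.sorted fun i hi => ?_).mono ?_
  · rw [mem_toList, h2'] at hi
    exact inner_innerSet _ i hi
  rintro _ t3 ⟨y, rfl, h6, h7⟩
  have h8 : y.items = innerSet l.toFinset := by rw [h6.items_eq, toFinset_toList, h2']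
  refine ⟨y, rfl, h8, h6.inv.tight, h6.phi_eq, ?_⟩
  have h9 : x.toList.length ≤ l.length := by
    have : x.items.card = x.toList.length := by
      rw [← toFinset_toList, card_toFinset_of_sorted h1.sorted]
    rw [← this, h2']
    refine (card_innerSet_le _).trans (List.toFinset_card_le _)
  have h10 : t3 ≤ A * (lg n ^ 3 * (l.length + 1)) := h7.trans <| by
    have := (Nat.pow_le_pow_left (lg_mono (h9.trans hn)) 2).trans (lg_pow_le (by norm_num : 2 ≤ 3) n)
    exact Nat.mul_le_mul_left _ (Nat.mul_le_mul this (by omega))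
  simp only [slots, phi, Nat.reduceAdd] at h3 h4
  have h11 : 1000 ≤ 1000 * lg n ^ 3 := le_mul_lg_pow _ _ _
  have h12 : t1 ≤ (C * lg n ^ 3 + 100) * (l.length + 1) := by omega
  calc t1 + t2 + t3 ≤ (C * lg n ^ 3 + 100) * (l.length + 1) + 120 * (l.length + 1) +
        A * (lg n ^ 3 * (l.length + 1)) := by omega
    _ = (C * lg n ^ 3 + 220 + A * lg n ^ 3) * (l.length + 1) := by ring
    _ ≤ (C * lg n ^ 3 + 1000 * lg n ^ 3 + A * lg n ^ 3) * (l.length + 1) := by gcongr; omega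
    _ = (C + A + 1000) * lg n ^ 3 * (l.length + 1) := by ring

/-- Trees can be constructed and updated efficiently. -/
theorem exists_bounds : ∃ (A C : ℕ) (R : ℕ → ℕ),
    CanBuild (fun _ => True) (fun n => A * (lg n ^ 4 * (n + 1))) ∧
    ∀ (W : ℕ) (t : RTree) (i : Item), t.Inv (2 * t.items.card + 1) → t.items.card ≤ W →
      CanUpdate R t i (2 * t.items.card + 1) (C * lg W ^ 6) := by
  obtain ⟨E, hE⟩ := exists_innerBuild
  obtain ⟨A₁, hA₁⟩ := exists_canBuild (p := fun _ => True) (by norm_num : 1 ≤ 3)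
    fun l hl _ n hn => hE l hl n hn
  obtain ⟨A₀, hA₀⟩ := exists_canBuild_inner
  -- The potential uses one rate `R` for inner and outer trees, so both construction times are
  -- raised to a common bound.
  have hB₀ := hA₀.mono (F' := fun n => (A₀ + A₁) * (lg n ^ 4 * (n + 1))) fun n => by
    have := lg_pow_le (by norm_num : 2 ≤ 4) n
    gcongr
    omega
  have hB₁ := hA₁.mono (F' := fun n => (A₀ + A₁) * (lg n ^ 4 * (n + 1))) fun n => by
    gcongr
    omega
  obtain ⟨C₀, hC₀⟩ := exists_canUpdate_inner hB₀ (pays _ 4) (by norm_num)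
  obtain ⟨C₁, hC₁⟩ := exists_canUpdate hB₁ (pays _ 4) C₀ 5 (by norm_num) (by norm_num)
  refine ⟨A₁, C₁, _, hA₁, fun W t i ht hW => hC₁ W t i ht hW trivial (fun _ _ => trivial) ?_⟩
  exact fun _ x hx hxi hxW => hC₀ _ x _ hx hxW rfl hxi

end RTree

/-! ## The greedy algorithm -/

theorem exists_minSwap_eq_iff {c : Fin 7} {s : Finset Item} {x : Key} :
    (∃ a : Item, minSwap c s = a ∧ a.key ≤ x) ↔ ∃ i ∈ s, i.cls = c ∧ i.snd ≤ x := by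
  constructor
  · rintro ⟨a, ha, hx⟩
    obtain ⟨i, hi, hc, rfl⟩ := exists_of_minSwap_eq ha
    exact ⟨i, hi, hc, hx⟩
  · rintro ⟨i, hi, hc, hx⟩
    have h := minSwap_le hi hc
    obtain ⟨a, ha, hai⟩ := WithTop.le_coe_iff.1 h
    exact ⟨a, ha, (Item.key_le_of_le hai).trans hx⟩

/-- A southeast and a southwest quadrant in `s` that meet, or touch, horizontally. -/
def Meets (s : Finset Item) : Prop :=
  ∃ i ∈ s, ∃ j ∈ s, i.cls = 3 ∧ j.cls = 4 ∧ i.snd ≤ j.snd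

/-- If any pair meets, so do the southeast quadrant extending farthest left and the southwest
quadrant extending farthest right, and these two are in the summary. -/
theorem meets_iff {s : Finset Item} : Meets s ↔
    ∃ a c : Item, minSwap 3 s = a ∧ maxSwap 4 s = c ∧ a.key ≤ c.key := by
  constructor
  · rintro ⟨i, hi, j, hj, h3, h4, h⟩
    obtain ⟨a, ha, hai⟩ := WithTop.le_coe_iff.1 (minSwap_le hi h3)
    obtain ⟨c, hc, hjc⟩ := WithBot.coe_le_iff.1 (le_maxSwap hj h4)
    exact ⟨a, c, ha, hc, (Item.key_le_of_le hai).trans (h.trans (Item.key_le_of_le hjc))⟩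
  · rintro ⟨a, c, ha, hc, h⟩
    obtain ⟨i, hi, h3, rfl⟩ := exists_of_minSwap_eq ha
    obtain ⟨j, hj, h4, rfl⟩ := exists_of_maxSwap_eq hc
    exact ⟨i, hi, j, hj, h3, h4, h⟩

open Classical in
theorem overlap_spec (s : Finset Item) :
    Fn fOverlap (.pair (encMin (minSwap 3 s)) (encMax (maxSwap 4 s))) fun v τ =>
      v = encBool (decide (Meets s)) ∧ τ ≤ 50 := by
  rw [fn_overlap]
  simp only [overlapBody, run]
  have h := meets_iff (s := s)
  cases ha : minSwap 3 s using WithTop.recTopCoe with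
  | top =>
    have : ¬ Meets s := by rw [h]; rintro ⟨a, c, ha', -⟩; rw [ha] at ha'; cases ha'
    simp only [encMin_top, run, this, decide_false, encBool_false]
    exact ⟨trivial, by omega⟩
  | coe a =>
    cases hc : maxSwap 4 s using WithBot.recBotCoe with
    | bot =>
      have : ¬ Meets s := by rw [h]; rintro ⟨a, c, -, hc', -⟩; rw [hc] at hc'; cases hc'
      simp only [encMin_coe, encMax_bot, run, this, decide_false, encBool_false, encItem_cases]
      exact ⟨trivial, by omega⟩
    | coe c =>
      have : Meets s ↔ a.key ≤ c.key := by
        rw [h]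
        constructor
        · rintro ⟨a', c', ha', hc', h⟩
          rw [ha] at ha'
          rw [hc] at hc'
          cases ha'
          cases hc'
          exact h
        · exact fun h => ⟨a, c, ha, hc, h⟩
      simp only [encMin_coe, encMax_coe, run, encItem_cases, encItem_fst]
      refine (leKey_spec _ _).mono ?_
      rintro _ t1 ⟨rfl, h1⟩
      refine ⟨?_, by omega⟩
      simp only [this]

open Classical in
theorem reach_spec (x : Key) (c : Fin 7) (s : Finset Item) :
    Fn fReach (.pair (encKey x) (encMin (minSwap c s))) fun v τ =>
      v = encBool (decide (∃ i ∈ s, i.cls = c ∧ i.snd ≤ x)) ∧ τ ≤ 40 := by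
  rw [fn_reach]
  simp only [reachBody, run]
  simp only [← exists_minSwap_eq_iff]
  cases ha : minSwap c s using WithTop.recTopCoe with
  | top =>
    simp only [encMin_top, run]
    exact ⟨by simp, by omega⟩
  | coe a =>
    simp only [encMin_coe, run, encItem_cases, encItem_fst]
    refine (leKey_spec _ _).mono ?_
    rintro _ t1 ⟨rfl, h1⟩
    refine ⟨?_, by omega⟩
    congr 1
    simp [WithTop.coe_eq_coe]

/-- `j` is the highest southeast quadrant of `s` that extends at least to `x`. -/
structure IsHighest (s : Finset Item) (x : Key) (j : Item) : Prop where
  mem : j ∈ s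
  cls : j.cls = 3
  snd_le : j.snd ≤ x
  le : ∀ i ∈ s, i.cls = 3 → i.snd ≤ x → i ≤ j

/-- `i` is the highest position in `s` such that a southeast quadrant `a` and a southwest
quadrant `c` from there on meet. -/
structure IsCross (s : Finset Item) (i a c : Item) : Prop where
  mem_a : a ∈ s
  mem_c : c ∈ s
  cls_a : a.cls = 3
  cls_c : c.cls = 4
  le : a.snd ≤ c.snd
  le_a : i ≤ a
  le_c : i ≤ c
  lt : ∀ a' ∈ s, ∀ c' ∈ s, a'.cls = 3 → c'.cls = 4 → i < a' → i < c' → c'.snd < a'.snd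

namespace RTree

/-- The search goes right whenever the right child contains a southeast quadrant that reaches `x`,
which its summary decides. -/
theorem highest_spec {t : RTree} {w : ℕ} (h : t.Inv w) (x : Key)
    (hx : ∃ i ∈ t.items, i.cls = 3 ∧ i.snd ≤ x) :
    Fn fHighest (.pair (encKey x) t.enc) fun v τ =>
      ∃ j, v = encItem j ∧ IsHighest t.items x j ∧ τ ≤ 300 * (t.depth + 1) := by
  induction t generalizing w with
  | nil => obtain ⟨i, hi, -⟩ := hx; simp [items] at hi
  | leaf j =>
    rw [fn_highest]
    simp only [highestBody, run, enc_leaf]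
    obtain ⟨i, hi, h3, hx⟩ := hx
    simp only [items, Finset.mem_singleton] at hi
    subst hi
    refine ⟨i, rfl, ⟨by simp [items], h3, hx, fun k hk _ _ => ?_⟩, by omega⟩
    simp only [items, Finset.mem_singleton] at hk
    exact hk.le
  | node cd used m r y a b _ iha ihb =>
    rw [fn_highest]
    simp only [highestBody, run, enc_node]
    refine b.info_spec.mono ?_
    rintro _ t1 ⟨rfl, h1⟩
    simp only [encSummary, run]
    refine (reach_spec _ _ _).mono ?_
    rintro _ t2 ⟨rfl, h2⟩
    simp only [decide_cases]
    constructor <;> intro hr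
    · refine (ihb h.right hr).mono ?_
      rintro _ t3 ⟨j, rfl, ⟨h3, h4, h5, h6⟩, h7⟩
      refine ⟨j, rfl, ⟨Finset.mem_union_right _ h3, h4, h5, fun i hi hi3 hix => ?_⟩, ?_⟩
      · rcases Finset.mem_union.1 hi with hi | hi
        · exact (h.lt i hi j h3).le
        · exact h6 i hi hi3 hix
      · simp only [depth]; omega
    · have : ∃ i ∈ a.items, i.cls = 3 ∧ i.snd ≤ x := by
        obtain ⟨i, hi, hi'⟩ := hx
        rcases Finset.mem_union.1 hi with hi | hi
        · exact ⟨i, hi, hi'⟩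
        · exact absurd ⟨i, hi, hi'⟩ hr
      refine (iha h.left this).mono ?_
      rintro _ t3 ⟨j, rfl, ⟨h3, h4, h5, h6⟩, h7⟩
      refine ⟨j, rfl, ⟨Finset.mem_union_left _ h3, h4, h5, fun i hi hi3 hix => ?_⟩, ?_⟩
      · rcases Finset.mem_union.1 hi with hi | hi
        · exact h6 i hi hi3 hix
        · exact absurd ⟨i, hi, hi3, hix⟩ hr
      · simp only [depth]; omega

/-- Here `e` consists of the items above the current subtree. The search keeps the invariant that
`e` has no meeting pair but gains one with the subtree; if the right child is not enough, it joins
`e`. The leaf that is reached completes the first pair from above. -/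
theorem cross_spec {t : RTree} {w : ℕ} (h : t.Inv w) (e : Finset Item)
    (he : ∀ i ∈ t.items, ∀ j ∈ e, i < j) (hn : ¬ Meets e) (hm : Meets (e ∪ t.items)) :
    Fn fCross (.pair t.enc (.pair (encMin (minSwap 3 e)) (encMax (maxSwap 4 e)))) fun v τ =>
      ∃ i a c : Item, v = .pair (encItem i) (.pair (encItem a.swap) (encItem c.swap)) ∧
        i ∈ t.items ∧ IsCross (e ∪ t.items) i a c ∧ τ ≤ 3000 * (t.depth + 1) := by
  induction t generalizing w e with
  | nil => exact absurd (by simpa [items] using hm) hn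
  | leaf i =>
    rw [fn_cross]
    simp only [crossBody, run, enc_leaf]
    refine ((leaf i).info_spec).mono ?_
    rintro _ t1 ⟨rfl, h1⟩
    simp only [encSummary, run]
    refine (minItem_spec _ _).mono ?_
    rintro _ t2 ⟨rfl, h2⟩
    refine (maxItem_spec _ _).mono ?_
    rintro _ t3 ⟨rfl, h3⟩
    rw [← minSwap_union, ← maxSwap_union]
    obtain ⟨a', c', ha, hc, hac⟩ := meets_iff.1 hm
    rw [ha, hc]
    obtain ⟨a, ha', ha3, rfl⟩ := exists_of_minSwap_eq ha
    obtain ⟨c, hc', hc4, rfl⟩ := exists_of_maxSwap_eq hc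
    have hle : ∀ j ∈ e ∪ (leaf i).items, i ≤ j := by
      intro j hj
      simp only [items, Finset.mem_union, Finset.mem_singleton] at hj
      rcases hj with hj | rfl
      · exact (he i (by simp [items]) j hj).le
      · exact le_rfl
    refine ⟨i, a, c, rfl, by simp [items], ⟨ha', hc', ha3, hc4, hac, hle _ ha', hle _ hc', ?_⟩,
      by omega⟩
    intro a₁ ha₁ c₁ hc₁ ha₁3 hc₁4 hia hic
    simp only [items, Finset.mem_union, Finset.mem_singleton] at ha₁ hc₁
    by_contra hlt
    exact hn ⟨a₁, ha₁.resolve_right hia.ne', c₁, hc₁.resolve_right hic.ne', ha₁3, hc₁4,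
      not_lt.1 hlt⟩
  | node cd used m r y a b _ iha ihb =>
    rw [fn_cross]
    simp only [crossBody, run, enc_node]
    refine b.info_spec.mono ?_
    rintro _ t1 ⟨rfl, h1⟩
    simp only [encSummary, run]
    refine (minItem_spec _ _).mono ?_
    rintro _ t2 ⟨rfl, h2⟩
    refine (maxItem_spec _ _).mono ?_
    rintro _ t3 ⟨rfl, h3⟩
    rw [← minSwap_union, ← maxSwap_union]
    refine (overlap_spec _).mono ?_
    rintro _ t4 ⟨rfl, h4⟩
    simp only [decide_cases]
    have heb : ∀ i ∈ b.items, ∀ j ∈ e, i < j := fun i hi =>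
      he i (Finset.mem_union_right _ hi)
    have hea : ∀ i ∈ a.items, ∀ j ∈ e ∪ b.items, i < j := fun i hi j hj => by
      rcases Finset.mem_union.1 hj with hj | hj
      · exact he i (Finset.mem_union_left _ hi) j hj
      · exact h.lt i hi j hj
    constructor <;> intro hr
    · refine (ihb h.right e heb hn hr).mono ?_
      rintro _ t5 ⟨i, a₁, c₁, rfl, hi, hc, h5⟩
      have hsub : e ∪ b.items ⊆ e ∪ (node cd used m r y a b).items :=
        Finset.union_subset_union_right Finset.subset_union_right
      have hback : ∀ j ∈ e ∪ (node cd used m r y a b).items, i < j → j ∈ e ∪ b.items := by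
        intro j hj hij
        simp only [items, Finset.mem_union] at hj ⊢
        rcases hj with hj | hj | hj
        · exact .inl hj
        · exact absurd hij (h.lt j hj i hi).not_gt
        · exact .inr hj
      refine ⟨i, a₁, c₁, rfl, Finset.mem_union_right _ hi, ⟨hsub hc.mem_a, hsub hc.mem_c, hc.cls_a,
        hc.cls_c, hc.le, hc.le_a, hc.le_c, fun a' ha' c' hc' h3 h4 hia hic => ?_⟩, ?_⟩
      · exact hc.lt a' (hback _ ha' hia) c' (hback _ hc' hic) h3 h4 hia hic
      · simp only [depth]; omega
    · have hset : e ∪ (node cd used m r y a b).items = e ∪ b.items ∪ a.items := by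
        rw [items, Finset.union_assoc, Finset.union_comm b.items]
      rw [hset] at hm ⊢
      refine (iha h.left _ hea hr hm).mono ?_
      rintro _ t5 ⟨i, a₁, c₁, rfl, hi, hc, h5⟩
      refine ⟨i, a₁, c₁, rfl, Finset.mem_union_left _ hi, hc, ?_⟩
      simp only [depth]; omega

end RTree

/-- The quadrant `j` covers the point `p`. -/
def Covering (j p : Item) : Prop :=
  j.cls = 3 ∧ p < j ∧ j.snd ≤ p.snd ∨ j.cls = 4 ∧ p < j ∧ p.snd ≤ j.snd ∨
    j.cls = 0 ∧ j < p ∧ j.snd ≤ p.snd ∨ j.cls = 1 ∧ j < p ∧ p.snd ≤ j.snd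

/-- The points of `s` above `lo` that are covered by southeast quadrants. -/
noncomputable def remaining (s : Finset Item) (lo : WithBot Item) : Finset Item :=
  coveredSE (between s lo ⊤)

/-- A southeast quadrant that covers a point above `lo` is itself above `lo`, so discarding the
lower items loses no covering quadrant. -/
theorem mem_remaining {s : Finset Item} {lo : WithBot Item} {p : Item} :
    p ∈ remaining s lo ↔ p ∈ s ∧ SECovered s p ∧ lo < (p : WithBot Item) := by
  simp only [remaining, mem_coveredSE, mem_between, SECovered, WithTop.coe_lt_top, and_true]
  constructor
  · rintro ⟨⟨h1, h2⟩, h3, j, hj, h4⟩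
    exact ⟨h1, ⟨h3, j, hj.1, h4⟩, h2⟩
  · rintro ⟨h1, ⟨h3, j, hj, h4, h5, h6⟩, h2⟩
    exact ⟨⟨h1, h2⟩, h3, j, ⟨hj, h2.trans (WithBot.coe_lt_coe.2 h5)⟩, h4, h5, h6⟩

open Classical in
/-- The quadrants of `o` that cover a remaining point. -/
noncomputable def active (s o : Finset Item) (lo : WithBot Item) : Finset Item :=
  o.filter fun q => ∃ p ∈ remaining s lo, Covering q p

theorem mem_active {s o : Finset Item} {lo : WithBot Item} {q : Item} :
    q ∈ active s o lo ↔ q ∈ o ∧ ∃ p ∈ remaining s lo, Covering q p := by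
  simp [active]

theorem remaining_subset {s : Finset Item} {lo lo' : WithBot Item} (h : lo ≤ lo') :
    remaining s lo' ⊆ remaining s lo := fun p hp => by
  rw [mem_remaining] at hp ⊢
  exact ⟨hp.1, hp.2.1, h.trans_lt hp.2.2⟩

/-- No remaining point is covered by a southwest quadrant. -/
def NoSouthwest (s : Finset Item) (lo : WithBot Item) : Prop :=
  ∀ p ∈ remaining s lo, ∀ j ∈ s, j.cls = 4 → p < j → j.snd < p.snd

/-- `p` is a leftmost remaining point and `b` the highest southeast quadrant that covers it. -/
structure IsStep (s : Finset Item) (lo : WithBot Item) (p b : Item) : Prop where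
  mem : p ∈ remaining s lo
  le : ∀ q ∈ remaining s lo, p.snd ≤ q.snd
  highest : IsHighest s p.snd b

/-! ### One step of the sweep, and the charging argument. -/

namespace IsStep

variable {s o : Finset Item} {lo : WithBot Item} {p b b' q : Item} {x : Key}

/-- The southeast quadrant that covers `q` reaches `q.snd`, hence `x`, so it is at most `b`. -/
theorem lt_of_isHighest (hb : IsHighest s x b) (hq : q ∈ remaining s lo) (h : q.snd ≤ x) :
    q < b := by
  obtain ⟨-, ⟨-, j, hj, h3, hlt, hle⟩, -⟩ := mem_remaining.1 hq
  exact hlt.trans_le (hb.le j hj h3 (hle.trans h))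

theorem ne_of_isHighest (hb : IsHighest s x b) (hq : q ∈ remaining s lo) : q ≠ b := by
  rintro rfl
  have := (mem_remaining.1 hq).2.1.1
  rw [hb.cls] at this
  exact absurd this (by decide)

variable (h : IsStep s lo p b)
include h

theorem lt : p < b := lt_of_isHighest h.highest h.mem le_rfl

theorem lo_lt : lo < (b : WithBot Item) :=
  (mem_remaining.1 h.mem).2.2.trans (WithBot.coe_lt_coe.2 h.lt)

theorem covering (hq : q ∈ remaining s lo) (hqb : q < b) : Covering b q :=
  .inl ⟨h.highest.cls, hqb, h.highest.snd_le.trans (h.le q hq)⟩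

theorem le_isHighest (hx : p.snd ≤ x) (hb' : IsHighest s x b') : b ≤ b' :=
  hb'.le b h.highest.mem h.highest.cls (h.highest.snd_le.trans hx)

/-- Suppose that `q` covers `p` and also a remaining point `r` above `b'`. If `q` is southeast, it
is at most `b ≤ b'`, below `r`. Southwest is excluded by `hs`, northeast by `hn`. If `q` is
northwest, it starts below `b`, so `r.snd ≤ q.snd ≤ x`; then the southeast quadrant covering `r`
reaches `x` and is at most `b'`, so `r` is below `b'`. -/
theorem notMem_active (hs : NoSouthwest s lo) (ho : o ⊆ s) (hq : q ∈ o) (hqp : Covering q p)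
    (hn : ¬ ∃ i ∈ between s ⊥ b, i.cls = 0 ∧ i.snd ≤ p.snd) (hx : p.snd ≤ x)
    (hw : ∀ i ∈ between s ⊥ b, i.cls = 1 → i.snd ≤ x) (hb' : IsHighest s x b') :
    q ∉ active s o b' := by
  rintro hqa
  obtain ⟨-, r, hr, hqr⟩ := mem_active.1 hqa
  have hbb := h.le_isHighest hx hb'
  have hr' : b' < r := WithBot.coe_lt_coe.1 (mem_remaining.1 hr).2.2
  have hqb : q < p → q ∈ between s ⊥ b := fun hlt =>
    mem_between.2 ⟨ho hq, WithBot.bot_lt_coe _, WithTop.coe_lt_coe.2 (hlt.trans h.lt)⟩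
  rcases hqp with ⟨hc, hlt, hle⟩ | ⟨hc, hlt, hle⟩ | ⟨hc, hlt, hle⟩ | ⟨hc, hlt, hle⟩
  · have h1 := h.highest.le q (ho hq) hc hle
    rcases hqr with ⟨-, h2, -⟩ | ⟨hc', -⟩ | ⟨hc', -⟩ | ⟨hc', -⟩
    · exact absurd (hr'.trans h2) (h1.trans hbb).not_gt
    all_goals rw [hc] at hc'; exact absurd hc' (by decide)
  · exact absurd hle (hs p h.mem q (ho hq) hc hlt).not_ge
  · exact hn ⟨q, hqb hlt, hc, hle⟩
  · rcases hqr with ⟨hc', -⟩ | ⟨hc', -⟩ | ⟨hc', -⟩ | ⟨-, -, h2⟩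
    on_goal 4 =>
      exact absurd hr' (lt_of_isHighest hb' hr (h2.trans (hw q (hqb hlt) hc))).not_gt
    all_goals rw [hc] at hc'; exact absurd hc' (by decide)

theorem card_active_lt (hs : NoSouthwest s lo) (ho : o ⊆ s) (hcov : ∃ q ∈ o, Covering q p)
    (hn : ¬ ∃ i ∈ between s ⊥ b, i.cls = 0 ∧ i.snd ≤ p.snd) (hx : p.snd ≤ x)
    (hw : ∀ i ∈ between s ⊥ b, i.cls = 1 → i.snd ≤ x) (hb' : IsHighest s x b') :
    (active s o b').card < (active s o lo).card := by
  obtain ⟨q, hq, hqp⟩ := hcov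
  refine Finset.card_lt_card (Finset.ssubset_iff_of_subset ?_ |>.2
    ⟨q, mem_active.2 ⟨hq, p, h.mem, hqp⟩, h.notMem_active hs ho hq hqp hn hx hw hb'⟩)
  intro q hq
  obtain ⟨hq, r, hr, hqr⟩ := mem_active.1 hq
  refine mem_active.2 ⟨hq, r, remaining_subset ?_ hr, hqr⟩
  exact h.lo_lt.le.trans (WithBot.coe_le_coe.2 (h.le_isHighest hx hb'))

theorem card_active_pos (hcov : ∃ q ∈ o, Covering q p) : 0 < (active s o lo).card := by
  obtain ⟨q, hq, hqp⟩ := hcov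
  exact Finset.card_pos.2 ⟨q, mem_active.2 ⟨hq, p, h.mem, hqp⟩⟩

end IsStep

/-- The quadrants among the items of `s` are converted to output by the program as by `dec`. -/
def Decodes (s : Finset Item) (dec : Item → Quadrant) : Prop :=
  ∀ i ∈ s, i.cls ≠ 2 → Fn fOutput (encItem i.swap) fun v τ => v = encQuadrant (dec i) ∧ τ ≤ 200

/-- `l` consists of quadrants of `s` and covers the remaining points. -/
structure IsPartialCover (s : Finset Item) (lo : WithBot Item) (l : List Item) : Prop where
  mem : ∀ i ∈ l, i ∈ s ∧ i.cls ≠ 2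
  cover : ∀ p ∈ remaining s lo, ∃ q ∈ l, Covering q p

theorem NoSouthwest.mono {s : Finset Item} {lo lo' : WithBot Item} (h : NoSouthwest s lo)
    (hl : lo ≤ lo') : NoSouthwest s lo' := fun p hp => h p (remaining_subset hl hp)

theorem IsPartialCover.step {s : Finset Item} {lo : WithBot Item} {b' : Item} {l l' : List Item}
    (hl : IsPartialCover s b' l) (hl' : ∀ i ∈ l', i ∈ s ∧ i.cls ≠ 2)
    (h : ∀ q ∈ remaining s lo, q ≤ b' → ∃ i ∈ l', Covering i q) :
    IsPartialCover s lo (l ++ l') := by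
  refine ⟨fun i hi => ?_, fun q hq => ?_⟩
  · rcases List.mem_append.1 hi with hi | hi
    · exact hl.mem i hi
    · exact hl' i hi
  · rcases le_or_gt q b' with hqb | hqb
    · obtain ⟨i, hi, hiq⟩ := h q hq hqb
      exact ⟨i, List.mem_append_right _ hi, hiq⟩
    · have := mem_remaining.1 hq
      obtain ⟨i, hi, hiq⟩ := hl.cover q (mem_remaining.2 ⟨this.1, this.2.1, WithBot.coe_lt_coe.2 hqb⟩)
      exact ⟨i, List.mem_append_left _ hi, hiq⟩

theorem encItem_swap (i : Item) :
    encItem i.swap = .pair (encKey i.snd) (.pair (encNat i.cls) (encKey i.key)) := rfl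

namespace RTree

/-- `o` is any family that covers the points in question; it appears in the analysis only. The
induction is on a bound for the number of its members that still cover a remaining point. -/
theorem loop_spec {t : RTree} {w : ℕ} (h : t.Inv w) {o : Finset Item} (ho : o ⊆ t.items)
    (hcov : ∀ p ∈ remaining t.items ⊥, ∃ q ∈ o, Covering q p) {dec : Item → Quadrant}
    (hdec : Decodes t.items dec) (n : ℕ) (lo : WithBot Item) (acc : List Quadrant)
    (hn : (active t.items o lo).card ≤ n) (hs : NoSouthwest t.items lo) :
    Fn fLoop (.pair t.enc (.pair (encMax lo) (encList encQuadrant acc))) fun v τ =>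
      ∃ l : List Item, v = encList encQuadrant (l.map dec ++ acc) ∧
        IsPartialCover t.items lo l ∧ l.length ≤ 3 * n ∧ τ ≤ (n + 1) * (10000000 * lg w ^ 2) := by
  induction n using Nat.strong_induction_on generalizing lo acc with
  | _ n ih =>
  have hlg := one_le_lg w
  have hlg2 : lg w ≤ lg w ^ 2 := Nat.le_self_pow (by norm_num) _
  have hdepth := h.depth_le
  rw [fn_loop]
  simp only [loopBody, run]
  refine (query_outer_spec h lo ⊤).mono ?_
  rintro _ t1 ⟨rfl, h1⟩
  simp only [encSummary, run]
  cases hL : leastCovered (between t.items lo ⊤) using WithTop.recTopCoe with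
  | top =>
    simp only [encMin_top, run]
    have hr : remaining t.items lo = ∅ := by
      by_contra hne
      obtain ⟨p, hp⟩ := Finset.nonempty_iff_ne_empty.2 hne
      have hp' := mem_coveredSE.1 hp
      have := leastCovered_le hp'.1 hp'.2
      rw [hL] at this
      simp at this
    refine ⟨[], rfl, ⟨by simp, by simp [hr]⟩, by simp, ?_⟩
    have : 1 * (10000000 * lg w ^ 2) ≤ (n + 1) * (10000000 * lg w ^ 2) :=
      Nat.mul_le_mul_right _ (by omega)
    omega
  | coe x =>
    obtain ⟨p, hp, hpc, rfl⟩ := exists_of_leastCovered_eq hL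
    have hp' : p ∈ remaining t.items lo := mem_coveredSE.2 ⟨hp, hpc⟩
    have hcovp := hcov p (remaining_subset bot_le hp')
    simp only [encMin_coe, encItem_cases, encItem_fst, Item.inn_key, run]
    have hex : ∃ i ∈ t.items, i.cls = 3 ∧ i.snd ≤ p.snd := by
      obtain ⟨-, ⟨-, j, hj, h3, -, hle⟩, -⟩ := mem_remaining.1 hp'
      exact ⟨j, hj, h3, hle⟩
    refine (highest_spec h _ hex).mono ?_
    rintro _ t2 ⟨b, rfl, hb, h2⟩
    have hst : IsStep t.items lo p b := ⟨hp', fun q hq => by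
      have hq' := mem_coveredSE.1 hq
      have := leastCovered_le hq'.1 hq'.2
      rw [hL, WithTop.coe_le_coe] at this
      exact Item.key_le_of_le this, hb⟩
    have hpos := hst.card_active_pos hcovp
    refine (query_outer_spec h ⊥ b).mono ?_
    rintro _ t3 ⟨rfl, h3⟩
    simp only [encItem_snd, encItem_fst, run]
    have hout : ∀ i ∈ t.items, i.cls ≠ 2 →
        Fn fOutput (.pair (encKey i.snd) (.pair (encNat i.cls) (encKey i.key))) fun v τ =>
          v = encQuadrant (dec i) ∧ τ ≤ 200 := hdec
    have hb2 : b.cls ≠ 2 := by rw [hb.cls]; decide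
    refine (hout b hb.mem hb2).mono ?_
    rintro _ t4 ⟨rfl, h4⟩
    simp only [encSummary, run]
    refine (reach_spec _ _ _).mono ?_
    rintro _ t5 ⟨rfl, h5⟩
    simp only [decide_cases]
    -- Some member of `o` covers `p`, so at least one is active.
    obtain ⟨n, rfl⟩ : ∃ k, n = k + 1 := ⟨n - 1, by omega⟩
    have hmul : (n + 1 + 1) * (10000000 * lg w ^ 2) =
        (n + 1) * (10000000 * lg w ^ 2) + 10000000 * lg w ^ 2 := by ring
    have hmul' : 10000000 * lg w ^ 2 ≤ (n + 1) * (10000000 * lg w ^ 2) := by nlinarith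
    constructor <;> intro hN
    -- Northeast case: `e` starts below `b` and reaches the leftmost remaining point. So `b` covers
    -- what is below `b`, `e` what is above, and the sweep ends.
    · obtain ⟨i, hi, hi0, hix⟩ := id hN
      obtain ⟨_, hmin, hmx⟩ := exists_minSwap_eq_iff.2 hN
      rw [hmin]
      obtain ⟨e, he, he0, rfl⟩ := exists_of_minSwap_eq hmin
      rw [mem_between] at he
      refine (hdec e he.1 (by rw [he0]; decide)).mono ?_
      rintro _ t6 ⟨rfl, h6⟩
      refine ⟨[e, b], rfl, ⟨?_, fun q hq => ?_⟩, by simp; omega, by omega⟩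
      · intro i hi
        simp only [List.mem_cons, List.not_mem_nil, or_false] at hi
        rcases hi with rfl | rfl
        · exact ⟨he.1, by rw [he0]; decide⟩
        · exact ⟨hb.mem, hb2⟩
      · rcases lt_trichotomy q b with hqb | rfl | hqb
        · exact ⟨b, by simp, hst.covering hq hqb⟩
        · exact absurd rfl (IsStep.ne_of_isHighest hb hq)
        · refine ⟨e, by simp, .inr (.inr (.inl ⟨he0, ?_, ?_⟩))⟩
          · exact (WithTop.coe_lt_coe.1 he.2.2).trans hqb
          · exact LE.le.trans hmx (hst.le q hq)
    -- The step that outputs `b` alone occurs both when no northwest quadrant starts below `b` and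
    -- when none of them reaches beyond `p`; it is the charging argument with `b' = b` and `x =
    -- p.snd`.
    · have hdefault : (∀ i ∈ between t.items ⊥ b, i.cls = 1 → i.snd ≤ p.snd) →
          Fn fLoop (.pair t.enc (.pair (encItem b) (.pair (encQuadrant (dec b))
            (encList encQuadrant acc)))) fun v τ =>
          ∃ l : List Item, v = encList encQuadrant (l.map dec ++ acc) ∧
            IsPartialCover t.items lo l ∧ l.length ≤ 3 * (n + 1) ∧
              τ ≤ (n + 1) * (10000000 * lg w ^ 2) := by
        intro hw
        have hlt := hst.card_active_lt hs ho hcovp hN le_rfl hw hb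
        refine (ih n (by omega) b (dec b :: acc) (by omega) (hs.mono hst.lo_lt.le)).mono ?_
        rintro _ t6 ⟨l, rfl, hl, hl3, h6⟩
        refine ⟨l ++ [b], by simp, hl.step (by simp [hb.mem, hb2]) ?_,
          by simp; omega, h6⟩
        intro q hq hqb
        exact ⟨b, by simp, hst.covering hq (lt_of_le_of_ne hqb (IsStep.ne_of_isHighest hb hq))⟩
      cases hW : maxSwap 1 (between t.items ⊥ b) using WithBot.recBotCoe with
      | bot =>
        simp only [encMax_bot, run]
        refine (hdefault fun i hi hi1 => ?_).mono ?_
        · have := le_maxSwap hi hi1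
          rw [hW] at this
          simp at this
        · rintro _ t6 ⟨l, rfl, hl, hl3, h6⟩
          exact ⟨l, rfl, hl, hl3, by omega⟩
      | coe x =>
        obtain ⟨e, he, he1, rfl⟩ := exists_of_maxSwap_eq hW
        have hmax : ∀ i ∈ between t.items ⊥ b, i.cls = 1 → i.snd ≤ e.snd := fun i hi hi1 => by
          have := le_maxSwap hi hi1
          rw [hW, WithBot.coe_le_coe] at this
          exact Item.key_le_of_le this
        simp only [encMax_coe, encItem_cases, encItem_fst, Item.swap_key, run]
        refine (leKey_spec _ _).mono ?_
        rintro _ t6 ⟨rfl, h6⟩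
        simp only [decide_cases]
        constructor <;> intro hx
        · refine (highest_spec h e.snd ⟨b, hb.mem, hb.cls, hb.snd_le.trans hx⟩).mono ?_
          rintro _ t7 ⟨b', rfl, hb', h7⟩
          have hb2' : b'.cls ≠ 2 := by rw [hb'.cls]; decide
          rw [mem_between] at he
          have he2 : e.cls ≠ 2 := by rw [he1]; decide
          simp only [encItem_snd, encItem_fst, run]
          refine (hout b' hb'.mem hb2').mono ?_
          rintro _ t8 ⟨rfl, h8⟩
          refine (hdec e he.1 he2).mono ?_
          rintro _ t9 ⟨rfl, h9⟩
          have hlt := hst.card_active_lt hs ho hcovp hN hx hmax hb'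
          have hbb := hst.le_isHighest hx hb'
          refine (ih n (by omega) b' (dec b' :: dec e :: dec b :: acc) (by omega)
            (hs.mono (hst.lo_lt.le.trans (WithBot.coe_le_coe.2 hbb)))).mono ?_
          rintro _ t10 ⟨l, rfl, hl, hl3, h10⟩
          refine ⟨l ++ [b', e, b], by simp, hl.step ?_ ?_,
            by simp; omega, by omega⟩
          · simp [hb.mem, hb2, hb'.mem, hb2', he.1, he2]
          · intro q hq hqb
            -- Points right of the side of `e` are covered by `b'`; the others by `b` if they are
            -- below `b`, and by `e` if they are above.
            rcases le_total q.snd e.snd with hqe | hqe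
            · rcases lt_trichotomy q b with hqb | rfl | hqb
              · exact ⟨b, by simp, hst.covering hq hqb⟩
              · exact absurd rfl (IsStep.ne_of_isHighest hb hq)
              · exact ⟨e, by simp, .inr (.inr (.inr ⟨he1,
                  (WithTop.coe_lt_coe.1 he.2.2).trans hqb, hqe⟩))⟩
            · exact ⟨b', by simp, .inl ⟨hb'.cls,
                lt_of_le_of_ne hqb (IsStep.ne_of_isHighest hb' hq), hb'.snd_le.trans hqe⟩⟩
        · refine (hdefault fun i hi hi1 => (hmax i hi hi1).trans (not_le.1 hx).le).mono ?_
          rintro _ t7 ⟨l, rfl, hl, hl3, h7⟩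
          exact ⟨l, rfl, hl, hl3, by omega⟩

/-- A southeast and a southwest quadrant that contain a common point above `i` would be a meeting
pair above `i`. -/
theorem noSouthwest_of_isCross {s : Finset Item} {i a c : Item} (h : IsCross s i a c) :
    NoSouthwest s i := by
  intro p hp j hj h4 hlt
  obtain ⟨-, ⟨-, k, hk, h3, hpk, hle⟩, hlo⟩ := mem_remaining.1 hp
  have hip := WithBot.coe_lt_coe.1 hlo
  exact (h.lt k hk j hj h3 h4 (hip.trans hpk) (hip.trans hlt)).trans_le hle

theorem noSouthwest_of_not_meets {s : Finset Item} (h : ¬ Meets s) (lo : WithBot Item) :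
    NoSouthwest s lo := by
  intro p hp j hj h4 _
  obtain ⟨-, ⟨-, k, hk, h3, hpk, hle⟩, -⟩ := mem_remaining.1 hp
  by_contra hn
  exact h ⟨k, hk, j, hj, h3, h4, hle.trans (not_lt.1 hn)⟩

/-- The crossing pair covers every point up to `i`: its union spans the whole width at that height
and below. The two extra outputs are absorbed into `5 * o.card`, as `o` is nonempty when there is a
point to cover. -/
theorem greedy_spec {t : RTree} {w : ℕ} (h : t.Inv w) {o : Finset Item} (ho : o ⊆ t.items)
    (hcov : ∀ p ∈ coveredSE t.items, ∃ q ∈ o, Covering q p) {dec : Item → Quadrant}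
    (hdec : Decodes t.items dec) (acc : List Quadrant) :
    Fn fGreedy (.pair t.enc (encList encQuadrant acc)) fun v τ =>
      ∃ l : List Item, v = encList encQuadrant (l.map dec ++ acc) ∧
        (∀ i ∈ l, i ∈ t.items ∧ i.cls ≠ 2) ∧ (∀ p ∈ coveredSE t.items, ∃ q ∈ l, Covering q p) ∧
        l.length ≤ 5 * o.card ∧ τ ≤ (o.card + 1) * (20000000 * lg w ^ 2) := by
  have hlg := one_le_lg w
  have hlg2 : lg w ≤ lg w ^ 2 := Nat.le_self_pow (by norm_num) _
  have hdepth := h.depth_le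
  have hrem : remaining t.items ⊥ = coveredSE t.items := by rw [remaining, between_bot_top]
  rw [← hrem] at hcov ⊢
  have hact : ∀ lo, (active t.items o lo).card ≤ o.card := fun lo =>
    Finset.card_le_card fun q hq => (mem_active.1 hq).1
  have htime : (o.card + 1) * (10000000 * lg w ^ 2) + 10000000 * lg w ^ 2 ≤
      (o.card + 1) * (20000000 * lg w ^ 2) := by nlinarith
  rw [fn_greedy]
  simp only [greedyBody, run]
  refine t.info_spec.mono ?_
  rintro _ t1 ⟨rfl, h1⟩
  simp only [encSummary, run]
  cases hL : leastCovered t.items using WithTop.recTopCoe with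
  | top =>
    simp only [encMin_top, run]
    refine ⟨[], rfl, by simp, fun p hp => ?_, by simp, by omega⟩
    rw [hrem, mem_coveredSE] at hp
    have := leastCovered_le hp.1 hp.2
    rw [hL] at this
    simp at this
  | coe x =>
    obtain ⟨p, hp, hpc, rfl⟩ := exists_of_leastCovered_eq hL
    have hpos : 0 < o.card := by
      obtain ⟨q, hq, -⟩ := hcov p (by rw [hrem]; exact mem_coveredSE.2 ⟨hp, hpc⟩)
      exact Finset.card_pos.2 ⟨q, hq⟩
    simp only [encMin_coe, encItem_cases, run]
    refine (overlap_spec _).mono ?_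
    rintro _ t2 ⟨rfl, h2⟩
    simp only [decide_cases]
    constructor <;> intro hm
    · have hcr := cross_spec h ∅ (by simp) (by rintro ⟨i, hi, -⟩; simp at hi) (by simpa using hm)
      simp only [minSwap, maxSwap, Finset.inf_empty, Finset.sup_empty, encMin_top, encMax_bot,
        Finset.empty_union] at hcr
      refine hcr.mono ?_
      rintro _ t3 ⟨i, a, c, rfl, hi, hc, h3⟩
      simp only [run]
      have ha2 : a.cls ≠ 2 := by rw [hc.cls_a]; decide
      have hc2 : c.cls ≠ 2 := by rw [hc.cls_c]; decide
      refine (hdec a hc.mem_a ha2).mono ?_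
      rintro _ t4 ⟨rfl, h4⟩
      refine (hdec c hc.mem_c hc2).mono ?_
      rintro _ t5 ⟨rfl, h5⟩
      refine (loop_spec h ho hcov hdec o.card i (dec a :: dec c :: acc) (hact _)
        (noSouthwest_of_isCross hc)).mono ?_
      rintro _ t6 ⟨l, rfl, hl, hl3, h6⟩
      have := hl.step (lo := ⊥) (l' := [a, c])
        (by simp [ha2, hc2, hc.mem_a, hc.mem_c]) fun q hq hqi => by
          have hq2 := (mem_remaining.1 hq).2.1.1
          rcases le_total a.snd q.snd with hle | hle
          · refine ⟨a, by simp, .inl ⟨hc.cls_a, lt_of_le_of_ne (hqi.trans hc.le_a) ?_, hle⟩⟩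
            rintro rfl
            exact ha2 hq2
          · refine ⟨c, by simp, .inr (.inl ⟨hc.cls_c, lt_of_le_of_ne (hqi.trans hc.le_c) ?_,
              hle.trans hc.le⟩)⟩
            rintro rfl
            exact hc2 hq2
      refine ⟨l ++ [a, c], by simp, this.mem, this.cover, by simp; omega, by omega⟩
    · refine (loop_spec h ho hcov hdec o.card ⊥ acc (hact _)
        (noSouthwest_of_not_meets hm _)).mono ?_
      rintro _ t6 ⟨l, rfl, hl, hl3, h6⟩
      exact ⟨l, rfl, hl.mem, hl.cover, by omega, by omega⟩

end RTree

/-! ## Verification of a cover -/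

/-- The key `x` lies strictly between the keys of `lo` and `hi`. -/
def KeyBetween (lo : WithBot Item) (hi : WithTop Item) (x : Key) : Prop :=
  (∀ a : Item, lo = a → a.key < x) ∧ ∀ a : Item, hi = a → x < a.key

theorem keyBetween_sup_inf {lo lo' : WithBot Item} {hi hi' : WithTop Item} {x : Key} :
    KeyBetween (lo ⊔ lo') (hi ⊓ hi') x ↔ KeyBetween lo hi x ∧ KeyBetween lo' hi' x := by
  have h1 : (∀ a : Item, lo ⊔ lo' = a → a.key < x) ↔
      (∀ a : Item, lo = a → a.key < x) ∧ ∀ a : Item, lo' = a → a.key < x := by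
    induction lo using WithBot.recBotCoe with
    | bot => simp
    | coe a =>
      induction lo' using WithBot.recBotCoe with
      | bot => simp
      | coe b =>
        simp only [← WithBot.coe_sup, WithBot.coe_inj, forall_eq']
        constructor
        · exact fun h => ⟨(Item.key_le_of_le le_sup_left).trans_lt h,
            (Item.key_le_of_le le_sup_right).trans_lt h⟩
        · rintro ⟨ha, hb⟩
          rcases max_choice a b with h | h <;> rw [h] <;> assumption
  have h2 : (∀ a : Item, hi ⊓ hi' = a → x < a.key) ↔
      (∀ a : Item, hi = a → x < a.key) ∧ ∀ a : Item, hi' = a → x < a.key := by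
    induction hi using WithTop.recTopCoe with
    | top => simp
    | coe a =>
      induction hi' using WithTop.recTopCoe with
      | top => simp
      | coe b =>
        simp only [← WithTop.coe_inf, WithTop.coe_inj, forall_eq']
        constructor
        · exact fun h => ⟨h.trans_le (Item.key_le_of_le inf_le_left),
            h.trans_le (Item.key_le_of_le inf_le_right)⟩
        · rintro ⟨ha, hb⟩
          rcases min_choice a b with h | h <;> rw [h] <;> assumption
  simp only [KeyBetween, h1, h2]
  tauto

theorem keyBetween_swap_iff {c c' : Fin 7} {s s' : Finset Item} {x : Key} :
    KeyBetween (maxSwap c s) (minSwap c' s') x ↔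
      (∀ i ∈ s, i.cls = c → i.snd < x) ∧ ∀ i ∈ s', i.cls = c' → x < i.snd := by
  refine and_congr ⟨fun h i hi hc => ?_, fun h a ha => ?_⟩ ⟨fun h i hi hc => ?_, fun h a ha => ?_⟩
  · obtain ⟨a, ha, hai⟩ := WithBot.coe_le_iff.1 (le_maxSwap hi hc)
    exact (Item.key_le_of_le hai : i.snd ≤ a.key).trans_lt (h a ha)
  · obtain ⟨i, hi, hc, rfl⟩ := exists_of_maxSwap_eq ha
    exact h i hi hc
  · obtain ⟨a, ha, hai⟩ := WithTop.le_coe_iff.1 (minSwap_le hi hc)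
    exact (h a ha).trans_le (Item.key_le_of_le hai)
  · obtain ⟨i, hi, hc, rfl⟩ := exists_of_minSwap_eq ha
    exact h i hi hc

namespace RTree

theorem Inv.card_le {t : RTree} {w : ℕ} (h : t.Inv w) : t.items.card ≤ w := by
  rw [← toFinset_toList]
  exact (List.toFinset_card_le _).trans ((length_toList_le t).trans h.slots_le)

/-- A lower bound on keys as a lower bound on the items of an inner tree. -/
def threshold : WithBot Item → WithBot Item :=
  WithBot.recBotCoe ⊥ fun a => ((⟨a.key, 6, a.snd⟩ : Item) : WithBot Item)

/-- Class 6 exceeds the class 5 of inner items, so equal keys are excluded, contrary to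
`swap_lt_inn_iff`. -/
theorem threshold_lt_inn {lo : WithBot Item} {p : Item} :
    threshold lo < (p.inn : WithBot Item) ↔ ∀ a : Item, lo = a → a.key < p.snd := by
  induction lo using WithBot.recBotCoe with
  | bot => simp [threshold]
  | coe a => simp [threshold, Item.lt_iff]

open Classical in
-- In each subtree the least point to the right of `lo` is the only candidate: if it is not to the
-- left of `hi`, no later one is.
theorem uncovered_spec {w : ℕ} (l : List RTree) (hl : ∀ u ∈ l, u.Inv w) (lo : WithBot Item)
    (hi : WithTop Item) :
    Fn fUncovered (.pair (encList enc l) (.pair (encMax lo) (encMin hi))) fun v τ =>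
      v = encBool (decide (∃ i ∈ itemsOf l, i.cls = 2 ∧ KeyBetween lo hi i.snd)) ∧
        τ ≤ (l.length + 1) * (400000 * lg w) := by
  have hlg := one_le_lg w
  have hlg2 := lg_two_mul_le w
  induction l with
  | nil =>
    rw [fn_uncovered]
    simp only [uncoveredBody, run, encList_nil]
    exact ⟨by simp [itemsOf], by simp; omega⟩
  | cons t l ih =>
    have ih := ih fun u hu => hl u (by simp [hu])
    have ht := hl t (by simp)
    have hlen : ((t :: l).length + 1) * (400000 * lg w) =
        (l.length + 1) * (400000 * lg w) + 400000 * lg w := by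
      rw [List.length_cons]; ring
    have hlen' : 400000 * lg w ≤ (l.length + 1) * (400000 * lg w) := by nlinarith
    have hin := ht.inner
    have hq := query_inner_spec (hin.2.mono (by have := ht.card_le; omega : _ ≤ 2 * w + 1))
      (by rw [hin.1]; exact inner_innerSet _) (threshold lo) ⊤
    rw [hin.1] at hq
    have hmem : (∃ i ∈ itemsOf (t :: l), i.cls = 2 ∧ KeyBetween lo hi i.snd) ↔
        (∃ i ∈ t.items, i.cls = 2 ∧ KeyBetween lo hi i.snd) ∨
          ∃ i ∈ itemsOf l, i.cls = 2 ∧ KeyBetween lo hi i.snd := by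
      simp only [itemsOf, Finset.mem_union, or_and_right, exists_or]
    have hin2 : ∀ i : Item, i ∈ between (innerSet t.items) (threshold lo) ⊤ ↔ ∃ p ∈ t.items,
        p.cls = 2 ∧ (∀ a : Item, lo = a → a.key < p.snd) ∧ p.inn = i := by
      intro i
      simp only [mem_between, mem_innerSet, WithTop.coe_lt_top, and_true]
      constructor
      · rintro ⟨⟨p, hp, h2, rfl⟩, h⟩
        exact ⟨p, hp, h2, threshold_lt_inn.1 h, rfl⟩
      · rintro ⟨p, hp, h2, h, rfl⟩
        exact ⟨⟨p, hp, h2, rfl⟩, threshold_lt_inn.2 h⟩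
    have hrec : (¬ ∃ i ∈ t.items, i.cls = 2 ∧ KeyBetween lo hi i.snd) → ∀ v,
        v = encBool (decide (∃ i ∈ itemsOf l, i.cls = 2 ∧ KeyBetween lo hi i.snd)) →
        v = encBool (decide (∃ i ∈ itemsOf (t :: l), i.cls = 2 ∧ KeyBetween lo hi i.snd)) := by
      rintro h v rfl
      rw [decide_eq_decide.2 (hmem.trans (or_iff_right h))]
    have hyes : (∃ i ∈ t.items, i.cls = 2 ∧ KeyBetween lo hi i.snd) → Val.pair .nil .nil =
        encBool (decide (∃ i ∈ itemsOf (t :: l), i.cls = 2 ∧ KeyBetween lo hi i.snd)) := by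
      intro h
      rw [decide_eq_true (hmem.2 (.inl h))]
      rfl
    rw [fn_uncovered, uncoveredBody, ev_ifPair, ev_fst, ev_var]
    change Ev _ (.letIn _ _) _
    rw [ev_letIn]
    -- The branches with and without a lower bound compute the same function of `lo`, so they are
    -- joined before the result is examined.
    refine Ev.mono (Q := fun v τ => v = encMin (least (between (innerSet t.items) (threshold lo) ⊤)) ∧
      τ ≤ 160000 * lg (2 * w + 1) + 200) ?_ ?_
    · simp only [run, encList_cons]
      refine t.inner_spec.mono ?_
      rintro _ t1 ⟨rfl, h1⟩
      cases lo using WithBot.recBotCoe with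
      | bot =>
        simp only [encMax_bot, run]
        refine hq.mono ?_
        rintro _ t2 ⟨rfl, h2⟩
        exact ⟨rfl, by omega⟩
      | coe a =>
        simp only [encMax_coe, encItem_cases, encItem_fst, encItem_snd, run]
        refine hq.mono ?_
        rintro _ t2 ⟨rfl, h2⟩
        exact ⟨rfl, by omega⟩
    rintro _ t1 ⟨rfl, h1⟩
    cases hL : least (between (innerSet t.items) (threshold lo) ⊤) using WithTop.recTopCoe with
    | top =>
      simp only [encMin_top, run, encList_cons]
      refine ih.mono ?_
      rintro v t2 ⟨h2, h3⟩
      refine ⟨hrec ?_ v h2, by omega⟩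
      rintro ⟨p, hp, hp2, hk⟩
      have := least_le ((hin2 _).2 ⟨p, hp, hp2, hk.1, rfl⟩)
      rw [hL] at this
      simp at this
    | coe x =>
      obtain ⟨p, hp, hp2, hk, rfl⟩ := (hin2 _).1 (least_mem hL)
      simp only [encMin_coe, run, encList_cons, encItem_cases]
      cases hi using WithTop.recTopCoe with
      | top =>
        simp only [encMin_top, run]
        exact ⟨hyes ⟨p, hp, hp2, hk, by simp⟩, by omega⟩
      | coe b =>
        simp only [encMin_coe, encItem_cases, encItem_fst, run, Item.inn_key]
        refine (leKey_spec _ _).mono ?_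
        rintro _ t2 ⟨rfl, h2⟩
        simp only [decide_cases]
        constructor <;> intro hx
        · refine ih.mono ?_
          rintro v t3 ⟨h3, h4⟩
          refine ⟨hrec ?_ v h3, by omega⟩
          rintro ⟨q, hq, hq2, hk'⟩
          have := least_le ((hin2 _).2 ⟨q, hq, hq2, hk'.1, rfl⟩)
          rw [hL, WithTop.coe_le_coe] at this
          exact absurd (hk'.2 b rfl) ((hx.trans (Item.key_le_of_le this)).not_gt)
        · refine ⟨hyes ⟨p, hp, hp2, hk, ?_⟩, by omega⟩
          rintro a ha
          cases ha
          exact not_le.1 hx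

/-- The points of `s` above `p` are covered by `c`. -/
def CoversAbove (s c : Finset Item) (p : WithBot Item) : Prop :=
  ∀ x ∈ s, x.cls = 2 → p < (x : WithBot Item) → ∃ j ∈ c, Covering j x

/-- The points of a gap between two consecutive quadrants that are not covered by `c`. -/
theorem not_covering_iff {c : Finset Item} (hc : ∀ i ∈ c, i.cls ≠ 2) {p : WithBot Item} {x : Item}
    (hx2 : x.cls = 2) (hp : p < (x : WithBot Item))
    (hi : (x : WithTop Item) < least (between c p ⊤)) :
    (¬ ∃ j ∈ c, Covering j x) ↔ KeyBetween
      (maxSwap 4 (between c p ⊤) ⊔ maxSwap 1 (between c ⊥ (least (between c p ⊤))))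
      (minSwap 3 (between c p ⊤) ⊓ minSwap 0 (between c ⊥ (least (between c p ⊤)))) x.snd := by
  rw [keyBetween_sup_inf, keyBetween_swap_iff, keyBetween_swap_iff]
  -- No item of `c` lies strictly between `p` and the next one, so above `p` and above `x` mean the
  -- same for quadrants of `c`. Equality with `x` is impossible by class.
  have habove : ∀ j : Item, j ∈ between c p ⊤ ↔ j ∈ c ∧ x < j := by
    intro j
    simp only [mem_between, WithTop.coe_lt_top, and_true]
    refine and_congr_right fun hj => ⟨fun h => ?_, fun h => hp.trans (WithBot.coe_lt_coe.2 h)⟩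
    exact WithTop.coe_lt_coe.1 (hi.trans_le (least_le (mem_between.2 ⟨hj, h, WithTop.coe_lt_top _⟩)))
  have hbelow : ∀ j : Item, j ∈ between c ⊥ (least (between c p ⊤)) ↔ j ∈ c ∧ j < x := by
    intro j
    simp only [mem_between, WithBot.bot_lt_coe, true_and]
    refine and_congr_right fun hj => ⟨fun h => ?_, fun h => (WithTop.coe_lt_coe.2 h).trans hi⟩
    rcases lt_trichotomy j x with hjx | rfl | hjx
    · exact hjx
    · exact absurd hx2 (hc _ hj)
    · exact absurd h (least_le ((habove j).2 ⟨hj, hjx⟩)).not_gt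
  simp only [habove, hbelow]
  constructor
  · intro h
    refine ⟨⟨fun i hi h4 => ?_, fun i hi h3 => ?_⟩, fun i hi h1 => ?_, fun i hi h0 => ?_⟩ <;>
      by_contra hn <;> refine h ⟨i, hi.1, ?_⟩
    · exact .inr (.inl ⟨h4, hi.2, not_lt.1 hn⟩)
    · exact .inl ⟨h3, hi.2, not_lt.1 hn⟩
    · exact .inr (.inr (.inr ⟨h1, hi.2, not_lt.1 hn⟩))
    · exact .inr (.inr (.inl ⟨h0, hi.2, not_lt.1 hn⟩))
  · rintro ⟨⟨h4, h3⟩, h1, h0⟩ ⟨j, hj, ⟨hc, hlt, hle⟩ | ⟨hc, hlt, hle⟩ | ⟨hc, hlt, hle⟩ | ⟨hc, hlt, hle⟩⟩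
    · exact absurd (h3 j ⟨hj, hlt⟩ hc) hle.not_gt
    · exact absurd (h4 j ⟨hj, hlt⟩ hc) hle.not_gt
    · exact absurd (h0 j ⟨hj, hlt⟩ hc) hle.not_gt
    · exact absurd (h1 j ⟨hj, hlt⟩ hc) hle.not_gt

open Classical in
-- Each recursive call moves `p` to the next quadrant of `u`, so the number of range queries in `t`
-- is linear in the number of output quadrants and independent of the number of points.
theorem gaps_spec {t u : RTree} {w : ℕ} (h : t.Inv w) (hu : u.Inv w)
    (hc : ∀ i ∈ u.items, i.cls ≠ 2) (n : ℕ) (p : WithBot Item)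
    (hn : (between u.items p ⊤).card ≤ n) :
    Fn fGaps (.pair t.enc (.pair u.enc (encMax p))) fun v τ =>
      v = encBool (decide (CoversAbove t.items u.items p)) ∧
        τ ≤ (n + 1) * (30000000 * lg w ^ 2) := by
  induction n using Nat.strong_induction_on generalizing p with
  | _ n ih =>
  have hlg := one_le_lg w
  have hlg2 : lg w ≤ lg w ^ 2 := Nat.le_self_pow (by norm_num) _
  have hdepth := h.depth_le
  have hmul : 30000000 * lg w ^ 2 ≤ (n + 1) * (30000000 * lg w ^ 2) := by nlinarith
  have hgap : ∀ l, itemsOf l = between t.items p (least (between u.items p ⊤)) →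
      ((∃ i ∈ itemsOf l, i.cls = 2 ∧ KeyBetween
        (maxSwap 4 (between u.items p ⊤) ⊔
          maxSwap 1 (between u.items ⊥ (least (between u.items p ⊤))))
        (minSwap 3 (between u.items p ⊤) ⊓
          minSwap 0 (between u.items ⊥ (least (between u.items p ⊤)))) i.snd) ↔
      ∃ x ∈ t.items, x.cls = 2 ∧ p < (x : WithBot Item) ∧
        (x : WithTop Item) < least (between u.items p ⊤) ∧ ¬ ∃ j ∈ u.items, Covering j x) := by
    intro l hl
    rw [hl]
    constructor
    · rintro ⟨x, hx, hx2, hk⟩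
      obtain ⟨hx, hpx, hxi⟩ := mem_between.1 hx
      exact ⟨x, hx, hx2, hpx, hxi, (not_covering_iff hc hx2 hpx hxi).2 hk⟩
    · rintro ⟨x, hx, hx2, hpx, hxi, hk⟩
      exact ⟨x, mem_between.2 ⟨hx, hpx, hxi⟩, hx2, (not_covering_iff hc hx2 hpx hxi).1 hk⟩
  rw [fn_gaps]
  simp only [gapsBody, run]
  refine (query_outer_spec hu p ⊤).mono ?_
  rintro _ t1 ⟨rfl, h1⟩
  simp only [encSummary, run]
  refine (query_outer_spec hu ⊥ (least (between u.items p ⊤))).mono ?_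
  rintro _ t2 ⟨rfl, h2⟩
  simp only [encSummary, run]
  refine (maxItem_spec _ _).mono ?_
  rintro _ t3 ⟨rfl, h3⟩
  refine (minItem_spec _ _).mono ?_
  rintro _ t4 ⟨rfl, h4⟩
  refine (canon_spec h [] p (least (between u.items p ⊤))).mono ?_
  rintro _ t5 ⟨l, rfl, hl, h5⟩
  rw [List.append_nil]
  refine (uncovered_spec l hl.inv _ _).mono ?_
  rintro _ t6 ⟨rfl, h6⟩
  have hsides : sides p (least (between u.items p ⊤)) * t.depth ≤ 2 * t.depth :=
    Nat.mul_le_mul_right _ (sides_le _ _)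
  have hlen := hl.length_le
  have h7 : t6 ≤ 4000000 * lg w ^ 2 := h6.trans <| by
    calc (l.length + 1) * (400000 * lg w) ≤ (8 * lg w) * (400000 * lg w) := by gcongr; omega
      _ ≤ 4000000 * lg w ^ 2 := by nlinarith
  simp only [decide_cases, hgap l hl.items_eq]
  constructor <;> intro hx
  · obtain ⟨x, hx, hx2, hpx, hxi, hk⟩ := hx
    have : ¬ CoversAbove t.items u.items p := fun hco => hk (hco x hx hx2 hpx)
    refine ⟨?_, by omega⟩
    rw [decide_eq_false this]
    rfl
  · cases hi : least (between u.items p ⊤) using WithTop.recTopCoe with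
    | top =>
      simp only [encMin_top, run]
      have : CoversAbove t.items u.items p := fun x hxt hx2 hpx => by
        by_contra hk
        exact hx ⟨x, hxt, hx2, hpx, by rw [hi]; exact WithTop.coe_lt_top _, hk⟩
      refine ⟨?_, by omega⟩
      rw [decide_eq_true this]
      rfl
    | coe i =>
      simp only [encMin_coe, encItem_cases, run]
      have hmem := least_mem hi
      obtain ⟨hiu, hpi, -⟩ := mem_between.1 hmem
      have hcard : (between u.items i ⊤).card < (between u.items p ⊤).card := by
        refine Finset.card_lt_card ((Finset.ssubset_iff_of_subset fun j hj => ?_).2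
          ⟨i, hmem, fun hii => ?_⟩)
        · obtain ⟨hj, hij, ht⟩ := mem_between.1 hj
          exact mem_between.2 ⟨hj, hpi.trans hij, ht⟩
        · exact absurd (mem_between.1 hii).2.1 (lt_irrefl _)
      obtain ⟨n, rfl⟩ : ∃ k, n = k + 1 := ⟨n - 1, by omega⟩
      have hmul2 : (n + 1 + 1) * (30000000 * lg w ^ 2) =
        (n + 1) * (30000000 * lg w ^ 2) + 30000000 * lg w ^ 2 := by ring
      refine (ih n (by omega) i (by omega)).mono ?_
      rintro _ t8 ⟨rfl, h8⟩
      refine ⟨congrArg encBool (decide_eq_decide.2 ⟨fun hco x hxt hx2 hpx => ?_,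
        fun hco x hxt hx2 hix => hco x hxt hx2 (hpi.trans hix)⟩), by omega⟩
      rcases lt_trichotomy x i with hxi | rfl | hxi
      · by_contra hk
        exact hx ⟨x, hxt, hx2, hpx, by rw [hi]; exact WithTop.coe_lt_coe.2 hxi, hk⟩
      · exact absurd hx2 (hc _ hiu)
      · exact hco x hxt hx2 (WithBot.coe_lt_coe.2 hxi)

end RTree

/-! ## The four orientations of an instance -/

/-- The class of a quadrant. -/
def quadCls (e n : Bool) : Fin 7 := if n then if e then 0 else 1 else if e then 3 else 4

theorem quadCls_ne_two (e n : Bool) : quadCls e n ≠ 2 := by cases e <;> cases n <;> decide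

/-- A point, in the coordinate system with the orientation `o`. -/
def pointItem (o : Bool × Bool) (p : Point) : Item := ⟨keyOf o.2 p.2, 2, keyOf o.1 p.1⟩

/-- A quadrant, in the coordinate system with the orientation `o`. -/
def quadItem (o : Bool × Bool) (q : Quadrant) : Item :=
  ⟨keyOf o.2 q.vy, quadCls (q.east == o.1) (q.north == o.2), keyOf o.1 q.vx⟩

theorem pointItem_injective (o : Bool × Bool) : Function.Injective (pointItem o) := by
  rintro ⟨x, y⟩ ⟨x', y'⟩ h
  simp only [pointItem, Item.mk.injEq] at h
  exact Prod.ext (keyOf_injective _ h.2.2) (keyOf_injective _ h.1)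

theorem quadItem_injective (o : Bool × Bool) : Function.Injective (quadItem o) := by
  rintro ⟨e, n, x, y⟩ ⟨e', n', x', y'⟩ h
  simp only [quadItem, Item.mk.injEq] at h
  obtain ⟨h1, h2, h3⟩ := h
  obtain rfl := keyOf_injective _ h1
  obtain rfl := keyOf_injective _ h3
  obtain ⟨a, b⟩ := o
  have : e = e' ∧ n = n' := by
    revert h2
    cases e <;> cases e' <;> cases n <;> cases n' <;> cases a <;> cases b <;> decide
  rw [this.1, this.2]

theorem Item.lt_iff_of_cls_lt {i j : Item} (h : i.cls < j.cls) : i < j ↔ i.key ≤ j.key := by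
  rw [Item.lt_iff, le_iff_lt_or_eq]
  simp [h]

/-- The classes 0 and 1 of northern quadrants are below the class 2 of points, and the classes 3 and
4 of southern ones above it. By `Item.lt_iff_of_cls_lt` a strict comparison of items is therefore a
weak comparison of heights, as closed quadrants require. -/
theorem covering_iff (o : Bool × Bool) (q : Quadrant) (p : Point) :
    Covering (quadItem o q) (pointItem o p) ↔ p ∈ q.region := by
  obtain ⟨e, n, x, y⟩ := q
  obtain ⟨a, b⟩ := o
  have h2 : ∀ (c : Fin 7), 2 < c →
      (pointItem (a, b) p < ⟨keyOf b y, c, keyOf a x⟩ ↔ keyOf b p.2 ≤ keyOf b y) :=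
    fun c hc => Item.lt_iff_of_cls_lt hc
  have h0 : ∀ (c : Fin 7), c < 2 →
      ((⟨keyOf b y, c, keyOf a x⟩ : Item) < pointItem (a, b) p ↔ keyOf b y ≤ keyOf b p.2) :=
    fun c hc => Item.lt_iff_of_cls_lt hc
  have e3 := h2 3 (by decide)
  have e4 := h2 4 (by decide)
  have e0 := h0 0 (by decide)
  have e1 := h0 1 (by decide)
  cases e <;> cases n <;> cases a <;> cases b <;>
    simp_all [Covering, quadItem, quadCls, Quadrant.region, pointItem, and_comm]

/-- Every quadrant is a southeast one in exactly one of the four orientations, the one given by `he`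
and `hn`. -/
theorem secovered_pointItem {o : Bool × Bool} {q : Quadrant} {p : Point} {s : Finset Item}
    (hq : quadItem o q ∈ s) (he : o.1 = q.east) (hn : o.2 = !q.north) (h : p ∈ q.region) :
    SECovered s (pointItem o p) := by
  have hc : (quadItem o q).cls = 3 := by
    simp only [quadItem, he, hn]
    cases q.east <;> cases q.north <;> decide
  rcases (covering_iff o q p).2 h with h | ⟨h, -⟩ | ⟨h, -⟩ | ⟨h, -⟩
  · exact ⟨rfl, _, hq, h⟩
  all_goals rw [hc] at h; exact absurd h (by decide)

/-- The items of an instance, in the coordinate system with the orientation `o`. -/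
noncomputable def QInstance.items (I : QInstance) (o : Bool × Bool) : Finset Item :=
  I.pts.image (pointItem o) ∪ I.quads.image (quadItem o)

theorem QInstance.mem_items {I : QInstance} {o : Bool × Bool} {i : Item} :
    i ∈ I.items o ↔ (∃ p ∈ I.pts, pointItem o p = i) ∨ ∃ q ∈ I.quads, quadItem o q = i := by
  simp [items]

theorem QInstance.exists_quad {I : QInstance} {o : Bool × Bool} {i : Item} (h : i ∈ I.items o)
    (hi : i.cls ≠ 2) : ∃ q ∈ I.quads, quadItem o q = i := by
  rcases mem_items.1 h with ⟨p, -, rfl⟩ | h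
  · exact absurd rfl hi
  · exact h

theorem QInstance.exists_point {I : QInstance} {o : Bool × Bool} {i : Item} (h : i ∈ I.items o)
    (hi : i.cls = 2) : ∃ p ∈ I.pts, pointItem o p = i := by
  rcases mem_items.1 h with h | ⟨q, -, rfl⟩
  · exact h
  · exact absurd hi (quadCls_ne_two _ _)

theorem pointItem_ne_quadItem (o : Bool × Bool) (p : Point) (q : Quadrant) :
    pointItem o p ≠ quadItem o q := fun h =>
  quadCls_ne_two _ _ (congrArg Item.cls h).symm

theorem QInstance.card_items (I : QInstance) (o : Bool × Bool) : (I.items o).card = I.size := by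
  rw [items, Finset.card_union_of_disjoint, Finset.card_image_of_injective _ (pointItem_injective o),
    Finset.card_image_of_injective _ (quadItem_injective o), size]
  rw [Finset.disjoint_left]
  intro i hi hi'
  obtain ⟨p, -, rfl⟩ := Finset.mem_image.1 hi
  obtain ⟨q, -, h⟩ := Finset.mem_image.1 hi'
  exact pointItem_ne_quadItem o p q h.symm

/-- Whether an update is an insertion. -/
def Update.ins : Update → Bool
  | .insertPoint _ => true
  | .deletePoint _ => false
  | .insertQuadrant _ => true
  | .deleteQuadrant _ => false

/-- The item that is inserted or deleted. -/
def Update.item (o : Bool × Bool) : Update → Item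
  | .insertPoint p => pointItem o p
  | .deletePoint p => pointItem o p
  | .insertQuadrant q => quadItem o q
  | .deleteQuadrant q => quadItem o q

theorem QInstance.items_apply (I : QInstance) (u : Update) (o : Bool × Bool) :
    (I.apply u).items o = RTree.modify u.ins (u.item o) (I.items o) := by
  ext i
  rw [RTree.mem_modify]
  cases u with
  | insertPoint p =>
    simp only [mem_items, QInstance.apply, Update.ins, Update.item, if_true, Finset.mem_insert,
      exists_eq_or_imp, or_assoc]
    rw [eq_comm]
  | insertQuadrant q =>
    simp only [mem_items, QInstance.apply, Update.ins, Update.item, if_true, Finset.mem_insert,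
      exists_eq_or_imp]
    rw [or_left_comm, eq_comm]
  | deletePoint p =>
    simp only [mem_items, QInstance.apply, Update.ins, Update.item, Bool.false_eq_true, if_false,
      Finset.mem_erase, and_or_left]
    refine or_congr ⟨?_, ?_⟩ ⟨?_, ?_⟩
    · rintro ⟨p', ⟨hne, hp⟩, rfl⟩
      exact ⟨fun h => hne (pointItem_injective o h), p', hp, rfl⟩
    · rintro ⟨hne, p', hp, rfl⟩
      exact ⟨p', ⟨fun h => hne (by rw [h]), hp⟩, rfl⟩
    · rintro ⟨q, hq, rfl⟩
      exact ⟨(pointItem_ne_quadItem o p q).symm, q, hq, rfl⟩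
    · exact fun h => h.2
  | deleteQuadrant q =>
    simp only [mem_items, QInstance.apply, Update.ins, Update.item, Bool.false_eq_true, if_false,
      Finset.mem_erase, and_or_left]
    refine or_congr ⟨?_, ?_⟩ ⟨?_, ?_⟩
    · rintro ⟨p, hp, rfl⟩
      exact ⟨pointItem_ne_quadItem o p q, p, hp, rfl⟩
    · exact fun h => h.2
    · rintro ⟨q', ⟨hne, hq⟩, rfl⟩
      exact ⟨fun h => hne (quadItem_injective o h), q', hq, rfl⟩
    · rintro ⟨hne, q', hq, rfl⟩
      exact ⟨q', ⟨fun h => hne (by rw [h]), hq⟩, rfl⟩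

theorem QInstance.size_apply_le (I : QInstance) (u : Update) : (I.apply u).size ≤ I.size + 1 := by
  rw [← card_items _ (true, true), ← card_items I (true, true), items_apply, RTree.modify]
  split
  · exact Finset.card_insert_le _ _
  · exact (Finset.card_le_card (Finset.erase_subset _ _)).trans (Nat.le_succ _)

theorem QInstance.size_le_apply (I : QInstance) (u : Update) : I.size ≤ (I.apply u).size + 1 := by
  rw [← card_items (I.apply u) (true, true), ← card_items I (true, true), items_apply]
  exact RTree.card_le_card_modify _ _ _

/-! ## Conversion between quadrants and items -/

theorem encNat_quadCls :
    encNat (quadCls true true) = .nil ∧ encNat (quadCls false true) = .pair .nil .nil ∧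
      encNat (quadCls true false) = .pair .nil (.pair .nil (.pair .nil .nil)) ∧
      encNat (quadCls false false) = .pair .nil (.pair .nil (.pair .nil (.pair .nil .nil))) :=
  ⟨rfl, rfl, rfl, rfl⟩

theorem output_spec (o : Bool × Bool) (q : Quadrant) :
    Fn fOutput (encItem (quadItem o q).swap) fun v τ => v = encQuadrant q ∧ τ ≤ 200 := by
  obtain ⟨e, n, x, y⟩ := q
  obtain ⟨a, b⟩ := o
  rw [fn_output]
  simp only [outputBody, encItem_swap, quadItem, encKey_keyOf, encQuadrant, run]
  cases e <;> cases n <;> cases a <;> cases b <;>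
    simp only [encNat_quadCls, beq_self_eq_true, Bool.true_beq, Bool.false_beq, Bool.not_true,
      Bool.not_false, encBool_true, encBool_false, run] <;>
    exact ⟨trivial, by omega⟩

/-- The quadrant given by an item. -/
noncomputable def itemQuad (o : Bool × Bool) : Item → Quadrant :=
  haveI : Nonempty Quadrant := ⟨⟨true, true, 0, 0⟩⟩
  Function.invFun (quadItem o)

@[simp] theorem itemQuad_quadItem (o : Bool × Bool) (q : Quadrant) :
    itemQuad o (quadItem o q) = q :=
  haveI : Nonempty Quadrant := ⟨q⟩
  Function.leftInverse_invFun (quadItem_injective o) q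

theorem decodes_items (I : QInstance) (o : Bool × Bool) : Decodes (I.items o) (itemQuad o) := by
  intro i hi h2
  obtain ⟨q, -, rfl⟩ := I.exists_quad hi h2
  rw [itemQuad_quadItem]
  exact output_spec o q

theorem quadItem_spec (o : Bool × Bool) (q : Quadrant) :
    Fn fQuadItem (.pair (.pair (encBool o.1) (encBool o.2)) (encQuadrant q)) fun v τ =>
      v = encItem (quadItem o q) ∧ τ ≤ 200 := by
  obtain ⟨e, n, x, y⟩ := q
  obtain ⟨a, b⟩ := o
  rw [fn_quadItem]
  simp only [quadItemBody, encItem, quadItem, encKey_keyOf, encQuadrant, run]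
  cases e <;> cases n <;> cases a <;> cases b <;>
    simp only [encNat_quadCls, beq_self_eq_true, Bool.true_beq, Bool.false_beq, Bool.not_true,
      Bool.not_false, encBool_true, encBool_false, run] <;>
    exact ⟨trivial, by omega⟩

/-! ## The data structure -/

namespace RTree

theorem updateOne_spec {R : ℕ → ℕ} {t : RTree} {u : Update} {o : Bool × Bool} {w g : ℕ}
    (h : CanUpdate R t (u.item o) w g) :
    Fn fUpdateOne (.pair (.pair (encBool o.1) (encBool o.2)) (.pair (encUpdate u) t.enc)) fun v τ =>
      ∃ t' : RTree, v = t'.enc ∧ t'.items = modify u.ins (u.item o) t.items ∧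
        t'.Inv (2 * t'.items.card + 1) ∧ τ + t'.phi R ≤ t.phi R + g + 500 := by
  have hp : ∀ p : Point, encItem (pointItem o p) = .pair (.pair (encBool o.2) (.real p.2))
      (.pair (.pair .nil (.pair .nil .nil)) (.pair (encBool o.1) (.real p.1))) := fun p => by
    rw [encItem, pointItem, encKey_keyOf, encKey_keyOf]
    rfl
  have h := h u.ins
  rw [fn_updateOne]
  cases u with
  | insertPoint p =>
    simp only [updateOneBody, encUpdate, encPoint, encBool_true, encBool_false, run]
    simp only [Update.ins, Update.item, hp, encBool_true] at h
    refine h.mono ?_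
    rintro _ t1 ⟨t', rfl, h1, h2, -, h3⟩
    exact ⟨t', rfl, h2, h1.tight, by omega⟩
  | deletePoint p =>
    simp only [updateOneBody, encUpdate, encPoint, encBool_true, encBool_false, run]
    simp only [Update.ins, Update.item, hp, encBool_false] at h
    refine h.mono ?_
    rintro _ t1 ⟨t', rfl, h1, h2, -, h3⟩
    exact ⟨t', rfl, h2, h1.tight, by omega⟩
  | insertQuadrant q =>
    simp only [updateOneBody, encUpdate, encBool_true, encBool_false, run]
    refine (quadItem_spec o q).mono ?_
    rintro _ t0 ⟨rfl, h0⟩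
    simp only [Update.ins, Update.item, encBool_true] at h
    refine h.mono ?_
    rintro _ t1 ⟨t', rfl, h1, h2, -, h3⟩
    exact ⟨t', rfl, h2, h1.tight, by omega⟩
  | deleteQuadrant q =>
    simp only [updateOneBody, encUpdate, encBool_true, encBool_false, run]
    refine (quadItem_spec o q).mono ?_
    rintro _ t0 ⟨rfl, h0⟩
    simp only [Update.ins, Update.item, encBool_false] at h
    refine h.mono ?_
    rintro _ t1 ⟨t', rfl, h1, h2, -, h3⟩
    exact ⟨t', rfl, h2, h1.tight, by omega⟩

end RTree

/-- Trees for the four orientations. -/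
abbrev Forest : Type := Bool × Bool → RTree

namespace Forest

noncomputable def enc (D : Forest) : Val :=
  .pair (D (true, true)).enc (.pair (D (true, false)).enc
    (.pair (D (false, true)).enc (D (false, false)).enc))

def phi (R : ℕ → ℕ) (D : Forest) : ℕ :=
  (D (true, true)).phi R + (D (true, false)).phi R + (D (false, true)).phi R +
    (D (false, false)).phi R

/-- The trees store the instance `I`. -/
structure Holds (D : Forest) (I : QInstance) : Prop where
  items_eq : ∀ o, (D o).items = I.items o
  inv : ∀ o, (D o).Inv (2 * I.size + 1)

/-- A forest from its trees. -/
def mk (a b c d : RTree) : Forest := fun o =>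
  if o.1 then if o.2 then a else b else if o.2 then c else d

end Forest

/-- Updates of trees with at most `W` items take amortized time `C (lg W) ^ 6`. -/
def UpdateBound (R : ℕ → ℕ) (C : ℕ) : Prop :=
  ∀ (W : ℕ) (t : RTree) (i : Item), t.Inv (2 * t.items.card + 1) → t.items.card ≤ W →
    t.CanUpdate R i (2 * t.items.card + 1) (C * lg W ^ 6)

section

variable {R : ℕ → ℕ} {C : ℕ}

theorem updateAll_spec (hU : UpdateBound R C) {D : Forest} {I : QInstance} (hD : D.Holds I) {W : ℕ}
    (hW : I.size ≤ W) (u : Update) :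
    Fn fUpdateAll (.pair D.enc (encUpdate u)) fun v τ => ∃ D' : Forest, v = D'.enc ∧
      D'.Holds (I.apply u) ∧ τ + D'.phi R ≤ D.phi R + (4 * C + 3000) * lg W ^ 6 := by
  have hcard : ∀ o, (D o).items.card = I.size := fun o => by rw [hD.items_eq, I.card_items]
  have key : ∀ o, Fn fUpdateOne (.pair (.pair (encBool o.1) (encBool o.2))
      (.pair (encUpdate u) (D o).enc)) fun v τ => ∃ t' : RTree, v = t'.enc ∧
        t'.items = (I.apply u).items o ∧ t'.Inv (2 * (I.apply u).size + 1) ∧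
          τ + t'.phi R ≤ (D o).phi R + C * lg W ^ 6 + 500 := by
    intro o
    refine (RTree.updateOne_spec (hU W (D o) (u.item o) (by rw [hcard]; exact hD.inv o)
      (by rw [hcard]; exact hW))).mono ?_
    rintro _ τ ⟨t', rfl, h1, h2, h3⟩
    have h4 : t'.items = (I.apply u).items o := by rw [h1, hD.items_eq, I.items_apply]
    rw [h4, QInstance.card_items] at h2
    exact ⟨t', rfl, h4, h2, h3⟩
  have k1 := key (true, true)
  have k2 := key (true, false)
  have k3 := key (false, true)
  have k4 := key (false, false)
  simp only [encBool_true, encBool_false] at k1 k2 k3 k4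
  rw [fn_updateAll]
  simp only [updateAllBody, Forest.enc, run]
  refine k1.mono ?_
  rintro _ t1 ⟨a, rfl, a1, a2, a3⟩
  refine k2.mono ?_
  rintro _ t2 ⟨b, rfl, b1, b2, b3⟩
  refine k3.mono ?_
  rintro _ t3 ⟨c, rfl, c1, c2, c3⟩
  refine k4.mono ?_
  rintro _ t4 ⟨d, rfl, d1, d2, d3⟩
  have := RTree.le_mul_lg_pow 3000 W 6
  refine ⟨Forest.mk a b c d, rfl, ⟨?_, ?_⟩, ?_⟩
  · rintro ⟨_ | _, _ | _⟩ <;> assumption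
  · rintro ⟨_ | _, _ | _⟩ <;> assumption
  · change _ + (a.phi R + b.phi R + c.phi R + d.phi R) ≤ _
    have hphi : D.phi R = (D (true, true)).phi R + (D (true, false)).phi R +
      (D (false, true)).phi R + (D (false, false)).phi R := rfl
    have hring : (4 * C + 3000) * lg W ^ 6 = 4 * (C * lg W ^ 6) + 3000 * lg W ^ 6 := by ring
    omega

theorem insertList_spec (hU : UpdateBound R C) {α : Type} (mk : α → Update) (f : α → Val) (k : Bool)
    (hf : ∀ a, encUpdate (mk a) = .pair (encBool true) (.pair (encBool k) (f a))) (l : List α)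
    {D : Forest} {I : QInstance} (hD : D.Holds I) {W : ℕ} (hW : I.size + l.length ≤ W) :
    Fn fInsertList (.pair (.pair (encBool k) (encList f l)) D.enc) fun v τ =>
      ∃ D' : Forest, v = D'.enc ∧ D'.Holds ((l.map mk).foldl QInstance.apply I) ∧
        τ + D'.phi R ≤ D.phi R + (l.length + 1) * ((4 * C + 4000) * lg W ^ 6) := by
  have hring : (4 * C + 4000) * lg W ^ 6 = (4 * C + 3000) * lg W ^ 6 + 1000 * lg W ^ 6 := by ring
  have hlg := RTree.le_mul_lg_pow 1000 W 6
  induction l generalizing D I with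
  | nil =>
    rw [fn_insertList]
    simp only [insertListBody, run, RTree.encList_nil]
    exact ⟨D, rfl, hD, by simp; omega⟩
  | cons a l ih =>
    rw [List.length_cons] at hW ⊢
    have h1 := updateAll_spec hU hD (by omega : I.size ≤ W) (mk a)
    rw [hf, encBool_true] at h1
    rw [fn_insertList]
    simp only [insertListBody, run, RTree.encList_cons]
    refine h1.mono ?_
    rintro _ t1 ⟨D₁, rfl, h2, h3⟩
    have h4 := I.size_apply_le (mk a)
    refine (ih h2 (by omega)).mono ?_
    rintro _ t2 ⟨D₂, rfl, h5, h6⟩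
    refine ⟨D₂, rfl, h5, ?_⟩
    have : (l.length + 1 + 1) * ((4 * C + 4000) * lg W ^ 6) =
      (l.length + 1) * ((4 * C + 4000) * lg W ^ 6) + (4 * C + 4000) * lg W ^ 6 := by ring
    omega

/-- The list may contain repetitions, but all its members are in `Q`. So the tree never exceeds
`Q.card` items, and each insertion is polylogarithmic in the size of the instance. -/
theorem insertOutputs_spec (hU : UpdateBound R C) {W : ℕ} (Q : Finset Quadrant) (hQ : Q.card ≤ W)
    (l : List Quadrant) (hl : ∀ q ∈ l, q ∈ Q) {t : RTree} {I : QInstance} (hI : I.quads ⊆ Q)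
    (hp : I.pts = ∅) (ht : t.items = I.items (true, true)) (hinv : t.Inv (2 * I.size + 1)) :
    Fn fInsertOutputs (.pair (encList encQuadrant l) t.enc) fun v τ =>
      ∃ t' : RTree, v = t'.enc ∧
        t'.items = ((l.map Update.insertQuadrant).foldl QInstance.apply I).items (true, true) ∧
        t'.Inv (2 * t'.items.card + 1) ∧ t'.items.card ≤ W ∧
        τ + t'.phi R ≤ t.phi R + (l.length + 1) * ((C + 2000) * lg W ^ 6) := by
  have hring : (C + 2000) * lg W ^ 6 = C * lg W ^ 6 + 2000 * lg W ^ 6 := by ring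
  have hlg := RTree.le_mul_lg_pow 2000 W 6
  have hsize : ∀ J : QInstance, J.pts = ∅ → J.quads ⊆ Q → J.size ≤ W := fun J h1 h2 => by
    rw [QInstance.size, h1, Finset.card_empty, zero_add]
    exact (Finset.card_le_card h2).trans hQ
  induction l generalizing t I with
  | nil =>
    rw [fn_insertOutputs]
    simp only [insertOutputsBody, run, RTree.encList_nil]
    refine ⟨t, rfl, ht, ?_, ?_, by simp; omega⟩
    · rw [ht, I.card_items]; exact hinv
    · rw [ht, I.card_items]; exact hsize I hp hI
  | cons q l ih =>
    have hcard : t.items.card = I.size := by rw [ht, I.card_items]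
    have h1 := RTree.updateOne_spec (o := (true, true)) (hU W t ((Update.insertQuadrant q).item (true, true))
      (by rw [hcard]; exact hinv) (by rw [hcard]; exact hsize I hp hI))
    rw [ht, ← I.items_apply] at h1
    simp only [encUpdate, encBool_true] at h1
    rw [fn_insertOutputs]
    simp only [insertOutputsBody, run, RTree.encList_cons]
    refine h1.mono ?_
    rintro _ t1 ⟨t', rfl, h2, h3, h4⟩
    rw [h2, QInstance.card_items] at h3
    have hsub : (I.apply (.insertQuadrant q)).quads ⊆ Q := by
      intro q' hq'
      simp only [QInstance.apply, Finset.mem_insert] at hq'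
      rcases hq' with rfl | hq'
      · exact hl _ (by simp)
      · exact hI hq'
    refine (ih (fun q' hq' => hl q' (by simp [hq'])) hsub hp h2 h3).mono ?_
    rintro _ t2 ⟨t'', rfl, h5, h6, h7, h8⟩
    refine ⟨t'', rfl, h5, h6, h7, ?_⟩
    have : ((q :: l).length + 1) * ((C + 2000) * lg W ^ 6) =
      (l.length + 1) * ((C + 2000) * lg W ^ 6) + (C + 2000) * lg W ^ 6 := by
      rw [List.length_cons]; ring
    omega

open Classical in
theorem foldl_insertPoint (ps : List Point) (I : QInstance) :
    (ps.map Update.insertPoint).foldl QInstance.apply I =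
      ⟨(QInstance.ofLists ps []).pts ∪ I.pts, I.quads⟩ := by
  induction ps generalizing I with
  | nil => simp [QInstance.ofLists]
  | cons p ps ih =>
    rw [List.map_cons, List.foldl_cons, ih]
    simp only [QInstance.apply, QInstance.ofLists, QInstance.mk.injEq, and_true]
    ext x
    simp [or_left_comm, or_assoc]

open Classical in
theorem foldl_insertQuadrant (qs : List Quadrant) (I : QInstance) :
    (qs.map Update.insertQuadrant).foldl QInstance.apply I =
      ⟨I.pts, (QInstance.ofLists [] qs).quads ∪ I.quads⟩ := by
  induction qs generalizing I with
  | nil => simp [QInstance.ofLists]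
  | cons p ps ih =>
    rw [List.map_cons, List.foldl_cons, ih]
    simp only [QInstance.apply, QInstance.ofLists, QInstance.mk.injEq, true_and]
    ext x
    simp [or_left_comm, or_assoc]

open Classical in
theorem foldl_insert (ps : List Point) (qs : List Quadrant) :
    (qs.map Update.insertQuadrant).foldl QInstance.apply
      ((ps.map Update.insertPoint).foldl QInstance.apply ⟨∅, ∅⟩) = QInstance.ofLists ps qs := by
  rw [foldl_insertPoint, foldl_insertQuadrant]
  simp [QInstance.ofLists]

open Classical in
-- `D.phi R = 0` matters: the bound for the later updates has no additive term that could absorb an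
-- initial potential.
theorem buildAll_spec (hU : UpdateBound R C) {A : ℕ}
    (hA : RTree.CanBuild (fun _ => True) fun n => A * (lg n ^ 4 * (n + 1)))
    (ps : List Point) (qs : List Quadrant) :
    Fn fBuildAll (.pair (encList encPoint ps) (encList encQuadrant qs)) fun v τ =>
      ∃ D : Forest, v = D.enc ∧ D.Holds (QInstance.ofLists ps qs) ∧ D.phi R = 0 ∧
        τ ≤ (8 * C + 4 * A + 20000) *
          ((ps.length + qs.length + 1) * lg (ps.length + qs.length) ^ 6) := by
  set n := ps.length + qs.length with hn
  have hI₀ : ∀ o, (⟨∅, ∅⟩ : QInstance).items o = ∅ := fun o => by simp [QInstance.items]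
  have h0 : Forest.Holds (fun _ => RTree.nil) ⟨∅, ∅⟩ :=
    ⟨fun o => by rw [hI₀]; rfl, fun o => Nat.le_add_left _ _⟩
  have hps := insertList_spec hU Update.insertPoint encPoint false (fun _ => rfl) ps h0 (W := n)
    (by simp [QInstance.size]; omega)
  rw [fn_buildAll]
  simp only [buildAllBody, run]
  simp only [encBool_false, Forest.enc, RTree.enc_nil] at hps
  refine hps.mono ?_
  rintro _ t1 ⟨D₁, rfl, h1, h2⟩
  have hsize : ((ps.map Update.insertPoint).foldl QInstance.apply ⟨∅, ∅⟩).size ≤ ps.length := by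
    rw [foldl_insertPoint]
    simp only [QInstance.size, QInstance.ofLists, Finset.union_empty, Finset.card_empty, add_zero]
    exact List.toFinset_card_le _
  have hqs := insertList_spec hU Update.insertQuadrant encQuadrant true (fun _ => rfl) qs h1 (W := n)
    (by omega)
  rw [foldl_insert] at hqs
  simp only [encBool_true, Forest.enc] at hqs
  refine hqs.mono ?_
  rintro _ t2 ⟨D, rfl, h3, h4⟩
  have hcard : (QInstance.ofLists ps qs).size ≤ n :=
    Nat.add_le_add (List.toFinset_card_le _) (List.toFinset_card_le _)
  have hb : ∀ o, Fn fFlatten (.pair (D o).enc .nil) fun v τ => Fn fBuild v fun v τ' => ∃ t : RTree,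
      v = t.enc ∧ t.items = (QInstance.ofLists ps qs).items o ∧
        t.Inv (2 * (QInstance.ofLists ps qs).size + 1) ∧ t.phi R = 0 ∧
          τ + τ' ≤ (A + 360) * (lg n ^ 6 * (n + 1)) := by
    intro o
    have hc : (D o).toList.length = (QInstance.ofLists ps qs).size := by
      rw [← RTree.card_toFinset_of_sorted (h3.inv o).sorted, RTree.toFinset_toList, h3.items_eq,
        QInstance.card_items]
    refine ((D o).flatten_spec []).mono ?_
    rintro _ τ ⟨rfl, h5⟩
    rw [List.append_nil]
    refine (hA _ (h3.inv o).sorted fun _ _ => trivial).mono ?_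
    rintro _ τ' ⟨t, rfl, h6, h7⟩
    have h8 : t.items = (QInstance.ofLists ps qs).items o := by
      rw [h6.items_eq, RTree.toFinset_toList, h3.items_eq]
    have h9 := h6.inv.tight
    rw [h8, QInstance.card_items] at h9
    refine ⟨t, rfl, h8, h9, h6.phi_eq R, ?_⟩
    have h10 := (h3.inv o).slots_le
    beta_reduce at h7
    rw [hc] at h7
    have h11 : A * (lg (QInstance.ofLists ps qs).size ^ 4 * ((QInstance.ofLists ps qs).size + 1)) ≤
        A * (lg n ^ 6 * (n + 1)) := by
      have := (Nat.pow_le_pow_left (RTree.lg_mono hcard) 4).trans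
        (RTree.lg_pow_le (by norm_num : 4 ≤ 6) n)
      gcongr
    have h12 : n + 1 ≤ lg n ^ 6 * (n + 1) := Nat.le_mul_of_pos_left _ (pow_pos (RTree.one_le_lg n) _)
    calc τ + τ' ≤ 360 * (n + 1) + A * (lg n ^ 6 * (n + 1)) := by omega
      _ ≤ 360 * (lg n ^ 6 * (n + 1)) + A * (lg n ^ 6 * (n + 1)) := by omega
      _ = _ := by ring
  simp only [Forest.enc, run]
  refine (hb (true, true)).mono ?_
  rintro x1 u1 h5
  refine h5.mono ?_
  rintro _ v1 ⟨a, rfl, a1, a2, a3, a4⟩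
  refine (hb (true, false)).mono ?_
  rintro x2 u2 h5
  refine h5.mono ?_
  rintro _ v2 ⟨b, rfl, b1, b2, b3, b4⟩
  refine (hb (false, true)).mono ?_
  rintro x3 u3 h5
  refine h5.mono ?_
  rintro _ v3 ⟨c, rfl, c1, c2, c3, c4⟩
  refine (hb (false, false)).mono ?_
  rintro x4 u4 h5
  refine h5.mono ?_
  rintro _ v4 ⟨d, rfl, d1, d2, d3, d4⟩
  refine ⟨Forest.mk a b c d, rfl, ⟨?_, ?_⟩, ?_, ?_⟩
  · rintro ⟨_ | _, _ | _⟩ <;> assumption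
  · rintro ⟨_ | _, _ | _⟩ <;> assumption
  · change a.phi R + b.phi R + c.phi R + d.phi R = 0
    omega
  · have hphi : Forest.phi R (fun _ => RTree.nil) = 0 := rfl
    rw [hphi] at h2
    have e1 : (ps.length + 1) * ((4 * C + 4000) * lg n ^ 6) ≤
        (4 * C + 4000) * (lg n ^ 6 * (n + 1)) := by
      calc _ ≤ (n + 1) * ((4 * C + 4000) * lg n ^ 6) := by gcongr; omega
        _ = _ := by ring
    have e2 : (qs.length + 1) * ((4 * C + 4000) * lg n ^ 6) ≤
        (4 * C + 4000) * (lg n ^ 6 * (n + 1)) := by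
      calc _ ≤ (n + 1) * ((4 * C + 4000) * lg n ^ 6) := by gcongr; omega
        _ = _ := by ring
    have e3 : 1 ≤ lg n ^ 6 * (n + 1) := Nat.mul_pos (pow_pos (RTree.one_le_lg n) _) (by omega)
    have e4 : (8 * C + 4 * A + 20000) * ((n + 1) * lg n ^ 6) =
      2 * ((4 * C + 4000) * (lg n ^ 6 * (n + 1))) + 4 * ((A + 360) * (lg n ^ 6 * (n + 1))) +
        10560 * (lg n ^ 6 * (n + 1)) := by ring
    omega

end

/-! ## The output-sensitive algorithm -/

section

variable {R : ℕ → ℕ} {C : ℕ}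

/-- The potential telescopes. The size before an update exceeds the size after it by at most one,
and passing to the latter costs the factor `3 ^ 6 = 729`. -/
theorem exists_updateRun (hU : UpdateBound R C) (us : List Update) {D : Forest} {I : QInstance}
    (hD : D.Holds I) : ∃ (D' : Forest) (t : ℕ), UpdateRun prog fUpdateAll D.enc us D'.enc t ∧
      D'.Holds (us.foldl QInstance.apply I) ∧
        t + D'.phi R ≤ D.phi R + (729 * (4 * C + 3000) + 2) * sumLg 6 I us := by
  induction us generalizing D I with
  | nil => exact ⟨D, 0, .nil _, hD, by simp [sumLg]⟩
  | cons u us ih =>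
    obtain ⟨_, t₁, h1, D₁, rfl, h2, h3⟩ :=
      (updateAll_spec hU hD (I.size_le_apply u) u).runs
    obtain ⟨D₂, t₂, h4, h5, h6⟩ := ih h2
    refine ⟨D₂, _, .cons h1 h4, h5, ?_⟩
    rw [sumLg]
    have h7 : lg ((I.apply u).size + 1) ^ 6 ≤ 729 * lg (I.apply u).size ^ 6 := by
      calc _ ≤ (3 * lg (I.apply u).size) ^ 6 :=
            Nat.pow_le_pow_left (RTree.lg_le_of_le (by omega)) 6
        _ = _ := by ring
    have h8 : (4 * C + 3000) * lg ((I.apply u).size + 1) ^ 6 ≤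
        (4 * C + 3000) * (729 * lg (I.apply u).size ^ 6) := Nat.mul_le_mul_left _ h7
    have h9 := RTree.le_mul_lg_pow 2 (I.apply u).size 6
    have h10 : (729 * (4 * C + 3000) + 2) * (lg (I.apply u).size ^ 6 + sumLg 6 (I.apply u) us) =
      (4 * C + 3000) * (729 * lg (I.apply u).size ^ 6) + 2 * lg (I.apply u).size ^ 6 +
        (729 * (4 * C + 3000) + 2) * sumLg 6 (I.apply u) us := by ring
    omega

/-- Points in southeast quadrants are coverable, so a cover of the coverable points is a valid
comparison family in every orientation, even if the instance has no set cover. -/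
theorem covering_quadItem {I : QInstance} {C₀ : Finset Quadrant}
    (hC : Covers (C₀ : Set Quadrant) I.coverable) (o : Bool × Bool) :
    ∀ p ∈ coveredSE (I.items o), ∃ q ∈ C₀.image (quadItem o), Covering q p := by
  intro i hi
  obtain ⟨hi, h2, j, hj, h3, hij⟩ := mem_coveredSE.1 hi
  obtain ⟨p, hp, rfl⟩ := I.exists_point hi h2
  obtain ⟨q, hq, rfl⟩ := I.exists_quad hj (by rw [h3]; decide)
  obtain ⟨q', hq', hpq⟩ := hC p ⟨hp, q, hq, (covering_iff o q p).1 (.inl ⟨h3, hij⟩)⟩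
  exact ⟨_, Finset.mem_image_of_mem _ hq', (covering_iff o q' p).2 hpq⟩

theorem greedy_items_spec {D : Forest} {I : QInstance} (hD : D.Holds I) {C₀ : Finset Quadrant}
    (hC₀ : C₀ ⊆ I.quads) (hC : Covers (C₀ : Set Quadrant) I.coverable) (o : Bool × Bool)
    (acc : List Quadrant) :
    Fn fGreedy (.pair (D o).enc (encList encQuadrant acc)) fun v τ =>
      ∃ l : List Quadrant, v = encList encQuadrant (l ++ acc) ∧ (∀ q ∈ l, q ∈ I.quads) ∧
        (∀ p ∈ I.pts, SECovered (I.items o) (pointItem o p) → ∃ q ∈ l, p ∈ q.region) ∧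
        l.length ≤ 5 * C₀.card ∧ τ ≤ (C₀.card + 1) * (80000000 * lg I.size ^ 2) := by
  have ho : C₀.image (quadItem o) ⊆ (D o).items := by
    rw [hD.items_eq]
    exact (Finset.image_subset_image hC₀).trans Finset.subset_union_right
  have hcov := covering_quadItem hC o
  have hdec := decodes_items I o
  rw [← hD.items_eq] at hcov hdec
  refine (RTree.greedy_spec (hD.inv o) ho hcov hdec acc).mono ?_
  rintro _ τ ⟨l, rfl, h1, h2, h3, h4⟩
  have hcard : (C₀.image (quadItem o)).card ≤ C₀.card := Finset.card_image_le
  have hl : ∀ i ∈ l, ∃ q ∈ I.quads, quadItem o q = i := fun i hi => by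
    have := h1 i hi
    rw [hD.items_eq] at this
    exact I.exists_quad this.1 this.2
  refine ⟨l.map (itemQuad o), rfl, fun q hq => ?_, fun p hp hse => ?_, ?_, ?_⟩
  · obtain ⟨i, hi, rfl⟩ := List.mem_map.1 hq
    obtain ⟨q, hq, rfl⟩ := hl i hi
    rwa [itemQuad_quadItem]
  · rw [hD.items_eq] at h2
    obtain ⟨i, hi, hip⟩ := h2 _ (mem_coveredSE.2 ⟨QInstance.mem_items.2 (.inl ⟨p, hp, rfl⟩), hse⟩)
    obtain ⟨q, hq, rfl⟩ := hl i hi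
    refine ⟨q, List.mem_map.2 ⟨_, hi, itemQuad_quadItem o q⟩, (covering_iff o q p).1 hip⟩
  · rw [List.length_map]; omega
  · have h5 := RTree.lg_two_mul_le I.size
    calc τ ≤ (C₀.card + 1) * (20000000 * (2 * lg I.size) ^ 2) := h4.trans (by gcongr)
      _ = _ := by ring

open Classical in
theorem coversAbove_iff {I : QInstance} {l : List Quadrant} (hl : ∀ q ∈ l, q ∈ I.quads)
    (hc : Covers {q | q ∈ l} I.coverable) {J : QInstance} (hJ : J.quads = l.toFinset)
    (hJ' : J.pts = ∅) :
    RTree.CoversAbove (I.items (true, true)) (J.items (true, true)) ⊥ ↔ I.HasCover := by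
  constructor
  · intro h p hp
    obtain ⟨j, hj, hjp⟩ := h (pointItem (true, true) p) (QInstance.mem_items.2 (.inl ⟨p, hp, rfl⟩))
      rfl (WithBot.bot_lt_coe _)
    rcases QInstance.mem_items.1 hj with ⟨x, hx, -⟩ | ⟨q, hq, rfl⟩
    · rw [hJ'] at hx; simp at hx
    · rw [hJ, List.mem_toFinset] at hq
      exact ⟨q, hl q hq, (covering_iff _ _ _).1 hjp⟩
  · intro h x hx hx2 _
    obtain ⟨p, hp, rfl⟩ := I.exists_point hx hx2
    obtain ⟨q, hq, hpq⟩ := h p hp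
    obtain ⟨q', hq', hpq'⟩ := hc p ⟨hp, q, hq, hpq⟩
    refine ⟨_, QInstance.mem_items.2 (.inr ⟨q', ?_, rfl⟩), (covering_iff _ _ _).2 hpq'⟩
    rw [hJ, List.mem_toFinset]
    exact hq'

open Classical in
-- `C₀` is an arbitrary cover of the coverable points that the program does not know. As the greedy
-- outputs cover all coverable points, testing whether they cover all points decides `HasCover`.
theorem solve_spec (hU : UpdateBound R C) {D : Forest} {I : QInstance} (hD : D.Holds I)
    {C₀ : Finset Quadrant} (hC₀ : C₀ ⊆ I.quads) (hC : Covers (C₀ : Set Quadrant) I.coverable) :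
    Fn fSolve D.enc fun v τ => ∃ l : List Quadrant,
      v = (if I.HasCover then encAnswer (some l) else encAnswer none) ∧
      (∀ q ∈ l, q ∈ I.quads) ∧ Covers {q | q ∈ l} I.coverable ∧ l.length ≤ 20 * C₀.card ∧
      τ ≤ (20 * C + 4000000000) * ((C₀.card + 1) * lg I.size ^ 6) := by
  rw [fn_solve]
  simp only [solveBody, Forest.enc, run]
  refine (greedy_items_spec hD hC₀ hC (true, true) []).mono ?_
  rintro _ t1 ⟨l₁, rfl, a1, b1, c1, d1⟩
  refine (greedy_items_spec hD hC₀ hC (true, false) _).mono ?_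
  rintro _ t2 ⟨l₂, rfl, a2, b2, c2, d2⟩
  refine (greedy_items_spec hD hC₀ hC (false, true) _).mono ?_
  rintro _ t3 ⟨l₃, rfl, a3, b3, c3, d3⟩
  refine (greedy_items_spec hD hC₀ hC (false, false) _).mono ?_
  rintro _ t4 ⟨l₄, rfl, a4, b4, c4, d4⟩
  rw [List.append_nil]
  set l := l₄ ++ (l₃ ++ (l₂ ++ l₁)) with hl
  have hmem : ∀ q ∈ l, q ∈ I.quads := by
    intro q hq
    simp only [hl, List.mem_append] at hq
    rcases hq with hq | hq | hq | hq
    exacts [a4 q hq, a3 q hq, a2 q hq, a1 q hq]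
  have hcov : Covers {q | q ∈ l} I.coverable := by
    rintro p ⟨hp, q, hq, hpq⟩
    have hse : ∀ o : Bool × Bool, o.1 = q.east → o.2 = !q.north →
        SECovered (I.items o) (pointItem o p) := fun o h1 h2 =>
      secovered_pointItem (QInstance.mem_items.2 (.inr ⟨q, hq, rfl⟩)) h1 h2 hpq
    simp only [hl, Set.mem_ofPred_eq, List.mem_append]
    -- A quadrant is handled by the run whose orientation makes it southeast: same horizontal bit,
    -- opposite vertical bit.
    cases he : q.east <;> cases hn : q.north
    · obtain ⟨q', h, h'⟩ := b3 p hp (hse _ he.symm (by rw [hn]; rfl))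
      exact ⟨q', .inr (.inl h), h'⟩
    · obtain ⟨q', h, h'⟩ := b4 p hp (hse _ he.symm (by rw [hn]; rfl))
      exact ⟨q', .inl h, h'⟩
    · obtain ⟨q', h, h'⟩ := b1 p hp (hse _ he.symm (by rw [hn]; rfl))
      exact ⟨q', .inr (.inr (.inr h)), h'⟩
    · obtain ⟨q', h, h'⟩ := b2 p hp (hse _ he.symm (by rw [hn]; rfl))
      exact ⟨q', .inr (.inr (.inl h)), h'⟩
  have hlen : l.length ≤ 20 * C₀.card := by
    simp only [hl, List.length_append]
    omega
  have hout := insertOutputs_spec hU (W := I.size) I.quads (Nat.le_add_left _ _) l hmem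
    (t := .nil) (I := ⟨∅, ∅⟩) (by simp) rfl (by simp [QInstance.items, RTree.items])
    (Nat.le_add_left _ _)
  rw [foldl_insertQuadrant] at hout
  refine hout.mono ?_
  rintro _ t5 ⟨u, rfl, h1, h2, h3, h4⟩
  have hu2 : ∀ i ∈ u.items, i.cls ≠ 2 := by
    intro i hi
    rw [h1] at hi
    rcases QInstance.mem_items.1 hi with ⟨p, hp, -⟩ | ⟨q, -, rfl⟩
    · simp at hp
    · exact quadCls_ne_two _ _
  have hucard : u.items.card ≤ l.length := by
    rw [h1, QInstance.card_items]
    simp only [QInstance.size, QInstance.ofLists, Finset.union_empty, Finset.card_empty, zero_add]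
    exact List.toFinset_card_le _
  refine (RTree.gaps_spec (hD.inv (true, true)) (h2.mono (by omega)) hu2 l.length ⊥
    ((Finset.card_le_card (Finset.filter_subset _ _)).trans hucard)).mono ?_
  rintro _ t6 ⟨rfl, h6⟩
  rw [hD.items_eq, h1]
  have hiff := coversAbove_iff hmem hcov
    (J := ⟨∅, (QInstance.ofLists [] l).quads ∪ ∅⟩) (by simp [QInstance.ofLists]) rfl
  have htime : ∀ s, s ≤ t1 + t2 + t3 + t4 + t5 + t6 + 1000 →
      s ≤ (20 * C + 4000000000) * ((C₀.card + 1) * lg I.size ^ 6) := by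
    intro s hs
    have e1 : (C₀.card + 1) * (80000000 * lg I.size ^ 2) ≤
        80000000 * ((C₀.card + 1) * lg I.size ^ 6) := by
      have := RTree.lg_pow_le (by norm_num : 2 ≤ 6) I.size
      calc _ = 80000000 * ((C₀.card + 1) * lg I.size ^ 2) := by ring
        _ ≤ _ := by gcongr
    have e2 : t5 ≤ 20 * C * ((C₀.card + 1) * lg I.size ^ 6) +
        40000 * ((C₀.card + 1) * lg I.size ^ 6) := by
      have : RTree.nil.phi R = 0 := rfl
      calc t5 ≤ (l.length + 1) * ((C + 2000) * lg I.size ^ 6) := by omega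
        _ ≤ (20 * (C₀.card + 1)) * ((C + 2000) * lg I.size ^ 6) := by gcongr; omega
        _ = _ := by ring
    have e3 : t6 ≤ 2400000000 * ((C₀.card + 1) * lg I.size ^ 6) := by
      have h7 := RTree.lg_two_mul_le I.size
      have := RTree.lg_pow_le (by norm_num : 2 ≤ 6) I.size
      calc t6 ≤ (20 * (C₀.card + 1)) * (30000000 * (2 * lg I.size) ^ 2) :=
            h6.trans (by gcongr; omega)
        _ = 2400000000 * ((C₀.card + 1) * lg I.size ^ 2) := by ring
        _ ≤ _ := by gcongr
    have e4 : 1 ≤ (C₀.card + 1) * lg I.size ^ 6 :=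
      Nat.mul_pos (by omega) (pow_pos (RTree.one_le_lg _) _)
    have e5 : (20 * C + 4000000000) * ((C₀.card + 1) * lg I.size ^ 6) =
      20 * C * ((C₀.card + 1) * lg I.size ^ 6) +
        4000000000 * ((C₀.card + 1) * lg I.size ^ 6) := by ring
    omega
  simp only [decide_cases, hiff]
  constructor <;> intro hcase
  · refine ⟨l, by rw [if_pos hcase]; rfl, hmem, hcov, hlen, htime _ (by omega)⟩
  · refine ⟨l, by rw [if_neg hcase]; rfl, hmem, hcov, hlen, htime _ (by omega)⟩

end

theorem exists_opt (I : QInstance) : ∃ C₀ : Finset Quadrant, C₀ ⊆ I.quads ∧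
    Covers (C₀ : Set Quadrant) I.coverable ∧ C₀.card = opt I.coverable I.quads := by
  refine Nat.sInf_mem (s := {m | ∃ C : Finset Quadrant, C ⊆ I.quads ∧
    Covers (C : Set Quadrant) I.coverable ∧ C.card = m}) ⟨_, I.quads, subset_rfl, ?_, rfl⟩
  rintro p ⟨-, q, hq, hpq⟩
  exact ⟨q, hq, hpq⟩

theorem coverable_eq {I : QInstance} (h : I.HasCover) : I.coverable = I.pts := by
  ext p
  exact ⟨fun hp => hp.1, fun hp => ⟨hp, h p hp⟩⟩

theorem mainTheorem5 :
    ∃ (c : ℕ) (P : Program) (build upd solve : ℕ),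
      IsBasicDataStructure P build upd ∧ IsOutputSensitive P build upd solve c := by
  obtain ⟨A, C, R, hA, hU⟩ := RTree.exists_bounds
  refine ⟨20, prog, fBuildAll, fUpdateAll, fSolve, ⟨8 * C + 4 * A + 729 * (4 * C + 3000) + 20002, 6,
    fun ps qs _ _ => ?_⟩, ⟨20 * C + 4000000002, 6, fun I D hD => ?_⟩⟩
  · obtain ⟨_, t, h1, D, rfl, h2, h3, h4⟩ := (buildAll_spec hU hA ps qs).runs
    refine ⟨_, _, h1, ?_, fun us => ?_⟩
    · have h5 : 1 ≤ (ps.length + qs.length + 1) * lg (ps.length + qs.length) ^ 6 :=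
        Nat.mul_pos (by omega) (pow_pos (RTree.one_le_lg _) _)
      calc t + 2 ≤ (8 * C + 4 * A + 20002) *
            ((ps.length + qs.length + 1) * lg (ps.length + qs.length) ^ 6) := by
            have : (8 * C + 4 * A + 20002) *
              ((ps.length + qs.length + 1) * lg (ps.length + qs.length) ^ 6) =
              (8 * C + 4 * A + 20000) *
                ((ps.length + qs.length + 1) * lg (ps.length + qs.length) ^ 6) +
              2 * ((ps.length + qs.length + 1) * lg (ps.length + qs.length) ^ 6) := by ring
            omega
        _ ≤ _ := Nat.mul_le_mul_right _ (by omega)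
    · obtain ⟨D', t', h5, -, h6⟩ := exists_updateRun hU us h2
      refine ⟨_, t', h5, ?_⟩
      calc t' ≤ (729 * (4 * C + 3000) + 2) * sumLg 6 (QInstance.ofLists ps qs) us := by omega
        _ ≤ _ := Nat.mul_le_mul_right _ (by omega)
  · obtain ⟨ps, qs, us, D₀, t₀, t, -, -, hb, hu, rfl⟩ := hD
    obtain ⟨_, _, h1, D₁, rfl, h2, -⟩ := (buildAll_spec hU hA ps qs).runs
    -- By determinism the given state is the encoded forest of the analysis, both after the
    -- construction and after the updates.
    obtain ⟨rfl, -⟩ := hb.det h1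
    obtain ⟨D₂, _, h3, h4, -⟩ := exists_updateRun hU us h2
    obtain ⟨rfl, -⟩ := hu.det h3
    set I := us.foldl QInstance.apply (QInstance.ofLists ps qs)
    obtain ⟨C₀, hC₀, hC, hopt⟩ := exists_opt I
    obtain ⟨_, τ, h5, l, rfl, h6, h7, h8, h9⟩ := (solve_spec hU h4 hC₀ hC).runs
    rw [hopt] at h8 h9
    have h10 : τ + 2 ≤
        (20 * C + 4000000002) * ((opt I.coverable I.quads + 1) * lg I.size ^ 6) := by
      have : 1 ≤ (opt I.coverable I.quads + 1) * lg I.size ^ 6 :=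
        Nat.mul_pos (by omega) (pow_pos (RTree.one_le_lg _) _)
      have : (20 * C + 4000000002) * ((opt I.coverable I.quads + 1) * lg I.size ^ 6) =
        (20 * C + 4000000000) * ((opt I.coverable I.quads + 1) * lg I.size ^ 6) +
          2 * ((opt I.coverable I.quads + 1) * lg I.size ^ 6) := by ring
      omega
    refine ⟨fun h => ?_, fun h => ?_⟩
    · rw [if_pos h] at h5
      rw [coverable_eq h] at h7 h8 h10
      exact ⟨l, _, h5, h6, h7, h8, h10⟩
    · rw [if_neg h] at h5
      exact ⟨_, h5, h10⟩
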